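/- Let $n,d\in\mathbb N$. For a probability measure $P_X$ on $\mathbb R^d$, $\theta\in\mathbb R^d$ and $\sigma>0$, let $P_{\theta,\sigma}$ be the law of $(Y,X)$, where $Y=X^\top\theta+\epsilon$ with $X\sim P_X$ and $\epsilon\sim N(0,\sigma^2)$ independent. For $\alpha\in(0,1)$ let $$D_\alpha(P,R)=\frac1{\alpha-1}\log\int\Big(\frac{dP}{d\mu}\Big)^{\alpha}\Big(\frac{dR}{d\mu}\Big)^{1-\alpha}d\mu$$ be the $\alpha$-Rényi divergence ($\mu$ any measure dominating $P$ and $R$). Let $\|\theta\|_0$ be the number of non-zero entries of $\theta$ and $\|\theta\|_1$ its $\ell_1$ norm. Prior: $\theta$ and $\sigma$ are independent; $\theta$ has density proportional to $\prod_{i=1}^d(\tau^2+\theta_i^2)^{-2}$ on the ball $\{\|\theta\|_1\le C_1\}$, with $\tau=1/(C_{\rm x}\sqrt{nd})$; and $\sigma^2$ has the inverse-gamma law $IG(a,b)$ with density $\frac{b^a}{\Gamma(a)}x^{-a-1}e^{-b/x}$ on $(0,\infty)$, where $a,b>0$ are fixed. Given observations $(Y_i,X_i)_{i=1}^n$, the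 (regular) posterior is $$\Pi_n(d\theta,d\sigma)\propto\prod_{i=1}^n\frac{1}{\sqrt{2\pi\sigma^2}}\,e^{-(Y_i-X_i^\top\theta)^2/(2\sigma^2)}\;\pi(d\theta,d\sigma).$$ Theorem. For all $\sigma_{\min},\sigma_{\max},a,b>0$ there is a constant $c>0$, depending only on $\sigma_{\min},\sigma_{\max},a,b$, such that the following holds. Let $n<d$, $C_{\rm x}>0$, $C_1\in\mathbb R$, let $P_X$ be any probability measure on $\mathbb R^d$ with $\mathbb E\|X_1\|_2^2<C_{\rm x}^2$, let $\sigma_0>0$ with $(2\sigma_{\min})^{-1}<\sigma_0^2<(2\sigma_{\max})^{-1}$, and let $\theta_0\in\mathbb R^d$ with $s^*=\|\theta_0\|_0$ satisfy $1\le s^*<n$ and $\|\theta_0\|_1\le C_1-2d\tau$. Let $(Y_i,X_i)_{i=1}^n$ be i.i.d. from $P_{\theta_0,\sigma_0}$, and put $$\varepsilon_n=\frac{c\,s^*}{n}\log\Big(\frac{C_{\rm x}C_1\sqrt{nd}}{s^*}\Big).$$ Then, for every $\alpha\in(0,1)$, $$\mathbb E\Big[\int D_\alpha(P_{\theta,\sigma},P_{\theta_0,\sigma_0})\,\Pi_n(d\theta,d\sigma)\Big]\le\frac{1+\alpha}{1-\alpha}\,\varepsilon_n$$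 and $$\mathbb P\Big[\int D_\alpha(P_{\theta,\sigma},P_{\theta_0,\sigma_0})\,\Pi_n(d\theta,d\sigma)\le\frac{2(\alpha+1)}{1-\alpha}\,\varepsilon_n\Big]\ge1-\frac{2}{n\varepsilon_n}.$$ -/

import Mathlib

open MeasureTheory ProbabilityTheory
open scoped ENNReal NNReal

noncomputable section

namespace SparseReg

/-! ### Rényi divergence -/

/-- The integral `∫ (dP/dμ)^α (dR/dμ)^(1-α) dμ`, for the dominating measure `μ = P + R`. -/
def renyiIntegral {Ω : Type*} [MeasurableSpace Ω] (α : ℝ) (P R : Measure Ω) : ℝ≥0∞ :=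
  ∫⁻ x, (P.rnDeriv (P + R) x) ^ α * (R.rnDeriv (P + R) x) ^ (1 - α) ∂(P + R)

/-- The `α`-Rényi divergence `(α - 1)⁻¹ log ∫ (dP/dμ)^α (dR/dμ)^(1-α) dμ`, with values in the
extended reals (it is `+∞` when the integral is `0`, for `α ∈ (0,1)`). -/
def renyiDiv {Ω : Type*} [MeasurableSpace Ω] (α : ℝ) (P R : Measure Ω) : EReal :=
  (((α - 1)⁻¹ : ℝ) : EReal) * ENNReal.log (renyiIntegral α P R)

/-! ### The linear regression model with random design -/

/-- The law `P_{θ,σ}` of `Z = (Y, X)`, where `Y = Xᵀθ + ε` with `X ∼ PX` and `ε ∼ N(0, σ²)`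
independent. -/
def regModel {d : ℕ} (PX : Measure (EuclideanSpace ℝ (Fin d))) (θ : EuclideanSpace ℝ (Fin d))
    (σ : ℝ) : Measure (ℝ × EuclideanSpace ℝ (Fin d)) :=
  (PX.prod (gaussianReal 0 (Real.toNNReal (σ ^ 2)))).map
    (fun p => (inner ℝ p.1 θ + p.2, p.1))

/-- The likelihood `L_n(θ, σ) = ∏ᵢ p_{θ,σ}(Yᵢ, Xᵢ)`, where `p_{θ,σ}` is the density of `P_{θ,σ}`
with respect to the product of Lebesgue measure and the law of the design, i.e. the `N(Xᵀθ, σ²)`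
density at `Y`. -/
def likelihood {d n : ℕ} (z : Fin n → ℝ × EuclideanSpace ℝ (Fin d))
    (p : EuclideanSpace ℝ (Fin d) × ℝ) : ℝ≥0∞ :=
  ∏ i, gaussianPDF (inner ℝ (z i).2 p.1) (Real.toNNReal (p.2 ^ 2)) (z i).1

/-! ### Norms and sparsity -/

/-- The `ℓ₁` norm. -/
def l1Norm {d : ℕ} (θ : EuclideanSpace ℝ (Fin d)) : ℝ := ∑ i, |θ i|

/-- The `ℓ₀` quasi-norm: the number of non-zero entries. -/
def l0Norm {d : ℕ} (θ : EuclideanSpace ℝ (Fin d)) : ℕ :=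
  (Finset.univ.filter fun i => θ i ≠ 0).card

/-! ### Prior and posterior -/

/-- A measure divided by its total mass. -/
def normalize {Ω : Type*} [MeasurableSpace Ω] (μ : Measure Ω) : Measure Ω :=
  (μ Set.univ)⁻¹ • μ

/-- The scaled Student prior: the probability measure on the `ℓ₁` ball of radius `C₁` with density
proportional to `∏ᵢ (τ² + θᵢ²)⁻²`. -/
def priorTheta (d : ℕ) (C₁ τ : ℝ) : Measure (EuclideanSpace ℝ (Fin d)) :=
  normalize
    ((volume.restrict {θ : EuclideanSpace ℝ (Fin d) | l1Norm θ ≤ C₁}).withDensity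
      fun θ => ENNReal.ofReal (∏ i, ((τ ^ 2 + θ i ^ 2) ^ 2)⁻¹))

/-- The inverse-gamma distribution `IG(a, b)`, with density `b^a / Γ(a) x^(-a-1) e^(-b/x)` on
`(0, ∞)`. -/
def invGamma (a b : ℝ) : Measure ℝ :=
  (volume.restrict (Set.Ioi 0)).withDensity
    fun x => ENNReal.ofReal (b ^ a / Real.Gamma a * x ^ (-a - 1) * Real.exp (-b / x))

/-- The prior on `σ`, under which `σ > 0` and `σ² ∼ IG(a, b)`. -/
def priorSigma (a b : ℝ) : Measure ℝ := (invGamma a b).map Real.sqrt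

/-- The joint prior of `(θ, σ)`: independent components. -/
def prior (d : ℕ) (C₁ τ a b : ℝ) : Measure (EuclideanSpace ℝ (Fin d) × ℝ) :=
  (priorTheta d C₁ τ).prod (priorSigma a b)

/-- The (regular) posterior `Π_n(dθ, dσ) ∝ L_n(θ, σ) π(dθ, dσ)`. -/
def posterior {d n : ℕ} (C₁ τ a b : ℝ) (z : Fin n → ℝ × EuclideanSpace ℝ (Fin d)) :
    Measure (EuclideanSpace ℝ (Fin d) × ℝ) :=
  normalize ((prior d C₁ τ a b).withDensity (likelihood z))

/-- The value `τ = 1 / (C_x √(nd))` of the prior scale. -/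
def tauScale (n d : ℕ) (Cx : ℝ) : ℝ := 1 / (Cx * Real.sqrt (n * d))

/-- The rate `ε_n = c s log (C_x C₁ √(nd) / s) / n`. -/
def rate (c : ℝ) (n d s : ℕ) (Cx C₁ : ℝ) : ℝ :=
  c * s * Real.log (Cx * C₁ * Real.sqrt (n * d) / s) / n

/-- The posterior mean `∫ D_α(P_{θ,σ}, P_{θ₀,σ₀}) Π_n(dθ, dσ)`; the Rényi divergence of probability
measures is non-negative (`renyiDiv_nonneg`), so it is integrated as a function with values in
`[0, ∞]`. -/
def posteriorRisk {d n : ℕ} (α : ℝ) (PX : Measure (EuclideanSpace ℝ (Fin d)))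
    (θ₀ : EuclideanSpace ℝ (Fin d)) (σ₀ C₁ τ a b : ℝ)
    (z : Fin n → ℝ × EuclideanSpace ℝ (Fin d)) : ℝ≥0∞ :=
  ∫⁻ p, (renyiDiv α (regModel PX p.1 p.2) (regModel PX θ₀ σ₀)).toENNReal
    ∂(posterior C₁ τ a b z)

/-! ### Sanity facts on the Rényi divergence -/

/-- The integral does not depend on the dominating measure. -/
theorem renyiIntegral_eq {Ω : Type*} [MeasurableSpace Ω] {α : ℝ} (h0 : 0 < α) (h1 : α < 1)
    (P R μ : Measure Ω) [IsFiniteMeasure P] [IsFiniteMeasure R] [SigmaFinite μ]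
    (hP : P ≪ μ) (hR : R ≪ μ) :
    renyiIntegral α P R = ∫⁻ x, (P.rnDeriv μ x) ^ α * (R.rnDeriv μ x) ^ (1 - α) ∂μ := by
  have hS : P + R ≪ μ := by
    intro s hs
    simp [hP hs, hR hs]
  have hPS : P ≪ P + R := Measure.AbsolutelyContinuous.rfl.add_right R
  have hRS : R ≪ P + R := by
    rw [add_comm]; exact Measure.AbsolutelyContinuous.rfl.add_right P
  have e : renyiIntegral α P R = ∫⁻ x, (P + R).rnDeriv μ x *
      ((P.rnDeriv (P + R) x) ^ α * (R.rnDeriv (P + R) x) ^ (1 - α)) ∂μ := by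
    rw [lintegral_rnDeriv_mul hS (by fun_prop)]
    rfl
  rw [e]
  apply lintegral_congr_ae
  filter_upwards [Measure.rnDeriv_mul_rnDeriv (κ := μ) hPS,
    Measure.rnDeriv_mul_rnDeriv (κ := μ) hRS, (P + R).rnDeriv_lt_top μ] with x hx hy hf
  rw [← hx, ← hy, Pi.mul_apply, Pi.mul_apply, ENNReal.mul_rpow_of_nonneg _ _ h0.le,
    ENNReal.mul_rpow_of_nonneg _ _ (by linarith : 0 ≤ 1 - α)]
  have : (P + R).rnDeriv μ x
      = ((P + R).rnDeriv μ x) ^ α * ((P + R).rnDeriv μ x) ^ (1 - α) := by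
    rw [← ENNReal.rpow_add_of_nonneg _ _ h0.le (by linarith)]
    simp
  nth_rewrite 1 [this]
  ring

theorem renyiIntegral_le_one {Ω : Type*} [MeasurableSpace Ω] {α : ℝ} (h0 : 0 < α) (h1 : α < 1)
    (P R : Measure Ω) [IsProbabilityMeasure P] [IsProbabilityMeasure R] :
    renyiIntegral α P R ≤ 1 := by
  unfold renyiIntegral
  refine (ENNReal.lintegral_mul_norm_pow_le (by fun_prop) (by fun_prop) h0.le (by linarith)
    (by ring)).trans ?_
  have hP : ∫⁻ x, P.rnDeriv (P + R) x ∂(P + R) ≤ 1 :=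
    (Measure.lintegral_rnDeriv_le).trans (by simp)
  have hR : ∫⁻ x, R.rnDeriv (P + R) x ∂(P + R) ≤ 1 :=
    (Measure.lintegral_rnDeriv_le).trans (by simp)
  exact mul_le_one' (ENNReal.rpow_le_one hP h0.le) (ENNReal.rpow_le_one hR (by linarith))

theorem renyiDiv_nonneg {Ω : Type*} [MeasurableSpace Ω] {α : ℝ} (h0 : 0 < α) (h1 : α < 1)
    (P R : Measure Ω) [IsProbabilityMeasure P] [IsProbabilityMeasure R] :
    0 ≤ renyiDiv α P R := by
  unfold renyiDiv
  have hl : ENNReal.log (renyiIntegral α P R) ≤ 0 := by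
    rw [← ENNReal.log_one]
    exact ENNReal.log_monotone (renyiIntegral_le_one h0 h1 P R)
  have hc : (((α - 1)⁻¹ : ℝ) : EReal) ≤ 0 := by
    exact_mod_cast inv_nonpos.mpr (by linarith)
  exact EReal.mul_nonneg_iff.mpr (Or.inr ⟨hc, hl⟩)

end SparseReg

end

/-!
The posterior is normalized through the likelihood ratios against the true density, and the Rényi
divergences of all orders are at most `2 / (1 - α)` times one loss, `J = -log ρ`, with `ρ` the
Hellinger affinity of `P_{θ,σ}` and `P_{θ₀,σ₀}` (`toENNReal_renyiDiv_le`). With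
`S = s log (C_x C₁ √(nd) / s)`, the theorem follows from the bound `n ∫ J dΠ ≤ C S + W`, where
`E W ≤ 1` (`exists_posterior_loss_le`), the probability statement by Markov's inequality.

By the entropy inequality (`lintegral_normalize_le`), the posterior mean of a function `g` is at
most the sum of minus the logarithm of the evidence `∫ L dπ`, for `L` the likelihood ratio of the
sample, and a small power of the exponential moment `∫ e^g L dπ`. The evidence is bounded below by
`e^{-C S - V}` with a small `V ≥ 0` (`exists_evidence_ge`): the Student density moves to `θ₀` at the
price of a polynomial factor per entry of the support, and symmetrizing the perturbation removes the
linear noise term.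

The posterior is not tempered, so exponential moments need more than Jensen's inequality. Two
devices provide them.

* A mixture of products of densities is bounded one observation at a time by the worst mixture of
  single densities (`lintegral_mixture_rpow_le`). A mixture over a small cell of the parameter space
  is nearly as far from the truth as the centre of the cell, because the affinity is concave
  (`lintegral_mixture_le_of_near`); for cells with a very small noise level it is nearly singular to
  the truth (`lintegral_mixture_le_of_concentrated`). The powers `9 / 10` of the cell masses are
  summed over a grid in `ℝ^d` of mesh `τ (d / s)^{2/5}`. Since the Student
  distribution has cubic tails, so that most entries round to `0`, this costs only `e^{C S}`
  (`exists_tsum_stuPi_cell_le`); the parameters with too large a rounding error have prior mass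
  `e^{-A S}`, for `A` as large as desired (`prior_sieve_compl_le`).
* Where the loss is large, a crude bound suffices: the unbounded noise factor of the likelihood
  ratio is split off by Hölder's inequality, and the remaining factor integrates to `e^{-J}` per
  observation, up to a power of `σ₀ / σ` which the inverse-gamma prior integrates
  (`lintegral_rough_le`). This covers losses above a multiple of `log n` for all parameters, and
  losses above a constant when `σ` is not too small.

What remains is a loss of at most order `log n` on the parameters outside the sieve or with very
small noise level. Their posterior mass is exponentially small in `S` on the event `V ≤ K S`. Off
this event only the trivial bound is available, but `E V ≤ K₀ / d`, while `n < d` and `log n ≤ 2 S`.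
When `log n` is of smaller order than `1 + S / n` the sieve is not fine enough for this, but then
`n log n` is itself of order `S`.
-/

noncomputable section

namespace SparseReg

/-! ### Product measures and sums of powers -/

theorem lintegral_pi_succ {Z : Type*} [MeasurableSpace Z] (P : Measure Z) [SigmaFinite P] {n : ℕ}
    {f : (Fin (n + 1) → Z) → ℝ≥0∞} (hf : Measurable f) :
    ∫⁻ z, f z ∂(Measure.pi fun _ : Fin (n + 1) => P)
      = ∫⁻ y, ∫⁻ a, f (Fin.cons a y) ∂P ∂(Measure.pi fun _ : Fin n => P) := by
  have h := (measurePreserving_piFinSuccAbove (fun _ : Fin (n + 1) => P) 0).symm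
  rw [← h.lintegral_comp hf, lintegral_prod_symm]
  · simp [MeasurableEquiv.piFinSuccAbove, Fin.insertNthEquiv]
  · exact (hf.comp (MeasurableEquiv.measurable _)).aemeasurable

theorem lintegral_pi_prod {Z : Type*} [MeasurableSpace Z] (P : Measure Z) [SigmaFinite P] (n : ℕ)
    {f : Fin n → Z → ℝ≥0∞} (hf : ∀ i, Measurable (f i)) :
    ∫⁻ z, ∏ i, f i (z i) ∂(Measure.pi fun _ : Fin n => P) = ∏ i, ∫⁻ a, f i a ∂P := by
  induction n with
  | zero => simp
  | succ n ih =>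
    rw [lintegral_pi_succ P (by fun_prop)]
    simp only [Fin.prod_univ_succ, Fin.cons_zero, Fin.cons_succ]
    simp_rw [lintegral_mul_const _ (hf 0)]
    rw [lintegral_const_mul _ (by fun_prop), ih fun i => hf i.succ]

theorem tsum_rpow_le {ι : Type*} (a : ι → ℝ≥0∞) {β : ℝ} (h0 : 0 < β) (h1 : β ≤ 1) :
    (∑' i, a i) ^ β ≤ ∑' i, a i ^ β := by
  have hfin : ∀ s : Finset ι, (∑ i ∈ s, a i) ^ β ≤ ∑ i ∈ s, a i ^ β := by
    classical
    intro s
    induction s using Finset.induction with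
    | empty => simp [h0]
    | insert i s hi ih =>
      rw [Finset.sum_insert hi, Finset.sum_insert hi]
      exact (ENNReal.rpow_add_le_add_rpow _ _ h0.le h1).trans (by gcongr)
  refine le_of_tendsto ((ENNReal.continuous_rpow_const (y := β)).tendsto _ |>.comp
    ENNReal.summable.hasSum) (Filter.Eventually.of_forall fun s => ?_)
  exact (hfin s).trans (ENNReal.sum_le_tsum s)

theorem tsum_pi_prod {ι : Type*} (f : ι → ℝ≥0∞) (d : ℕ) :
    ∑' z : Fin d → ι, ∏ j, f (z j) = (∑' i, f i) ^ d := by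
  induction d with
  | zero => simp
  | succ d ih =>
    rw [← (Fin.consEquiv fun _ : Fin (d + 1) => ι).tsum_eq, ENNReal.tsum_prod']
    simp only [Fin.consEquiv_apply, Fin.prod_univ_succ, Fin.cons_zero, Fin.cons_succ]
    simp_rw [ENNReal.tsum_mul_left, ih, ENNReal.tsum_mul_right]
    rw [pow_succ, mul_comm]

/-! ### Mixtures of product likelihoods -/

/-- If no mixture of the likelihood ratios `k θ`, `θ ∼ ν'` with `ν' ≪ ν`, has a `β`-affinity
with `P` above `R`, then the integrated product likelihood ratio has `β`-moment at most
`R ^ n` times the power of the mass of `ν`: the observations are integrated out one at a time, the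
remaining factors being put into the mixing measure. -/
theorem lintegral_mixture_rpow_le {T Z : Type*} [MeasurableSpace T] [MeasurableSpace Z]
    (P : Measure Z) [SigmaFinite P] (ν : Measure T) [SFinite ν] {k : T → Z → ℝ≥0∞}
    (hk : Measurable (Function.uncurry k)) {β : ℝ} (hβ : 0 < β) {R : ℝ≥0∞} (hR : R ≠ 0)
    (H : ∀ g : T → ℝ≥0∞, Measurable g → ∫⁻ t, g t ∂ν = 1 →
      ∫⁻ z, (∫⁻ t, k t z * g t ∂ν) ^ β ∂P ≤ R) (n : ℕ) :
    ∫⁻ z, (∫⁻ t, ∏ i, k t (z i) ∂ν) ^ β ∂(Measure.pi fun _ : Fin n => P)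
      ≤ R ^ n * ν Set.univ ^ β := by
  -- the one-step bound for a density of any mass
  have H' : ∀ g : T → ℝ≥0∞, Measurable g →
      ∫⁻ z, (∫⁻ t, k t z * g t ∂ν) ^ β ∂P ≤ R * (∫⁻ t, g t ∂ν) ^ β := by
    intro g hg
    rcases eq_or_ne (∫⁻ t, g t ∂ν) 0 with h0 | h0
    · have : ∀ z, ∫⁻ t, k t z * g t ∂ν = 0 := fun z => by
        rw [lintegral_eq_zero_iff hg] at h0
        rw [← lintegral_zero (μ := ν)]
        apply lintegral_congr_ae
        filter_upwards [h0] with t ht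
        simp [ht]
      simp [this, hβ]
    rcases eq_or_ne (∫⁻ t, g t ∂ν) ∞ with hT | hT
    · rw [hT, ENNReal.top_rpow_of_pos hβ, ENNReal.mul_top hR]
      exact le_top
    set G := ∫⁻ t, g t ∂ν with hG
    have h1 : ∫⁻ t, g t * G⁻¹ ∂ν = 1 := by
      rw [lintegral_mul_const _ hg, ← hG, ENNReal.mul_inv_cancel h0 hT]
    have h2 := H _ (hg.mul_const G⁻¹) h1
    have h3 : ∀ z, (∫⁻ t, k t z * g t ∂ν) ^ β
        = (∫⁻ t, k t z * (g t * G⁻¹) ∂ν) ^ β * G ^ β := fun z => by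
      rw [← ENNReal.mul_rpow_of_nonneg _ _ hβ.le, ← lintegral_mul_const']
      · simp_rw [← mul_assoc]
        simp_rw [mul_assoc (k _ z * g _), ENNReal.inv_mul_cancel h0 hT, mul_one]
      · exact hT
    simp_rw [h3]
    rw [lintegral_mul_const' _ _ (ENNReal.rpow_ne_top_of_nonneg hβ.le hT)]
    gcongr
  have main : ∀ g : T → ℝ≥0∞, Measurable g →
      ∫⁻ z, (∫⁻ t, (∏ i, k t (z i)) * g t ∂ν) ^ β ∂(Measure.pi fun _ : Fin n => P)
        ≤ R ^ n * (∫⁻ t, g t ∂ν) ^ β := by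
    have hki : ∀ (m : ℕ) (i : Fin m), Measurable fun p : (Fin m → Z) × T => k p.2 (p.1 i) :=
      fun m i => hk.comp (measurable_snd.prodMk ((measurable_pi_apply i).comp measurable_fst))
    induction n with
    | zero => intro g hg; simp
    | succ n ih =>
      intro g hg
      have hm : ∀ m : ℕ, Measurable fun z : Fin m → Z =>
          (∫⁻ t, (∏ i, k t (z i)) * g t ∂ν) ^ β := fun m => by
        refine Measurable.pow_const (Measurable.lintegral_prod_right' (f := fun p : (Fin m → Z) × T
          => (∏ i, k p.2 (p.1 i)) * g p.2) ?_) β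
        exact (Finset.measurable_prod _ fun i _ => hki m i).mul (hg.comp measurable_snd)
      rw [lintegral_pi_succ P (hm _)]
      calc _ ≤ ∫⁻ y, R * (∫⁻ t, (∏ i, k t (y i)) * g t ∂ν) ^ β
              ∂(Measure.pi fun _ : Fin n => P) := by
            refine lintegral_mono fun y => ?_
            simp only [Fin.prod_univ_succ, Fin.cons_zero, Fin.cons_succ, mul_assoc]
            refine H' (fun t => (∏ i, k t (y i)) * g t) ?_
            exact (Finset.measurable_prod _ fun i _ => hk.comp
              (measurable_id.prodMk measurable_const)).mul hg
        _ ≤ R ^ (n + 1) * (∫⁻ t, g t ∂ν) ^ β := by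
            rw [lintegral_const_mul _ (hm _), pow_succ', mul_assoc]
            gcongr
            exact ih g hg
  simpa using main 1 measurable_one

/-! ### Hellinger affinity of a mixture -/

/-- The Hellinger affinity `∫ √f √g dμ` of two densities. -/
def affinity {Z : Type*} [MeasurableSpace Z] (μ : Measure Z) (f g : Z → ℝ≥0∞) : ℝ≥0∞ :=
  ∫⁻ z, f z ^ (1 / 2 : ℝ) * g z ^ (1 / 2 : ℝ) ∂μ

theorem sqrt_mul_self' (a : ℝ≥0∞) : a ^ (1 / 2 : ℝ) * a ^ (1 / 2 : ℝ) = a := by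
  rw [← ENNReal.rpow_add_of_nonneg _ _ (by norm_num) (by norm_num)]
  norm_num

theorem sq_expand_le (a b e : ℝ≥0∞) :
    4 * (a * e) + 4 * (e * b) ≤ a * a + 4 * (e * e) + b * b + 2 * (a * b) := by
  induction a with
  | top => simp
  | coe a =>
    induction b with
    | top => simp
    | coe b =>
      induction e with
      | top => simp
      | coe e =>
        norm_cast
        rw [← NNReal.coe_le_coe]
        push_cast
        nlinarith [sq_nonneg ((a : ℝ) + b - 2 * e)]

section Affinity

variable {T Z : Type*} [MeasurableSpace T] [MeasurableSpace Z]

/-- The triangle inequality for the Hellinger distance, up to constants. -/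
theorem affinity_triangle (μ : Measure Z) {f q g : Z → ℝ≥0∞} (hf : Measurable f)
    (hq : Measurable q) (hg : Measurable g) (hf1 : ∫⁻ z, f z ∂μ ≤ 1) (hq1 : ∫⁻ z, q z ∂μ ≤ 1)
    (hg1 : ∫⁻ z, g z ∂μ ≤ 1) :
    4 * affinity μ f q + 4 * affinity μ q g ≤ 6 + 2 * affinity μ f g := by
  unfold affinity
  calc _ = ∫⁻ z, 4 * (f z ^ (1 / 2 : ℝ) * q z ^ (1 / 2 : ℝ))
          + 4 * (q z ^ (1 / 2 : ℝ) * g z ^ (1 / 2 : ℝ)) ∂μ := by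
        rw [lintegral_add_left (by fun_prop), lintegral_const_mul _ (by fun_prop),
          lintegral_const_mul _ (by fun_prop)]
    _ ≤ ∫⁻ z, f z + 4 * q z + g z + 2 * (f z ^ (1 / 2 : ℝ) * g z ^ (1 / 2 : ℝ)) ∂μ := by
        refine lintegral_mono fun z => ?_
        have := sq_expand_le (f z ^ (1 / 2 : ℝ)) (g z ^ (1 / 2 : ℝ)) (q z ^ (1 / 2 : ℝ))
        simpa only [sqrt_mul_self'] using this
    _ ≤ 1 + 4 * 1 + 1 + 2 * ∫⁻ z, f z ^ (1 / 2 : ℝ) * g z ^ (1 / 2 : ℝ) ∂μ := by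
        rw [lintegral_add_left (by fun_prop), lintegral_add_left (by fun_prop),
          lintegral_add_left (by fun_prop), lintegral_const_mul _ (by fun_prop),
          lintegral_const_mul _ (by fun_prop)]
        gcongr
    _ = _ := by norm_num

theorem affinity_comm (μ : Measure Z) (f g : Z → ℝ≥0∞) : affinity μ f g = affinity μ g f := by
  unfold affinity
  simp_rw [mul_comm]

theorem lintegral_mixture_le_one {μ : Measure Z} [SFinite μ] {ν : Measure T} [SFinite ν]
    {p : T → Z → ℝ≥0∞} (hp : Measurable (Function.uncurry p)) {g : T → ℝ≥0∞} (hg : Measurable g)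
    (hg1 : ∫⁻ t, g t ∂ν = 1) (hp1 : ∀ᵐ t ∂ν, ∫⁻ z, p t z ∂μ ≤ 1) :
    ∫⁻ z, ∫⁻ t, p t z * g t ∂ν ∂μ ≤ 1 := by
  have hm : Measurable fun a : Z × T => p a.2 a.1 * g a.2 :=
    (hp.comp measurable_swap).mul (hg.comp measurable_snd)
  rw [lintegral_lintegral_swap hm.aemeasurable]
  calc _ ≤ ∫⁻ t, g t ∂ν := by
        refine lintegral_mono_ae (hp1.mono fun t ht => ?_)
        have hpt : Measurable (p t) := hp.comp measurable_prodMk_left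
        rw [lintegral_mul_const _ hpt]
        exact mul_le_of_le_one_left' ht
    _ = 1 := hg1

/-- By concavity of the square root, a mixture of densities close to `f` is close to `f`. -/
theorem one_le_affinity_mixture {μ : Measure Z} [SFinite μ] {ν : Measure T} [SFinite ν]
    {p : T → Z → ℝ≥0∞} (hp : Measurable (Function.uncurry p)) {f : Z → ℝ≥0∞} (hf : Measurable f)
    {g : T → ℝ≥0∞} (hg : Measurable g) (hg1 : ∫⁻ t, g t ∂ν = 1) {u : ℝ≥0∞}
    (hu : ∀ᵐ t ∂ν, 1 ≤ affinity μ f (p t) + u) :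
    1 ≤ affinity μ f (fun z => ∫⁻ t, p t z * g t ∂ν) + u := by
  have hm : Measurable fun a : Z × T =>
      f a.1 ^ (1 / 2 : ℝ) * p a.2 a.1 ^ (1 / 2 : ℝ) * g a.2 :=
    ((hf.comp measurable_fst).pow_const _ |>.mul ((hp.comp measurable_swap).pow_const _)).mul
      (hg.comp measurable_snd)
  calc (1 : ℝ≥0∞) = ∫⁻ t, g t ∂ν := hg1.symm
    _ ≤ ∫⁻ t, affinity μ f (p t) * g t + u * g t ∂ν := by
        refine lintegral_mono_ae (hu.mono fun t ht => ?_)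
        rw [← add_mul]
        exact le_mul_of_one_le_left' ht
    _ = ∫⁻ t, affinity μ f (p t) * g t ∂ν + u := by
        rw [lintegral_add_right _ (hg.const_mul u), lintegral_const_mul _ hg, hg1, mul_one]
    _ ≤ _ := by
        gcongr
        have e : ∀ t, affinity μ f (p t) * g t
            = ∫⁻ z, f z ^ (1 / 2 : ℝ) * p t z ^ (1 / 2 : ℝ) * g t ∂μ := fun t => by
          rw [affinity, lintegral_mul_const]
          exact (hf.pow_const _).mul ((hp.comp measurable_prodMk_left).pow_const _)
        simp_rw [e]
        rw [← lintegral_lintegral_swap hm.aemeasurable]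
        refine lintegral_mono fun z => ?_
        simp_rw [mul_assoc]
        have hpz : Measurable fun t => p t z := hp.comp measurable_prodMk_right
        have hpg : Measurable fun t => p t z ^ (1 / 2 : ℝ) * g t := (hpz.pow_const _).mul hg
        rw [lintegral_const_mul _ hpg]
        gcongr
        have h := ENNReal.lintegral_mul_norm_pow_le (μ := ν) (hpz.mul hg).aemeasurable
          hg.aemeasurable (p := 1 / 2) (q := 1 / 2) (by norm_num) (by norm_num) (by norm_num)
        rw [hg1, ENNReal.one_rpow, mul_one] at h
        refine le_trans (lintegral_mono fun t => ?_) h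
        rw [Pi.mul_apply, ENNReal.mul_rpow_of_nonneg _ _ (by norm_num), mul_assoc, sqrt_mul_self']

/-- A mixture of densities close to `f` is about as far from `p₀` as `f` is. -/
theorem affinity_mixture_le {μ : Measure Z} [SFinite μ] {ν : Measure T} [SFinite ν]
    {p : T → Z → ℝ≥0∞} (hp : Measurable (Function.uncurry p)) {f p₀ : Z → ℝ≥0∞}
    (hf : Measurable f) (hp₀ : Measurable p₀) (hf1 : ∫⁻ z, f z ∂μ ≤ 1) (hp₀1 : ∫⁻ z, p₀ z ∂μ ≤ 1)
    {g : T → ℝ≥0∞} (hg : Measurable g) (hg1 : ∫⁻ t, g t ∂ν = 1) {u : ℝ≥0∞}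
    (hp1 : ∀ᵐ t ∂ν, ∫⁻ z, p t z ∂μ ≤ 1) (hu : ∀ᵐ t ∂ν, 1 ≤ affinity μ f (p t) + u) :
    4 * affinity μ (fun z => ∫⁻ t, p t z * g t ∂ν) p₀ ≤ 2 + 2 * affinity μ f p₀ + 4 * u := by
  have hm : Measurable fun z => ∫⁻ t, p t z * g t ∂ν :=
    Measurable.lintegral_prod_right' (f := fun a : Z × T => p a.2 a.1 * g a.2)
      ((hp.comp measurable_swap).mul (hg.comp measurable_snd))
  have h1 := affinity_triangle μ hf hm hp₀ hf1 (lintegral_mixture_le_one hp hg hg1 hp1) hp₀1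
  have h2 := one_le_affinity_mixture hp hf hg hg1 hu
  set A := affinity μ f (fun z => ∫⁻ t, p t z * g t ∂ν)
  set Q := affinity μ (fun z => ∫⁻ t, p t z * g t ∂ν) p₀
  have h3 : 4 + 4 * Q ≤ 4 + (2 + 2 * affinity μ f p₀ + 4 * u) := by
    calc 4 + 4 * Q ≤ 4 * (A + u) + 4 * Q := by
          gcongr
          calc (4 : ℝ≥0∞) = 4 * 1 := (mul_one _).symm
            _ ≤ _ := by gcongr
      _ = (4 * A + 4 * Q) + 4 * u := by ring
      _ ≤ (6 + 2 * affinity μ f p₀) + 4 * u := by gcongr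
      _ = _ := by
          rw [← add_assoc, ← add_assoc]
          norm_num
  exact (ENNReal.add_le_add_iff_left (by norm_num)).1 h3

/-- Hölder's inequality, from `1 / 10 = (1 / 2) (1 / 5)`. -/
theorem rpow_mul_rpow_le_affinity (μ : Measure Z) {q p₀ : Z → ℝ≥0∞} (hq : Measurable q)
    (hp₀ : Measurable p₀) (hq1 : ∫⁻ z, q z ∂μ ≤ 1) :
    ∫⁻ z, q z ^ (9 / 10 : ℝ) * p₀ z ^ (1 / 10 : ℝ) ∂μ ≤ affinity μ q p₀ ^ (1 / 5 : ℝ) := by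
  have h := ENNReal.lintegral_mul_norm_pow_le (μ := μ)
    (f := fun z => q z ^ (1 / 2 : ℝ) * p₀ z ^ (1 / 2 : ℝ)) (g := q) (by fun_prop)
    (by fun_prop) (p := 1 / 5) (q := 4 / 5) (by norm_num) (by norm_num) (by norm_num)
  calc _ = ∫⁻ z, (q z ^ (1 / 2 : ℝ) * p₀ z ^ (1 / 2 : ℝ)) ^ (1 / 5 : ℝ) * q z ^ (4 / 5 : ℝ) ∂μ := by
        refine lintegral_congr fun z => ?_
        rw [ENNReal.mul_rpow_of_nonneg _ _ (by norm_num), ← ENNReal.rpow_mul, ← ENNReal.rpow_mul,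
          mul_right_comm, ← ENNReal.rpow_add_of_nonneg _ _ (by norm_num) (by norm_num)]
        norm_num
    _ ≤ _ := h.trans (mul_le_of_le_one_right' (ENNReal.rpow_le_one hq1 (by norm_num)))

theorem inv_mul_rpow_mul {c q : ℝ≥0∞} (h0 : c ≠ 0) (hT : c ≠ ∞) {β : ℝ} (hβ : 0 ≤ β) :
    (c⁻¹ * q) ^ β * c = q ^ β * c ^ (1 - β) := by
  rw [ENNReal.mul_rpow_of_nonneg _ _ hβ, ENNReal.inv_rpow, ENNReal.rpow_sub _ _ h0 hT,
    ENNReal.rpow_one, ENNReal.div_eq_inv_mul]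
  ring

end Affinity

/-! ### Posterior integrals -/

section Posterior

variable {T : Type*} [MeasurableSpace T] {ν : Measure T} {L : T → ℝ≥0∞}

theorem lintegral_normalize (hL : Measurable L) {f : T → ℝ≥0∞} (hf : Measurable f) :
    ∫⁻ t, f t ∂(normalize (ν.withDensity L)) = (∫⁻ t, L t ∂ν)⁻¹ * ∫⁻ t, f t * L t ∂ν := by
  rw [normalize, lintegral_smul_measure, withDensity_apply _ MeasurableSet.univ,
    Measure.restrict_univ, lintegral_withDensity_eq_lintegral_mul _ hL hf, smul_eq_mul]
  simp_rw [Pi.mul_apply, mul_comm]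

theorem normalize_univ_le_one (μ : Measure T) : normalize μ Set.univ ≤ 1 := by
  simp only [normalize, Measure.smul_apply, smul_eq_mul]
  exact ENNReal.inv_mul_le_one _

theorem normalize_apply_le {B : ℝ}
    (hZ : ENNReal.ofReal (Real.exp (-B)) ≤ ∫⁻ t, L t ∂ν) {S : Set T} (hS : MeasurableSet S) :
    normalize (ν.withDensity L) S ≤ ENNReal.ofReal (Real.exp B) * ∫⁻ t in S, L t ∂ν := by
  rw [normalize, Measure.smul_apply, withDensity_apply _ MeasurableSet.univ,
    Measure.restrict_univ, withDensity_apply _ hS, smul_eq_mul]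
  gcongr
  rw [ENNReal.inv_le_iff_inv_le, ← ENNReal.ofReal_inv_of_pos (Real.exp_pos _), ← Real.exp_neg]
  exact hZ

/-- The entropy inequality: the posterior mean of `g` is at most the logarithm of
`∫ e^g L dν / ∫ L dν` up to an additive constant; the logarithm is replaced by the tangent line
at `c`. -/
theorem lintegral_normalize_le_add (hL : Measurable L) {B c : ℝ}
    (hZ : ENNReal.ofReal (Real.exp (-B)) ≤ ∫⁻ t, L t ∂ν) (hc : 0 ≤ c) {g : T → ℝ}
    (hg : Measurable g) :
    ∫⁻ t, ENNReal.ofReal (g t) ∂(normalize (ν.withDensity L)) ≤ ENNReal.ofReal c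
      + ENNReal.ofReal (Real.exp (B - c)) * ∫⁻ t, ENNReal.ofReal (Real.exp (g t)) * L t ∂ν := by
  have hpt : ∀ t, ENNReal.ofReal (g t)
      ≤ ENNReal.ofReal c + ENNReal.ofReal (Real.exp (-c)) * ENNReal.ofReal (Real.exp (g t)) := by
    intro t
    rw [← ENNReal.ofReal_mul (Real.exp_pos _).le, ← ENNReal.ofReal_add hc (by positivity),
      ← Real.exp_add]
    apply ENNReal.ofReal_le_ofReal
    linarith [Real.add_one_le_exp (-c + g t)]
  refine (lintegral_mono hpt).trans ?_
  rw [lintegral_add_left (by fun_prop), lintegral_const, lintegral_const_mul _ (by fun_prop)]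
  refine add_le_add (mul_le_of_le_one_right' (normalize_univ_le_one _)) ?_
  rw [lintegral_normalize hL (by fun_prop), ← mul_assoc]
  refine mul_le_mul_left ?_ _
  have : (∫⁻ t, L t ∂ν)⁻¹ ≤ ENNReal.ofReal (Real.exp B) := by
    rw [ENNReal.inv_le_iff_inv_le, ← ENNReal.ofReal_inv_of_pos (Real.exp_pos _), ← Real.exp_neg]
    exact hZ
  calc _ ≤ ENNReal.ofReal (Real.exp (-c)) * ENNReal.ofReal (Real.exp B) := by gcongr
    _ = _ := by
      rw [← ENNReal.ofReal_mul (Real.exp_pos _).le, ← Real.exp_add]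
      congr 2; ring

/-- The entropy inequality with a free parameter `b`: a small power `γ` of the exponential moment
controls the part of the posterior mean of `g` above `B + b`. -/
theorem lintegral_normalize_le (hL : Measurable L) {B b γ : ℝ} (hB : 0 ≤ B) (hb : 0 ≤ b)
    (hγ : 0 < γ) (hZ : ENNReal.ofReal (Real.exp (-B)) ≤ ∫⁻ t, L t ∂ν) {g : T → ℝ}
    (hg : Measurable g) :
    ∫⁻ t, ENNReal.ofReal (g t) ∂(normalize (ν.withDensity L)) ≤ ENNReal.ofReal (B + b + 1)
      + ENNReal.ofReal (1 / γ) * (ENNReal.ofReal (Real.exp (-b)) *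
        ∫⁻ t, ENNReal.ofReal (Real.exp (g t)) * L t ∂ν) ^ γ := by
  set N := ∫⁻ t, ENNReal.ofReal (Real.exp (g t)) * L t ∂ν with hN
  rcases eq_or_ne N ∞ with hT | hT
  · rw [hT, ENNReal.mul_top (by simp [Real.exp_pos]), ENNReal.top_rpow_of_pos hγ,
      ENNReal.mul_top (by simpa using hγ)]
    simp
  set N' := N.toReal with hN'
  have hNN : N = ENNReal.ofReal N' := (ENNReal.ofReal_toReal hT).symm
  have hN0 : 0 ≤ N' := ENNReal.toReal_nonneg
  set y := Real.exp (-b) * N' with hy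
  have hy0 : 0 ≤ y := by positivity
  have hpow : (ENNReal.ofReal (Real.exp (-b)) * N) ^ γ = ENNReal.ofReal (y ^ γ) := by
    rw [hNN, ← ENNReal.ofReal_mul (Real.exp_pos _).le, ENNReal.ofReal_rpow_of_nonneg hy0 hγ.le]
  -- the tangent point is the logarithm of the ratio, with `log y ≤ y ^ γ / γ`
  have h1 := lintegral_normalize_le_add hL (c := B + b + 1 / γ * y ^ γ) hZ (by positivity) hg
  refine h1.trans ?_
  rw [← hN, hpow, ← ENNReal.ofReal_mul (by positivity), hNN, ← ENNReal.ofReal_mul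
    (Real.exp_pos _).le, ← ENNReal.ofReal_add (by positivity) (by positivity),
    ← ENNReal.ofReal_add (by positivity) (by positivity)]
  apply ENNReal.ofReal_le_ofReal
  have h2 : y ≤ Real.exp (1 / γ * y ^ γ) := by
    have h3 : y ^ γ ≤ Real.exp (y ^ γ) := by linarith [Real.add_one_le_exp (y ^ γ)]
    calc y = (y ^ γ) ^ (1 / γ) := by
          rw [← Real.rpow_mul hy0, mul_one_div_cancel hγ.ne', Real.rpow_one]
      _ ≤ (Real.exp (y ^ γ)) ^ (1 / γ) := by gcongr
      _ = _ := by rw [← Real.exp_mul]; ring_nf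
  have h4 : Real.exp (B - (B + b + 1 / γ * y ^ γ)) * N' ≤ 1 := by
    rw [show B - (B + b + 1 / γ * y ^ γ) = -(1 / γ * y ^ γ) + -b by ring, Real.exp_add, mul_assoc,
      ← hy, Real.exp_neg, ← div_eq_inv_mul, div_le_one (Real.exp_pos _)]
    exact h2
  linarith

end Posterior

/-! ### Densities of the regression model -/

/-- The density of `P_{θ,σ}` at `w = (y, x)` with respect to the product of Lebesgue measure and
the law of the design. -/
def dens {d : ℕ} (p : EuclideanSpace ℝ (Fin d) × ℝ) (w : ℝ × EuclideanSpace ℝ (Fin d)) : ℝ≥0∞ :=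
  gaussianPDF (inner ℝ w.2 p.1) (Real.toNNReal (p.2 ^ 2)) w.1

/-- The affinity of `P_{θ,σ}` and `P_{θ',σ'}` is `gaussScale σ σ'` times the expectation of a
Gaussian function of `Xᵀ(θ - θ')`. -/
def gaussScale (σ σ' : ℝ) : ℝ := √(2 * σ * σ' / (σ ^ 2 + σ' ^ 2))

/-- The Hellinger affinity of `P_{θ,σ}` and `P_{θ',σ'}` in closed form. -/
def rho {d : ℕ} (PX : Measure (EuclideanSpace ℝ (Fin d)))
    (p q : EuclideanSpace ℝ (Fin d) × ℝ) : ℝ :=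
  gaussScale p.2 q.2 *
    ∫ x, Real.exp (-(inner ℝ x (p.1 - q.1)) ^ 2 / (4 * (p.2 ^ 2 + q.2 ^ 2))) ∂PX

/-- The likelihood ratio of one observation. -/
def lratio {d : ℕ} (p₀ p : EuclideanSpace ℝ (Fin d) × ℝ) (w : ℝ × EuclideanSpace ℝ (Fin d)) :
    ℝ≥0∞ := (dens p₀ w)⁻¹ * dens p w

/-- Completing the square: the geometric mean of two Gaussian densities is proportional to a Gaussian
density. -/
theorem sqrt_gaussian_mul {m m' s t : ℝ} (hs : 0 < s) (ht : 0 < t) (y : ℝ) :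
    √(gaussianPDFReal m (Real.toNNReal (s ^ 2)) y * gaussianPDFReal m' (Real.toNNReal (t ^ 2)) y)
      = gaussScale s t * Real.exp (-(m - m') ^ 2 / (4 * (s ^ 2 + t ^ 2)))
        * gaussianPDFReal ((m * t ^ 2 + m' * s ^ 2) / (s ^ 2 + t ^ 2))
            (Real.toNNReal (2 * s ^ 2 * t ^ 2 / (s ^ 2 + t ^ 2))) y := by
  have hst : 0 < s ^ 2 + t ^ 2 := by positivity
  have hx := mul_nonneg (gaussianPDFReal_nonneg m (Real.toNNReal (s ^ 2)) y)
    (gaussianPDFReal_nonneg m' (Real.toNNReal (t ^ 2)) y)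
  have hy : 0 ≤ gaussScale s t * Real.exp (-(m - m') ^ 2 / (4 * (s ^ 2 + t ^ 2)))
        * gaussianPDFReal ((m * t ^ 2 + m' * s ^ 2) / (s ^ 2 + t ^ 2))
            (Real.toNNReal (2 * s ^ 2 * t ^ 2 / (s ^ 2 + t ^ 2))) y :=
    mul_nonneg (mul_nonneg (Real.sqrt_nonneg _) (Real.exp_pos _).le) (gaussianPDFReal_nonneg _ _ _)
  rw [Real.sqrt_eq_iff_mul_self_eq hx hy, eq_comm]
  simp only [gaussianPDFReal, gaussScale]
  rw [Real.coe_toNNReal _ (by positivity), Real.coe_toNNReal _ (by positivity),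
    Real.coe_toNNReal _ (by positivity)]
  have e1 : Real.exp (-(m - m') ^ 2 / (4 * (s ^ 2 + t ^ 2)))
      * Real.exp (-(m - m') ^ 2 / (4 * (s ^ 2 + t ^ 2)))
      * (Real.exp (-(y - (m * t ^ 2 + m' * s ^ 2) / (s ^ 2 + t ^ 2)) ^ 2
          / (2 * (2 * s ^ 2 * t ^ 2 / (s ^ 2 + t ^ 2))))
        * Real.exp (-(y - (m * t ^ 2 + m' * s ^ 2) / (s ^ 2 + t ^ 2)) ^ 2
          / (2 * (2 * s ^ 2 * t ^ 2 / (s ^ 2 + t ^ 2)))))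
      = Real.exp (-(y - m) ^ 2 / (2 * s ^ 2)) * Real.exp (-(y - m') ^ 2 / (2 * t ^ 2)) := by
    simp only [← Real.exp_add]
    congr 1
    field_simp
    ring
  have e2 : √(2 * s * t / (s ^ 2 + t ^ 2)) * √(2 * s * t / (s ^ 2 + t ^ 2))
      = 2 * s * t / (s ^ 2 + t ^ 2) := Real.mul_self_sqrt (by positivity)
  have e3 : (√(2 * Real.pi * (2 * s ^ 2 * t ^ 2 / (s ^ 2 + t ^ 2))))⁻¹
      * (√(2 * Real.pi * (2 * s ^ 2 * t ^ 2 / (s ^ 2 + t ^ 2))))⁻¹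
      = (2 * Real.pi * (2 * s ^ 2 * t ^ 2 / (s ^ 2 + t ^ 2)))⁻¹ := by
    rw [← mul_inv, Real.mul_self_sqrt (by positivity)]
  have e4 : (√(2 * Real.pi * s ^ 2))⁻¹ * (√(2 * Real.pi * t ^ 2))⁻¹ = (2 * Real.pi * s * t)⁻¹ := by
    rw [← mul_inv, ← Real.sqrt_mul (by positivity),
      show 2 * Real.pi * s ^ 2 * (2 * Real.pi * t ^ 2) = (2 * Real.pi * s * t) ^ 2 by ring,
      Real.sqrt_sq (by positivity)]
  calc _ = (√(2 * s * t / (s ^ 2 + t ^ 2)) * √(2 * s * t / (s ^ 2 + t ^ 2)))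
        * ((√(2 * Real.pi * (2 * s ^ 2 * t ^ 2 / (s ^ 2 + t ^ 2))))⁻¹
      * (√(2 * Real.pi * (2 * s ^ 2 * t ^ 2 / (s ^ 2 + t ^ 2))))⁻¹)
        * (Real.exp (-(m - m') ^ 2 / (4 * (s ^ 2 + t ^ 2)))
      * Real.exp (-(m - m') ^ 2 / (4 * (s ^ 2 + t ^ 2)))
      * (Real.exp (-(y - (m * t ^ 2 + m' * s ^ 2) / (s ^ 2 + t ^ 2)) ^ 2
          / (2 * (2 * s ^ 2 * t ^ 2 / (s ^ 2 + t ^ 2))))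
        * Real.exp (-(y - (m * t ^ 2 + m' * s ^ 2) / (s ^ 2 + t ^ 2)) ^ 2
          / (2 * (2 * s ^ 2 * t ^ 2 / (s ^ 2 + t ^ 2)))))) := by ring
    _ = (2 * Real.pi * s * t)⁻¹ *
        (Real.exp (-(y - m) ^ 2 / (2 * s ^ 2)) * Real.exp (-(y - m') ^ 2 / (2 * t ^ 2))) := by
      rw [e1, e2, e3]
      congr 1
      field_simp
    _ = _ := by rw [← e4]; ring

theorem lintegral_sqrt_gaussian {m m' s t : ℝ} (hs : 0 < s) (ht : 0 < t) :
    ∫⁻ y, gaussianPDF m (Real.toNNReal (s ^ 2)) y ^ (1 / 2 : ℝ)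
        * gaussianPDF m' (Real.toNNReal (t ^ 2)) y ^ (1 / 2 : ℝ)
      = ENNReal.ofReal (gaussScale s t * Real.exp (-(m - m') ^ 2 / (4 * (s ^ 2 + t ^ 2)))) := by
  have h : ∀ y, gaussianPDF m (Real.toNNReal (s ^ 2)) y ^ (1 / 2 : ℝ)
        * gaussianPDF m' (Real.toNNReal (t ^ 2)) y ^ (1 / 2 : ℝ)
      = ENNReal.ofReal (gaussScale s t * Real.exp (-(m - m') ^ 2 / (4 * (s ^ 2 + t ^ 2))))
        * gaussianPDF ((m * t ^ 2 + m' * s ^ 2) / (s ^ 2 + t ^ 2))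
            (Real.toNNReal (2 * s ^ 2 * t ^ 2 / (s ^ 2 + t ^ 2))) y := fun y => by
    simp only [gaussianPDF]
    rw [← ENNReal.mul_rpow_of_nonneg _ _ (by norm_num),
      ← ENNReal.ofReal_mul (gaussianPDFReal_nonneg _ _ _),
      ENNReal.ofReal_rpow_of_nonneg (mul_nonneg (gaussianPDFReal_nonneg _ _ _)
        (gaussianPDFReal_nonneg _ _ _)) (by norm_num), ← Real.sqrt_eq_rpow,
      sqrt_gaussian_mul hs ht, ENNReal.ofReal_mul (by unfold gaussScale; positivity)]
  simp_rw [h]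
  rw [lintegral_const_mul _ (measurable_gaussianPDF _ _), lintegral_gaussianPDF_eq_one, mul_one]
  have : 0 < 2 * s ^ 2 * t ^ 2 / (s ^ 2 + t ^ 2) := by positivity
  simpa using this

section Model

variable {d : ℕ}

theorem measurable_dens : Measurable (Function.uncurry (dens (d := d))) := by
  have h : Measurable fun a : (EuclideanSpace ℝ (Fin d) × ℝ) × (ℝ × EuclideanSpace ℝ (Fin d)) =>
      (inner ℝ a.2.2 a.1.1, Real.toNNReal (a.1.2 ^ 2), a.2.1) := by fun_prop
  exact measurable_uncurry_gaussianPDF.comp h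

theorem measurable_dens_right (p : EuclideanSpace ℝ (Fin d) × ℝ) : Measurable (dens p) :=
  Measurable.of_uncurry_left measurable_dens

theorem measurable_lratio (p₀ : EuclideanSpace ℝ (Fin d) × ℝ) :
    Measurable (Function.uncurry (lratio p₀)) :=
  ((measurable_dens_right p₀).comp measurable_snd).inv.mul measurable_dens

theorem dens_ne_zero {p : EuclideanSpace ℝ (Fin d) × ℝ} (hp : 0 < p.2)
    (w : ℝ × EuclideanSpace ℝ (Fin d)) : dens p w ≠ 0 := by
  refine (gaussianPDF_pos _ ?_ _).ne'
  have : 0 < p.2 ^ 2 := by positivity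
  simpa using hp.ne'

theorem dens_ne_top (p : EuclideanSpace ℝ (Fin d) × ℝ)
    (w : ℝ × EuclideanSpace ℝ (Fin d)) : dens p w ≠ ∞ := gaussianPDF_ne_top

theorem lintegral_dens (PX : Measure (EuclideanSpace ℝ (Fin d))) [IsProbabilityMeasure PX]
    {p : EuclideanSpace ℝ (Fin d) × ℝ} (hp : 0 < p.2) :
    ∫⁻ w, dens p w ∂((volume : Measure ℝ).prod PX) = 1 := by
  rw [lintegral_prod_symm _ (measurable_dens_right p).aemeasurable]
  have hv : Real.toNNReal (p.2 ^ 2) ≠ 0 := by simpa using hp.ne'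
  simp only [dens, lintegral_gaussianPDF_eq_one _ hv, lintegral_const, measure_univ, mul_one]

theorem regModel_eq (PX : Measure (EuclideanSpace ℝ (Fin d))) [IsProbabilityMeasure PX]
    {p : EuclideanSpace ℝ (Fin d) × ℝ} (hp : 0 < p.2) :
    regModel PX p.1 p.2 = ((volume : Measure ℝ).prod PX).withDensity (dens p) := by
  have hv : Real.toNNReal (p.2 ^ 2) ≠ 0 := by simpa using hp.ne'
  refine Measure.ext_of_lintegral _ fun f hf => ?_
  have hm : Measurable fun a : EuclideanSpace ℝ (Fin d) × ℝ => (inner ℝ a.1 p.1 + a.2, a.1) := by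
    fun_prop
  have hfm : Measurable fun a : EuclideanSpace ℝ (Fin d) × ℝ => f (inner ℝ a.1 p.1 + a.2, a.1) :=
    hf.comp hm
  rw [regModel, lintegral_map hf hm, lintegral_prod _ hfm.aemeasurable,
    lintegral_withDensity_eq_lintegral_mul _ (measurable_dens_right p) hf,
    lintegral_prod_symm _ ((measurable_dens_right p).mul hf).aemeasurable]
  refine lintegral_congr fun x => ?_
  have h1 : ∫⁻ y, f (inner ℝ x p.1 + y, x) ∂(gaussianReal 0 (Real.toNNReal (p.2 ^ 2)))
      = ∫⁻ y, f (y, x) ∂(gaussianReal (0 + inner ℝ x p.1) (Real.toNNReal (p.2 ^ 2))) := by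
    rw [← gaussianReal_map_const_add, lintegral_map (by fun_prop) (by fun_prop)]
  rw [h1, zero_add, gaussianReal_of_var_ne_zero _ hv,
    lintegral_withDensity_eq_lintegral_mul _ (measurable_gaussianPDF _ _) (by fun_prop)]
  rfl

theorem isProbabilityMeasure_regModel (PX : Measure (EuclideanSpace ℝ (Fin d)))
    [IsProbabilityMeasure PX] (θ : EuclideanSpace ℝ (Fin d)) (σ : ℝ) :
    IsProbabilityMeasure (regModel PX θ σ) := by
  unfold regModel
  refine Measure.isProbabilityMeasure_map (Measurable.aemeasurable ?_)
  fun_prop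

theorem rho_nonneg (PX : Measure (EuclideanSpace ℝ (Fin d)))
    (p q : EuclideanSpace ℝ (Fin d) × ℝ) : 0 ≤ rho PX p q :=
  mul_nonneg (Real.sqrt_nonneg _) (integral_nonneg fun _ => (Real.exp_pos _).le)

theorem integrable_exp_neg_sq (PX : Measure (EuclideanSpace ℝ (Fin d))) [IsProbabilityMeasure PX]
    (θ : EuclideanSpace ℝ (Fin d)) {v : ℝ} (hv : 0 ≤ v) :
    Integrable (fun x => Real.exp (-(inner ℝ x θ) ^ 2 / v)) PX := by
  refine Integrable.of_bound (C := 1) (by fun_prop) (Filter.Eventually.of_forall fun x => ?_)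
  rw [Real.norm_eq_abs, abs_of_pos (Real.exp_pos _), Real.exp_le_one_iff]
  exact div_nonpos_of_nonpos_of_nonneg (by nlinarith [sq_nonneg (inner ℝ x θ : ℝ)]) hv

theorem affinity_dens (PX : Measure (EuclideanSpace ℝ (Fin d))) [IsProbabilityMeasure PX]
    {p q : EuclideanSpace ℝ (Fin d) × ℝ} (hp : 0 < p.2) (hq : 0 < q.2) :
    affinity ((volume : Measure ℝ).prod PX) (dens p) (dens q) = ENNReal.ofReal (rho PX p q) := by
  have hmp := measurable_dens_right p
  have hmq := measurable_dens_right q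
  rw [affinity, lintegral_prod_symm _ (by fun_prop)]
  simp only [dens]
  simp_rw [lintegral_sqrt_gaussian hp hq]
  rw [rho, ← integral_const_mul, ofReal_integral_eq_lintegral_ofReal]
  · simp_rw [inner_sub_right]
  · exact (integrable_exp_neg_sq PX _ (by positivity)).const_mul _
  · exact Filter.Eventually.of_forall fun x => mul_nonneg (Real.sqrt_nonneg _) (Real.exp_pos _).le

theorem gaussScale_pos {σ σ' : ℝ} (h : 0 < σ) (h' : 0 < σ') : 0 < gaussScale σ σ' := by
  unfold gaussScale; positivity

theorem rho_pos (PX : Measure (EuclideanSpace ℝ (Fin d))) [IsProbabilityMeasure PX]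
    {p q : EuclideanSpace ℝ (Fin d) × ℝ} (hp : 0 < p.2) (hq : 0 < q.2) : 0 < rho PX p q := by
  refine mul_pos (gaussScale_pos hp hq) (integral_exp_pos ?_)
  exact integrable_exp_neg_sq PX _ (by positivity)

/-! ### Comparison of the Rényi divergences -/

/-- Log-convexity of `α ↦ ∫ f ^ α g ^ (1 - α)` bounds every Rényi integral below by the Hellinger
affinity. -/
theorem affinity_le_rpow {Z : Type*} [MeasurableSpace Z] (μ : Measure Z) {f g : Z → ℝ≥0∞}
    (hf : Measurable f) (hg : Measurable g) (hf1 : ∫⁻ z, f z ∂μ ≤ 1) (hg1 : ∫⁻ z, g z ∂μ ≤ 1)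
    {α : ℝ} (h0 : 0 < α) (h1 : α < 1) :
    affinity μ f g ≤ (∫⁻ z, f z ^ α * g z ^ (1 - α) ∂μ) ^ (1 / 2 : ℝ) := by
  have key : ∀ {f g : Z → ℝ≥0∞}, Measurable f → Measurable g → ∫⁻ z, f z ∂μ ≤ 1 →
      ∫⁻ z, g z ∂μ ≤ 1 → ∀ {α : ℝ}, 1 / 2 ≤ α → α < 1 →
      affinity μ f g ≤ (∫⁻ z, f z ^ α * g z ^ (1 - α) ∂μ) ^ (1 / 2 : ℝ) := by
    intro f g hf hg hf1 hg1 α h0 h1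
    have hα : 0 < α := by linarith
    set t := 1 / (2 * α) with ht
    have ht0 : 0 ≤ t := by positivity
    have ht1 : t ≤ 1 := by rw [ht, div_le_one (by positivity)]; linarith
    have ht2 : 1 / 2 ≤ t := by
      rw [ht]; apply one_div_le_one_div_of_le (by positivity); linarith
    have hαt : α * t = 1 / 2 := by rw [ht]; field_simp
    have hI : ∫⁻ z, f z ^ α * g z ^ (1 - α) ∂μ ≤ 1 := by
      refine (ENNReal.lintegral_mul_norm_pow_le hf.aemeasurable hg.aemeasurable hα.le
        (by linarith) (by ring)).trans ?_
      exact mul_le_one' (ENNReal.rpow_le_one hf1 hα.le) (ENNReal.rpow_le_one hg1 (by linarith))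
    calc affinity μ f g = ∫⁻ z, (f z ^ α * g z ^ (1 - α)) ^ t * g z ^ (1 - t) ∂μ := by
          refine lintegral_congr fun z => ?_
          rw [ENNReal.mul_rpow_of_nonneg _ _ ht0, ← ENNReal.rpow_mul, ← ENNReal.rpow_mul, hαt,
            mul_assoc, ← ENNReal.rpow_add_of_nonneg _ _ (mul_nonneg (by linarith) ht0)
              (by linarith)]
          congr 2
          nlinarith
      _ ≤ (∫⁻ z, f z ^ α * g z ^ (1 - α) ∂μ) ^ t * (∫⁻ z, g z ∂μ) ^ (1 - t) :=
          ENNReal.lintegral_mul_norm_pow_le (by fun_prop) (by fun_prop) ht0 (by linarith) (by ring)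
      _ ≤ (∫⁻ z, f z ^ α * g z ^ (1 - α) ∂μ) ^ t :=
          mul_le_of_le_one_right' (ENNReal.rpow_le_one hg1 (by linarith))
      _ ≤ _ := ENNReal.rpow_le_rpow_of_exponent_ge hI ht2
  rcases le_total (1 / 2) α with h | h
  · exact key hf hg hf1 hg1 h h1
  · have := key hg hf hg1 hf1 (α := 1 - α) (by linarith) (by linarith)
    rw [affinity_comm]
    simpa [mul_comm] using this

theorem toENNReal_renyiDiv_le (PX : Measure (EuclideanSpace ℝ (Fin d))) [IsProbabilityMeasure PX]
    {p q : EuclideanSpace ℝ (Fin d) × ℝ} (hp : 0 < p.2) (hq : 0 < q.2) {α : ℝ} (h0 : 0 < α)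
    (h1 : α < 1) :
    (renyiDiv α (regModel PX p.1 p.2) (regModel PX q.1 q.2)).toENNReal
      ≤ ENNReal.ofReal (2 / (1 - α) * -Real.log (rho PX p q)) := by
  set μ := (volume : Measure ℝ).prod PX
  have := isProbabilityMeasure_regModel PX p.1 p.2
  have := isProbabilityMeasure_regModel PX q.1 q.2
  have hI : renyiIntegral α (regModel PX p.1 p.2) (regModel PX q.1 q.2)
      = ∫⁻ w, dens p w ^ α * dens q w ^ (1 - α) ∂μ := by
    rw [renyiIntegral_eq h0 h1 _ _ μ]
    · rw [regModel_eq PX hp, regModel_eq PX hq]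
      apply lintegral_congr_ae
      filter_upwards [Measure.rnDeriv_withDensity μ (measurable_dens_right p),
        Measure.rnDeriv_withDensity μ (measurable_dens_right q)] with w h1 h2
      rw [h1, h2]
    · rw [regModel_eq PX hp]; exact withDensity_absolutelyContinuous _ _
    · rw [regModel_eq PX hq]; exact withDensity_absolutelyContinuous _ _
  have hr := rho_pos PX hp hq
  have hle : ENNReal.ofReal (rho PX p q ^ 2)
      ≤ renyiIntegral α (regModel PX p.1 p.2) (regModel PX q.1 q.2) := by
    have h := affinity_le_rpow μ (measurable_dens_right p) (measurable_dens_right q)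
      (lintegral_dens PX hp).le (lintegral_dens PX hq).le h0 h1
    rw [affinity_dens PX hp hq, ← hI] at h
    calc _ = ENNReal.ofReal (rho PX p q) ^ 2 := ENNReal.ofReal_pow hr.le 2
      _ ≤ ((renyiIntegral α (regModel PX p.1 p.2) (regModel PX q.1 q.2)) ^ (1 / 2 : ℝ)) ^ 2 := by
        gcongr
      _ = _ := by rw [pow_two, sqrt_mul_self']
  rw [← EReal.real_coe_toENNReal]
  apply EReal.toENNReal_le_toENNReal
  have hlog := ENNReal.log_monotone hle
  rw [ENNReal.log_ofReal_of_pos (by positivity), Real.log_pow] at hlog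
  have hneg : (((α - 1)⁻¹ : ℝ) : EReal) ≤ 0 := by
    exact_mod_cast inv_nonpos.mpr (by linarith)
  have hm := EReal.mul_le_mul_of_nonpos_right hlog hneg
  rw [renyiDiv, mul_comm]
  refine hm.trans (le_of_eq ?_)
  rw [← EReal.coe_mul]
  congr 1
  have : α - 1 ≠ 0 := by linarith
  have : 1 - α ≠ 0 := by linarith
  push_cast
  field_simp
  ring

/-! ### The posterior through likelihood ratios -/

/-- The likelihood ratio of the sample. -/
def lratioProd {n : ℕ} (p₀ : EuclideanSpace ℝ (Fin d) × ℝ)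
    (z : Fin n → ℝ × EuclideanSpace ℝ (Fin d)) (p : EuclideanSpace ℝ (Fin d) × ℝ) : ℝ≥0∞ :=
  ∏ i, lratio p₀ p (z i)

theorem measurable_lratioProd {n : ℕ} (p₀ : EuclideanSpace ℝ (Fin d) × ℝ) :
    Measurable fun a : (Fin n → ℝ × EuclideanSpace ℝ (Fin d)) × (EuclideanSpace ℝ (Fin d) × ℝ) =>
      lratioProd p₀ a.1 a.2 := by
  unfold lratioProd
  refine Finset.measurable_fun_prod _ fun i _ => ?_
  have h : Measurable fun a : (Fin n → ℝ × EuclideanSpace ℝ (Fin d)) ×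
      (EuclideanSpace ℝ (Fin d) × ℝ) => (a.2, a.1 i) :=
    measurable_snd.prodMk ((measurable_pi_apply i).comp measurable_fst)
  have h2 := (measurable_lratio p₀).comp h
  simpa only [Function.comp_def, Function.uncurry] using h2

theorem measurable_lratioProd_right {n : ℕ} (p₀ : EuclideanSpace ℝ (Fin d) × ℝ)
    (z : Fin n → ℝ × EuclideanSpace ℝ (Fin d)) : Measurable (lratioProd p₀ z) := by
  have h : Measurable fun p : EuclideanSpace ℝ (Fin d) × ℝ => (z, p) := measurable_prodMk_left
  have h2 := (measurable_lratioProd p₀).comp h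
  simpa only [Function.comp_def] using h2

theorem normalize_smul {T : Type*} [MeasurableSpace T] (μ : Measure T) {c : ℝ≥0∞} (h0 : c ≠ 0)
    (hT : c ≠ ∞) : normalize (c • μ) = normalize μ := by
  simp only [normalize, Measure.smul_apply, smul_eq_mul, smul_smul]
  rw [ENNReal.mul_inv (Or.inl h0) (Or.inl hT), mul_right_comm, ENNReal.inv_mul_cancel h0 hT,
    one_mul]

/-- The density of the true parameter cancels in the normalization, so the posterior can be computed
from likelihood ratios. -/
theorem posterior_eq {n : ℕ} {p₀ : EuclideanSpace ℝ (Fin d) × ℝ} (hp₀ : 0 < p₀.2)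
    (C₁ τ a b : ℝ) (z : Fin n → ℝ × EuclideanSpace ℝ (Fin d)) :
    posterior C₁ τ a b z = normalize ((prior d C₁ τ a b).withDensity (lratioProd p₀ z)) := by
  have h0 : (∏ i, dens p₀ (z i)) ≠ 0 := Finset.prod_ne_zero_iff.2 fun i _ => dens_ne_zero hp₀ _
  have hT : (∏ i, dens p₀ (z i)) ≠ ∞ := ENNReal.prod_ne_top fun i _ => dens_ne_top _ _
  have h : likelihood z = (∏ i, dens p₀ (z i)) • lratioProd p₀ z := by
    funext p
    simp only [likelihood, lratioProd, lratio, Pi.smul_apply, smul_eq_mul,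
      ← Finset.prod_mul_distrib]
    refine Finset.prod_congr rfl fun i _ => ?_
    rw [← mul_assoc, ENNReal.mul_inv_cancel (dens_ne_zero hp₀ _) (dens_ne_top _ _), one_mul]
    rfl
  rw [posterior, h, withDensity_smul, normalize_smul _ h0 hT]
  exact measurable_lratioProd_right p₀ z

end Model

/-! ### The Student distribution -/

/-- The density of the scaled Student distribution with three degrees of freedom. -/
def stuPDF (τ x : ℝ) : ℝ := 2 * τ ^ 3 / Real.pi * ((τ ^ 2 + x ^ 2) ^ 2)⁻¹

/-- The scaled Student distribution with three degrees of freedom, normalized to have second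
moment `τ ^ 2`. -/
def stu (τ : ℝ) : Measure ℝ := volume.withDensity fun x => ENNReal.ofReal (stuPDF τ x)

theorem stuPDF_pos {τ : ℝ} (hτ : 0 < τ) (x : ℝ) : 0 < stuPDF τ x := by
  unfold stuPDF; positivity

theorem measurable_stuPDF (τ : ℝ) : Measurable (stuPDF τ) := by
  unfold stuPDF; fun_prop

theorem hasDerivAt_arctan_div {τ : ℝ} (hτ : 0 < τ) (x : ℝ) :
    HasDerivAt (fun x => Real.arctan (x / τ)) (τ / (τ ^ 2 + x ^ 2)) x := by
  have h := ((hasDerivAt_id x).div_const τ).arctan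
  refine h.congr_deriv ?_
  simp only [id_eq]
  field_simp

theorem hasDerivAt_div_sq_add {τ : ℝ} (hτ : 0 < τ) (x : ℝ) :
    HasDerivAt (fun x => τ * x / (τ ^ 2 + x ^ 2)) (τ * (τ ^ 2 - x ^ 2) / (τ ^ 2 + x ^ 2) ^ 2) x := by
  have h0 : τ ^ 2 + x ^ 2 ≠ 0 := by positivity
  have h := ((hasDerivAt_id' x).const_mul τ).fun_div
    (((hasDerivAt_id' x).fun_pow 2).const_add (τ ^ 2)) h0
  refine h.congr_deriv ?_
  field_simp
  ring

theorem tendsto_arctan_div {τ : ℝ} (hτ : 0 < τ) :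
    Filter.Tendsto (fun x => Real.arctan (x / τ)) Filter.atTop (nhds (Real.pi / 2)) ∧
    Filter.Tendsto (fun x => Real.arctan (x / τ)) Filter.atBot (nhds (-(Real.pi / 2))) :=
  ⟨(Real.tendsto_arctan_atTop.mono_right nhdsWithin_le_nhds).comp
      (Filter.tendsto_id.atTop_div_const hτ),
    (Real.tendsto_arctan_atBot.mono_right nhdsWithin_le_nhds).comp
      (Filter.tendsto_id.atBot_div_const hτ)⟩

theorem tendsto_div_sq_add {τ : ℝ} :
    Filter.Tendsto (fun x => τ * x / (τ ^ 2 + x ^ 2)) Filter.atTop (nhds 0) ∧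
    Filter.Tendsto (fun x => τ * x / (τ ^ 2 + x ^ 2)) Filter.atBot (nhds 0) := by
  have hb : ∀ x : ℝ, ‖τ * x / (τ ^ 2 + x ^ 2)‖ ≤ |τ| * ‖x⁻¹‖ := by
    intro x
    rcases eq_or_ne x 0 with rfl | hx
    · simp
    have : 0 < x ^ 2 := by positivity
    rw [Real.norm_eq_abs, Real.norm_eq_abs, abs_div, abs_mul, abs_inv, mul_div_assoc]
    gcongr
    rw [div_le_iff₀ (by positivity), abs_of_pos (by positivity : 0 < τ ^ 2 + x ^ 2),
      ← div_eq_inv_mul, le_div_iff₀ (abs_pos.2 hx), ← pow_two, sq_abs]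
    nlinarith [sq_nonneg τ]
  have ht := tendsto_inv_atTop_zero (𝕜 := ℝ)
  have hbt := tendsto_inv_atBot_zero (𝕜 := ℝ)
  constructor
  · refine squeeze_zero_norm hb ?_
    simpa using (ht.norm.const_mul |τ|)
  · refine squeeze_zero_norm hb ?_
    simpa using (hbt.norm.const_mul |τ|)

theorem integrable_inv_sq_add {τ : ℝ} (hτ : 0 < τ) :
    Integrable fun x : ℝ => τ / (τ ^ 2 + x ^ 2) := by
  have h := (integrable_inv_one_add_sq.comp_div hτ.ne').const_mul τ⁻¹
  refine h.congr (Filter.Eventually.of_forall fun x => ?_)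
  simp only
  field_simp

theorem integrable_stuPDF {τ : ℝ} (hτ : 0 < τ) : Integrable (stuPDF τ) := by
  refine ((integrable_inv_sq_add hτ).const_mul (2 / Real.pi)).mono'
    (measurable_stuPDF τ).aestronglyMeasurable (Filter.Eventually.of_forall fun x => ?_)
  rw [Real.norm_eq_abs, abs_of_pos (stuPDF_pos hτ x), stuPDF]
  rw [show 2 * τ ^ 3 / Real.pi * ((τ ^ 2 + x ^ 2) ^ 2)⁻¹
    = 2 / Real.pi * (τ / (τ ^ 2 + x ^ 2) * (τ ^ 2 / (τ ^ 2 + x ^ 2))) by field_simp]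
  gcongr
  exact mul_le_of_le_one_right (by positivity)
    ((div_le_one (by positivity)).2 (by nlinarith [sq_nonneg x]))

theorem integrable_sq_mul_stuPDF {τ : ℝ} (hτ : 0 < τ) :
    Integrable fun x => x ^ 2 * stuPDF τ x := by
  refine ((integrable_inv_sq_add hτ).const_mul (2 * τ ^ 2 / Real.pi)).mono'
    ((measurable_id.pow_const 2).mul (measurable_stuPDF τ)).aestronglyMeasurable
    (Filter.Eventually.of_forall fun x => ?_)
  rw [Real.norm_eq_abs, abs_of_nonneg (mul_nonneg (sq_nonneg x) (stuPDF_pos hτ x).le), stuPDF]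
  rw [show x ^ 2 * (2 * τ ^ 3 / Real.pi * ((τ ^ 2 + x ^ 2) ^ 2)⁻¹)
    = 2 * τ ^ 2 / Real.pi * (τ / (τ ^ 2 + x ^ 2) * (x ^ 2 / (τ ^ 2 + x ^ 2))) by field_simp]
  gcongr
  exact mul_le_of_le_one_right (by positivity)
    ((div_le_one (by positivity)).2 (by nlinarith [sq_nonneg τ]))

theorem integral_stuPDF {τ : ℝ} (hτ : 0 < τ) : ∫ x, stuPDF τ x = 1 := by
  have hd : ∀ x, HasDerivAt
      (fun x => (Real.arctan (x / τ) + τ * x / (τ ^ 2 + x ^ 2)) / Real.pi) (stuPDF τ x) x := by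
    intro x
    refine (((hasDerivAt_arctan_div hτ x).fun_add
      (hasDerivAt_div_sq_add hτ x)).div_const Real.pi).congr_deriv ?_
    have : 0 < τ ^ 2 + x ^ 2 := by positivity
    rw [stuPDF]
    field_simp
    ring
  rw [integral_of_hasDerivAt_of_tendsto hd (integrable_stuPDF hτ)
    (((tendsto_arctan_div hτ).2.add tendsto_div_sq_add.2).div_const _)
    (((tendsto_arctan_div hτ).1.add tendsto_div_sq_add.1).div_const _)]
  field_simp
  ring

theorem integral_sq_mul_stuPDF {τ : ℝ} (hτ : 0 < τ) : ∫ x, x ^ 2 * stuPDF τ x = τ ^ 2 := by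
  have hd : ∀ x, HasDerivAt
      (fun x => τ ^ 2 * (Real.arctan (x / τ) - τ * x / (τ ^ 2 + x ^ 2)) / Real.pi)
      (x ^ 2 * stuPDF τ x) x := by
    intro x
    refine ((((hasDerivAt_arctan_div hτ x).fun_sub (hasDerivAt_div_sq_add hτ x)).const_mul
      (τ ^ 2)).div_const Real.pi).congr_deriv ?_
    have : 0 < τ ^ 2 + x ^ 2 := by positivity
    rw [stuPDF]
    field_simp
    ring
  rw [integral_of_hasDerivAt_of_tendsto hd (integrable_sq_mul_stuPDF hτ)
    ((((tendsto_arctan_div hτ).2.sub tendsto_div_sq_add.2).const_mul _).div_const _)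
    ((((tendsto_arctan_div hτ).1.sub tendsto_div_sq_add.1).const_mul _).div_const _)]
  field_simp
  ring

theorem lintegral_stu (τ : ℝ) {f : ℝ → ℝ≥0∞} (hf : Measurable f) :
    ∫⁻ x, f x ∂(stu τ) = ∫⁻ x, ENNReal.ofReal (stuPDF τ x) * f x := by
  rw [stu, lintegral_withDensity_eq_lintegral_mul _ (measurable_stuPDF τ).ennreal_ofReal hf]
  rfl

theorem isProbabilityMeasure_stu {τ : ℝ} (hτ : 0 < τ) : IsProbabilityMeasure (stu τ) := by
  constructor
  rw [stu, withDensity_apply _ MeasurableSet.univ, Measure.restrict_univ,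
    ← ofReal_integral_eq_lintegral_ofReal (integrable_stuPDF hτ)
      (Filter.Eventually.of_forall fun x => (stuPDF_pos hτ x).le), integral_stuPDF hτ,
    ENNReal.ofReal_one]

theorem lintegral_sq_stu {τ : ℝ} (hτ : 0 < τ) :
    ∫⁻ x, ENNReal.ofReal (x ^ 2) ∂(stu τ) = ENNReal.ofReal (τ ^ 2) := by
  rw [lintegral_stu _ (by fun_prop), ← integral_sq_mul_stuPDF hτ,
    ofReal_integral_eq_lintegral_ofReal (integrable_sq_mul_stuPDF hτ)
      (Filter.Eventually.of_forall fun x => mul_nonneg (sq_nonneg x) (stuPDF_pos hτ x).le)]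
  refine lintegral_congr fun x => ?_
  rw [ENNReal.ofReal_mul (sq_nonneg x), mul_comm]

theorem lintegral_abs_stu_le {τ : ℝ} (hτ : 0 < τ) :
    ∫⁻ x, ENNReal.ofReal |x| ∂(stu τ) ≤ ENNReal.ofReal τ := by
  have := isProbabilityMeasure_stu hτ
  calc _ ≤ ∫⁻ x, ENNReal.ofReal (1 / (2 * τ)) * ENNReal.ofReal (x ^ 2)
          + ENNReal.ofReal (τ / 2) ∂(stu τ) := by
        refine lintegral_mono fun x => ?_
        rw [← ENNReal.ofReal_mul (by positivity), ← ENNReal.ofReal_add (by positivity)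
          (by positivity)]
        apply ENNReal.ofReal_le_ofReal
        have : 0 ≤ (|x| - τ) ^ 2 := sq_nonneg _
        rw [show 1 / (2 * τ) * x ^ 2 + τ / 2 = (|x| ^ 2 + τ ^ 2) / (2 * τ) by
          rw [sq_abs]; field_simp, le_div_iff₀ (by positivity)]
        nlinarith
    _ = ENNReal.ofReal τ := by
        rw [lintegral_add_right _ measurable_const, lintegral_const_mul _ (by fun_prop),
          lintegral_sq_stu hτ, lintegral_const, measure_univ, mul_one,
          ← ENNReal.ofReal_mul (by positivity), ← ENNReal.ofReal_add (by positivity)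
          (by positivity)]
        congr 1
        field_simp
        norm_num

theorem memLp_stu {τ : ℝ} (hτ : 0 < τ) (c : ℝ) : MemLp (fun x => c * x) 2 (stu τ) := by
  refine MemLp.const_mul ?_ c
  rw [memLp_two_iff_integrable_sq (by fun_prop)]
  refine ⟨by fun_prop, ?_⟩
  rw [hasFiniteIntegral_iff_ofReal (Filter.Eventually.of_forall fun x => sq_nonneg x),
    lintegral_sq_stu hτ]
  exact ENNReal.ofReal_lt_top

theorem stuPDF_neg (τ x : ℝ) : stuPDF τ (-x) = stuPDF τ x := by
  simp [stuPDF]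

theorem map_neg_stu (τ : ℝ) : (stu τ).map Neg.neg = stu τ := by
  refine Measure.ext_of_lintegral _ fun f hf => ?_
  rw [lintegral_map hf measurable_neg, lintegral_stu _ (by fun_prop), lintegral_stu _ hf,
    ← lintegral_neg_eq_self]
  simp [stuPDF_neg]

theorem integral_stu (τ : ℝ) : ∫ x, x ∂(stu τ) = 0 := by
  have h : ∫ x, x ∂(stu τ) = ∫ x, -x ∂(stu τ) := by
    conv_lhs => rw [← map_neg_stu]
    rw [integral_map (by fun_prop) (by fun_prop)]
  rw [integral_neg] at h
  linarith

/-! ### Independent Student coordinates -/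

/-- The law on `ℝ^d` with independent scaled Student coordinates. -/
def stuPi (d : ℕ) (τ : ℝ) : Measure (EuclideanSpace ℝ (Fin d)) :=
  (Measure.pi fun _ : Fin d => stu τ).map (WithLp.toLp 2)

section StuPi

variable {d : ℕ} {τ : ℝ}

theorem isProbabilityMeasure_stuPi (hτ : 0 < τ) : IsProbabilityMeasure (stuPi d τ) := by
  have := isProbabilityMeasure_stu hτ
  exact Measure.isProbabilityMeasure_map (by fun_prop)

theorem lintegral_stuPi {f : EuclideanSpace ℝ (Fin d) → ℝ≥0∞} (hf : Measurable f) :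
    ∫⁻ θ, f θ ∂(stuPi d τ) = ∫⁻ x, f (WithLp.toLp 2 x) ∂(Measure.pi fun _ : Fin d => stu τ) := by
  rw [stuPi, lintegral_map hf (by fun_prop)]

theorem lintegral_prod_stuPi (hτ : 0 < τ) {f : Fin d → ℝ → ℝ≥0∞} (hf : ∀ i, Measurable (f i)) :
    ∫⁻ θ, ∏ j, f j (θ j) ∂(stuPi d τ) = ∏ j, ∫⁻ x, f j x ∂(stu τ) := by
  have := isProbabilityMeasure_stu hτ
  rw [lintegral_stuPi (by fun_prop)]
  exact lintegral_pi_prod _ _ hf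

theorem lintegral_coord_stuPi (hτ : 0 < τ) {f : ℝ → ℝ≥0∞} (hf : Measurable f) (j : Fin d) :
    ∫⁻ θ, f (θ j) ∂(stuPi d τ) = ∫⁻ x, f x ∂(stu τ) := by
  have := isProbabilityMeasure_stu hτ
  rw [lintegral_stuPi (by fun_prop)]
  have h := (measurePreserving_eval (fun _ : Fin d => stu τ) j).lintegral_comp hf
  exact h

theorem stuPi_eq (hτ : 0 < τ) : stuPi d τ
    = volume.withDensity fun θ => ∏ j, ENNReal.ofReal (stuPDF τ (θ j)) := by
  have := isProbabilityMeasure_stu hτ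
  have hm := (measurable_stuPDF τ).ennreal_ofReal
  have hpi : (Measure.pi fun _ : Fin d => stu τ)
      = (volume : Measure (Fin d → ℝ)).withDensity
          fun x => ∏ j, ENNReal.ofReal (stuPDF τ (x j)) := by
    refine Measure.pi_eq fun s hs => ?_
    rw [withDensity_apply _ (MeasurableSet.univ_pi hs),
      ← lintegral_indicator (MeasurableSet.univ_pi hs)]
    have : ∀ x : Fin d → ℝ, (Set.univ.pi s).indicator
        (fun x => ∏ j, ENNReal.ofReal (stuPDF τ (x j))) x
        = ∏ j, (s j).indicator (fun y => ENNReal.ofReal (stuPDF τ y)) (x j) := by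
      intro x
      by_cases hx : x ∈ Set.univ.pi s
      · rw [Set.indicator_of_mem hx]
        refine Finset.prod_congr rfl fun j _ => ?_
        rw [Set.indicator_of_mem (hx j (Set.mem_univ j))]
      · rw [Set.indicator_of_notMem hx, eq_comm]
        simp only [Set.mem_pi, Set.mem_univ, true_implies, not_forall] at hx
        obtain ⟨j, hj⟩ := hx
        exact Finset.prod_eq_zero (Finset.mem_univ j) (Set.indicator_of_notMem hj _)
    simp_rw [this]
    rw [volume_pi, lintegral_pi_prod _ _ fun j => hm.indicator (hs j)]
    refine Finset.prod_congr rfl fun j _ => ?_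
    rw [lintegral_indicator (hs j), stu, withDensity_apply _ (hs j)]
  refine Measure.ext_of_lintegral _ fun f hf => ?_
  have hp : Measurable fun θ : EuclideanSpace ℝ (Fin d) =>
      ∏ j, ENNReal.ofReal (stuPDF τ (θ j)) :=
    Finset.measurable_fun_prod _ fun j _ => hm.comp (by fun_prop)
  have hp' : Measurable fun x : Fin d → ℝ => ∏ j, ENNReal.ofReal (stuPDF τ (x j)) :=
    Finset.measurable_fun_prod _ fun j _ => hm.comp (by fun_prop)
  rw [lintegral_stuPi hf, hpi, lintegral_withDensity_eq_lintegral_mul _ hp' (by fun_prop),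
    lintegral_withDensity_eq_lintegral_mul _ hp hf,
    ← (PiLp.volume_preserving_toLp (Fin d)).lintegral_comp (hp.mul hf)]
  rfl

theorem measurable_l1Norm : Measurable (l1Norm (d := d)) := by
  unfold l1Norm; fun_prop

/-- By Markov's inequality, as `|θ j|` has mean at most `τ`: truncating the prior to an `ℓ₁` ball of
radius at least `2 d τ` costs at most half of its mass. -/
theorem stuPi_l1Norm_le (hτ : 0 < τ) (hd : 0 < d) {r : ℝ} (hr : 2 * d * τ ≤ r) :
    (1 / 2 : ℝ≥0∞) ≤ stuPi d τ {θ | l1Norm θ ≤ r} := by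
  have := isProbabilityMeasure_stuPi (d := d) hτ
  have hms : MeasurableSet {θ : EuclideanSpace ℝ (Fin d) | l1Norm θ ≤ r} :=
    measurable_l1Norm measurableSet_Iic
  have hmean : ∫⁻ θ, ENNReal.ofReal (l1Norm θ) ∂(stuPi d τ) ≤ ENNReal.ofReal (d * τ) := by
    have : ∀ θ : EuclideanSpace ℝ (Fin d), ENNReal.ofReal (l1Norm θ)
        = ∑ j, ENNReal.ofReal |θ j| := fun θ => by
      rw [l1Norm, ENNReal.ofReal_sum_of_nonneg fun j _ => abs_nonneg _]
    simp_rw [this]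
    rw [lintegral_finsetSum _ fun j _ => by fun_prop]
    calc _ ≤ ∑ _j : Fin d, ENNReal.ofReal τ := by
          refine Finset.sum_le_sum fun j _ => ?_
          rw [lintegral_coord_stuPi hτ (f := fun x => ENNReal.ofReal |x|) (by fun_prop)]
          exact lintegral_abs_stu_le hτ
      _ = _ := by
          rw [Finset.sum_const, Finset.card_univ, Fintype.card_fin, nsmul_eq_mul,
            ENNReal.ofReal_mul (by positivity), ENNReal.ofReal_natCast]
  have hd' : (0 : ℝ) < d := by exact_mod_cast hd
  have hbad : stuPi d τ {θ | l1Norm θ ≤ r}ᶜ ≤ 1 / 2 := by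
    have hsub : {θ : EuclideanSpace ℝ (Fin d) | l1Norm θ ≤ r}ᶜ
        ⊆ {θ | ENNReal.ofReal (2 * (d * τ)) ≤ ENNReal.ofReal (l1Norm θ)} := by
      intro θ hθ
      simp only [Set.mem_compl_iff, Set.mem_ofPred_eq, not_le] at hθ ⊢
      exact ENNReal.ofReal_le_ofReal (by linarith)
    refine (measure_mono hsub).trans ?_
    have hpos : 0 < 2 * (d * τ) := by positivity
    refine (meas_ge_le_lintegral_div (measurable_l1Norm.ennreal_ofReal).aemeasurable
      (ENNReal.ofReal_pos.2 hpos).ne' ENNReal.ofReal_ne_top).trans ?_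
    rw [ENNReal.div_le_iff (ENNReal.ofReal_pos.2 hpos).ne' ENNReal.ofReal_ne_top]
    refine hmean.trans (le_of_eq ?_)
    rw [show (1 / 2 : ℝ≥0∞) = ENNReal.ofReal (1 / 2) by
      rw [ENNReal.ofReal_div_of_pos (by norm_num)]; simp, ← ENNReal.ofReal_mul (by norm_num)]
    congr 1
    ring
  have hadd := measure_add_measure_compl (μ := stuPi d τ) hms
  rw [measure_univ] at hadd
  by_contra hlt
  push Not at hlt
  have h2 : (1 : ℝ≥0∞) < 1 / 2 + 1 / 2 := by
    calc (1 : ℝ≥0∞) = _ := hadd.symm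
      _ < _ := ENNReal.add_lt_add_of_lt_of_le (ne_top_of_le_ne_top (by simp) hbad) hlt hbad
  rw [ENNReal.add_halves] at h2
  exact lt_irrefl _ h2

/-- The Student coordinates are uncorrelated, with second moment `τ ^ 2`. -/
theorem lintegral_inner_sq_stuPi (hτ : 0 < τ) (x : EuclideanSpace ℝ (Fin d)) :
    ∫⁻ θ, ENNReal.ofReal ((inner ℝ x θ) ^ 2) ∂(stuPi d τ) = ENNReal.ofReal (τ ^ 2 * ‖x‖ ^ 2) := by
  have := isProbabilityMeasure_stu hτ
  have hin : ∀ y : Fin d → ℝ, (inner ℝ x (WithLp.toLp 2 y) : ℝ) = ∑ j, x j * y j := fun y => by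
    simp [PiLp.inner_apply, mul_comm]
  have hml : ∀ j, MemLp (fun t => x j * t) 2 (stu τ) := fun j => memLp_stu hτ (x j)
  have hS : (fun y : Fin d → ℝ => ∑ j, x j * y j) = ∑ j, fun y : Fin d → ℝ => x j * y j := by
    funext y; simp
  have hmS : MemLp (fun y : Fin d → ℝ => ∑ j, x j * y j) 2 (Measure.pi fun _ : Fin d => stu τ) := by
    rw [hS]
    refine memLp_finsetSum' _ fun j _ => ?_
    exact (hml j).comp_measurePreserving (measurePreserving_eval _ j)
  have hvar := variance_sum_pi (X := fun j t => x j * t) hml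
  have hmean : ∫ y, (∑ j, x j * y j) ∂(Measure.pi fun _ : Fin d => stu τ) = 0 := by
    rw [integral_finsetSum]
    · refine Finset.sum_eq_zero fun j _ => ?_
      have h := integral_comp_eval (μ := fun _ : Fin d => stu τ) (i := j)
        (f := fun t => x j * t) (hml j).aestronglyMeasurable
      rw [h, integral_const_mul, integral_stu, mul_zero]
    · intro j _
      exact ((hml j).comp_measurePreserving (measurePreserving_eval _ j)).integrable
        (by norm_num)
  have h1 : ∀ j, Var[fun t => x j * t; stu τ] = x j ^ 2 * τ ^ 2 := by
    intro j
    rw [variance_of_integral_eq_zero (hml j).aestronglyMeasurable.aemeasurable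
      (by rw [integral_const_mul, integral_stu, mul_zero])]
    simp_rw [mul_pow]
    rw [integral_const_mul]
    congr 1
    have h2 : Integrable (fun t : ℝ => t ^ 2) (stu τ) := by
      have := memLp_stu hτ 1
      simp only [one_mul] at this
      exact this.integrable_sq
    rw [integral_eq_lintegral_of_nonneg_ae (Filter.Eventually.of_forall fun t => sq_nonneg t)
      h2.aestronglyMeasurable, lintegral_sq_stu hτ, ENNReal.toReal_ofReal (by positivity)]
  rw [lintegral_stuPi (by fun_prop)]
  simp_rw [hin]
  rw [← ofReal_integral_eq_lintegral_ofReal hmS.integrable_sq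
    (Filter.Eventually.of_forall fun y => sq_nonneg _)]
  congr 1
  rw [← variance_of_integral_eq_zero hmS.aestronglyMeasurable.aemeasurable hmean, hS, hvar,
    Finset.sum_congr rfl fun j _ => h1 j, ← Finset.sum_mul, EuclideanSpace.real_norm_sq_eq, mul_comm]

/-! ### The prior on the regression vector -/

theorem priorTheta_eq (hτ : 0 < τ) (C₁ : ℝ) :
    priorTheta d C₁ τ = normalize ((stuPi d τ).restrict {θ | l1Norm θ ≤ C₁}) := by
  have hB : MeasurableSet {θ : EuclideanSpace ℝ (Fin d) | l1Norm θ ≤ C₁} :=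
    measurable_l1Norm measurableSet_Iic
  set c := ENNReal.ofReal ((2 * τ ^ 3 / Real.pi) ^ d) with hc
  have hc0 : c ≠ 0 := by
    have : 0 < (2 * τ ^ 3 / Real.pi) ^ d := by positivity
    simpa [hc] using this
  have hm : Measurable fun θ : EuclideanSpace ℝ (Fin d) =>
      ENNReal.ofReal (∏ i, ((τ ^ 2 + θ i ^ 2) ^ 2)⁻¹) := by fun_prop
  have hdens : (fun θ : EuclideanSpace ℝ (Fin d) => ∏ j, ENNReal.ofReal (stuPDF τ (θ j)))
      = c • fun θ => ENNReal.ofReal (∏ i, ((τ ^ 2 + θ i ^ 2) ^ 2)⁻¹) := by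
    funext θ
    rw [← ENNReal.ofReal_prod_of_nonneg fun j _ => (stuPDF_pos hτ _).le, Pi.smul_apply,
      smul_eq_mul, hc, ← ENNReal.ofReal_mul (by positivity)]
    simp only [stuPDF]
    rw [Finset.prod_mul_distrib, Finset.prod_const, Finset.card_univ, Fintype.card_fin]
  rw [priorTheta, ← normalize_smul _ hc0 ENNReal.ofReal_ne_top, stuPi_eq hτ, hdens,
    withDensity_smul _ hm, Measure.restrict_smul, restrict_withDensity hB]

theorem priorTheta_le (hτ : 0 < τ) (hd : 0 < d) {C₁ : ℝ} (hC : 2 * d * τ ≤ C₁) :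
    priorTheta d C₁ τ ≤ (2 : ℝ≥0∞) • stuPi d τ := by
  rw [priorTheta_eq hτ, normalize, Measure.restrict_apply_univ]
  have h := stuPi_l1Norm_le hτ hd hC
  have h2 : (stuPi d τ {θ | l1Norm θ ≤ C₁})⁻¹ ≤ 2 := by
    rw [ENNReal.inv_le_iff_inv_le]
    simpa using h
  intro s
  simp only [Measure.smul_apply, smul_eq_mul]
  exact mul_le_mul' h2 (Measure.restrict_apply_le _ _)

theorem restrict_le_priorTheta (hτ : 0 < τ) (C₁ : ℝ) :
    (stuPi d τ).restrict {θ | l1Norm θ ≤ C₁} ≤ priorTheta d C₁ τ := by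
  have := isProbabilityMeasure_stuPi (d := d) hτ
  rw [priorTheta_eq hτ, normalize, Measure.restrict_apply_univ]
  intro s
  simp only [Measure.smul_apply, smul_eq_mul]
  refine le_mul_of_one_le_left' ?_
  rw [ENNReal.one_le_inv]
  exact prob_le_one

theorem isProbabilityMeasure_normalize {T : Type*} [MeasurableSpace T] {μ : Measure T}
    (h0 : μ Set.univ ≠ 0) (hT : μ Set.univ ≠ ∞) : IsProbabilityMeasure (normalize μ) := by
  constructor
  simp only [normalize, Measure.smul_apply, smul_eq_mul]
  exact ENNReal.inv_mul_cancel h0 hT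

theorem isProbabilityMeasure_priorTheta (hτ : 0 < τ) (hd : 0 < d) {C₁ : ℝ}
    (hC : 2 * d * τ ≤ C₁) : IsProbabilityMeasure (priorTheta d C₁ τ) := by
  have := isProbabilityMeasure_stuPi (d := d) hτ
  rw [priorTheta_eq hτ]
  refine isProbabilityMeasure_normalize ?_ ?_
  · rw [Measure.restrict_apply_univ]
    intro h
    have := stuPi_l1Norm_le hτ hd hC
    rw [h] at this
    simp at this
  · rw [Measure.restrict_apply_univ]
    exact measure_ne_top _ _

end StuPi

/-! ### The inverse-gamma prior -/

section InvGamma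

variable {a b : ℝ}

theorem measurable_invGammaPDF (a b : ℝ) : Measurable fun x : ℝ =>
    b ^ a / Real.Gamma a * x ^ (-a - 1) * Real.exp (-b / x) := by fun_prop

theorem invGammaPDF_nonneg (ha : 0 < a) (hb : 0 < b) {x : ℝ} (hx : 0 < x) :
    0 ≤ b ^ a / Real.Gamma a * x ^ (-a - 1) * Real.exp (-b / x) := by
  have := Real.Gamma_pos_of_pos ha
  positivity

theorem integral_invGammaPDF (ha : 0 < a) (hb : 0 < b) :
    ∫ x in Set.Ioi 0, b ^ a / Real.Gamma a * x ^ (-a - 1) * Real.exp (-b / x) = 1 := by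
  have hG := Real.Gamma_pos_of_pos ha
  have h := integral_comp_rpow_Ioi (fun y : ℝ => y ^ (a - 1) * Real.exp (-(b * y)))
    (p := -1) (by norm_num)
  rw [Real.integral_rpow_mul_exp_neg_mul_Ioi ha hb] at h
  have h2 : ∫ x in Set.Ioi (0 : ℝ), x ^ (-a - 1) * Real.exp (-b / x)
      = (1 / b) ^ a * Real.Gamma a := by
    rw [← h]
    refine setIntegral_congr_fun measurableSet_Ioi fun x hx => ?_
    have hx : 0 < x := hx
    simp only [smul_eq_mul, abs_neg, abs_one, one_mul]
    rw [← Real.rpow_mul hx.le, ← mul_assoc, ← Real.rpow_add hx, Real.rpow_neg_one]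
    congr 1
    · congr 1; ring
    · congr 1; ring
  simp_rw [mul_assoc]
  rw [integral_const_mul, h2, one_div, Real.inv_rpow hb.le]
  field_simp

theorem integrable_invGammaPDF (ha : 0 < a) (hb : 0 < b) :
    IntegrableOn (fun x => b ^ a / Real.Gamma a * x ^ (-a - 1) * Real.exp (-b / x))
      (Set.Ioi 0) := by
  by_contra h
  have := integral_invGammaPDF ha hb
  rw [integral_undef h] at this
  exact zero_ne_one this

theorem isProbabilityMeasure_invGamma (ha : 0 < a) (hb : 0 < b) :
    IsProbabilityMeasure (invGamma a b) := by
  constructor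
  rw [invGamma, withDensity_apply _ MeasurableSet.univ, Measure.restrict_univ,
    ← ofReal_integral_eq_lintegral_ofReal (integrable_invGammaPDF ha hb),
    integral_invGammaPDF ha hb, ENNReal.ofReal_one]
  filter_upwards [ae_restrict_mem measurableSet_Ioi] with x hx
  exact invGammaPDF_nonneg ha hb hx

theorem isProbabilityMeasure_priorSigma (ha : 0 < a) (hb : 0 < b) :
    IsProbabilityMeasure (priorSigma a b) := by
  have := isProbabilityMeasure_invGamma ha hb
  exact Measure.isProbabilityMeasure_map (by fun_prop)

theorem ae_pos_invGamma : ∀ᵐ x ∂(invGamma a b), 0 < x := by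
  refine (withDensity_absolutelyContinuous _ _).ae_le ?_
  exact ae_restrict_mem measurableSet_Ioi

theorem ae_pos_priorSigma : ∀ᵐ σ ∂(priorSigma a b), 0 < σ := by
  rw [priorSigma, ae_map_iff (by fun_prop) measurableSet_Ioi]
  filter_upwards [ae_pos_invGamma] with x hx
  exact Real.sqrt_pos.2 hx

/-- The prior of `σ` puts mass of order `1 / n` on a relative `1 / n`-neighbourhood. -/
theorem exists_le_priorSigma (ha : 0 < a) (hb : 0 < b) {l u : ℝ} (hl : 0 < l) (hu : 0 < u) :
    ∃ c : ℝ, 0 < c ∧ ∀ v : ℝ, l ≤ v → v ≤ u → ∀ n : ℕ, 1 ≤ n → ENNReal.ofReal (c / n)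
      ≤ priorSigma a b {σ | 0 < σ ∧ v ≤ σ ^ 2 ∧ σ ^ 2 ≤ v * (1 + 1 / n)} := by
  have hG := Real.Gamma_pos_of_pos ha
  set p := b ^ a / Real.Gamma a * (2 * u) ^ (-a - 1) * Real.exp (-b / l) with hp
  have hp0 : 0 < p := by positivity
  refine ⟨p * l, by positivity, fun v hlv hvu n hn => ?_⟩
  have hn' : (1 : ℝ) ≤ n := by exact_mod_cast hn
  have hv : 0 < v := by linarith
  have hn1 : 1 / (n : ℝ) ≤ 1 := by rw [div_le_one (by linarith)]; exact hn'
  have hn0 : 0 < 1 / (n : ℝ) := by positivity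
  have hms : MeasurableSet {σ : ℝ | 0 < σ ∧ v ≤ σ ^ 2 ∧ σ ^ 2 ≤ v * (1 + 1 / n)} := by
    have h2 : Measurable fun σ : ℝ => σ ^ 2 := by fun_prop
    exact measurableSet_Ioi.inter
      ((measurableSet_le measurable_const h2).inter (measurableSet_le h2 measurable_const))
  rw [priorSigma, Measure.map_apply (by fun_prop) hms]
  have hsub : Set.Icc v (v * (1 + 1 / n))
      ⊆ Real.sqrt ⁻¹' {σ : ℝ | 0 < σ ∧ v ≤ σ ^ 2 ∧ σ ^ 2 ≤ v * (1 + 1 / n)} := by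
    intro x hx
    have hx0 : 0 < x := by linarith [hx.1]
    refine ⟨Real.sqrt_pos.2 hx0, ?_, ?_⟩ <;> rw [Real.sq_sqrt hx0.le]
    exacts [hx.1, hx.2]
  refine le_trans ?_ (measure_mono hsub)
  have hI : Set.Icc v (v * (1 + 1 / n)) ∩ Set.Ioi 0 = Set.Icc v (v * (1 + 1 / n)) :=
    Set.inter_eq_left.2 fun x hx => lt_of_lt_of_le hv hx.1
  rw [invGamma, withDensity_apply _ measurableSet_Icc, Measure.restrict_restrict measurableSet_Icc,
    hI]
  calc ENNReal.ofReal (p * l / n) ≤ ENNReal.ofReal p * volume (Set.Icc v (v * (1 + 1 / n))) := by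
        rw [Real.volume_Icc, ← ENNReal.ofReal_mul hp0.le]
        apply ENNReal.ofReal_le_ofReal
        rw [show v * (1 + 1 / (n : ℝ)) - v = v * (1 / n) by ring, mul_div_assoc, mul_one_div]
        gcongr
    _ = ∫⁻ _x in Set.Icc v (v * (1 + 1 / n)), ENNReal.ofReal p := by
        rw [setLIntegral_const]
    _ ≤ _ := by
        refine setLIntegral_mono' measurableSet_Icc fun x hx => ENNReal.ofReal_le_ofReal ?_
        have hx0 : 0 < x := by linarith [hx.1]
        have hx2 : x ≤ 2 * u := by nlinarith [hx.2]
        rw [hp]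
        have h1 : (2 * u) ^ (-a - 1) ≤ x ^ (-a - 1) :=
          Real.rpow_le_rpow_of_nonpos hx0 hx2 (by linarith)
        have h2 : -b / l ≤ -b / x := by
          rw [neg_div, neg_div, neg_le_neg_iff]
          gcongr
          linarith [hx.1]
        gcongr

/-- The factor `e^{-b / x}` makes all negative moments of `σ` finite under the prior. -/
theorem lintegral_inv_pow_priorSigma_le (ha : 0 < a) (hb : 0 < b) (n : ℕ) :
    ∫⁻ σ, ENNReal.ofReal ((σ ^ 2)⁻¹ ^ n) ∂(priorSigma a b)
      ≤ ENNReal.ofReal (2 ^ a * (2 * n / b) ^ n) := by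
  have hb2 : 0 < b / 2 := by positivity
  have := isProbabilityMeasure_invGamma ha hb2
  have hG := Real.Gamma_pos_of_pos ha
  rw [priorSigma, lintegral_map (by fun_prop) (by fun_prop), invGamma,
    lintegral_withDensity_eq_lintegral_mul _ (measurable_invGammaPDF a b).ennreal_ofReal
      (by fun_prop)]
  calc _ ≤ ∫⁻ x in Set.Ioi 0, ENNReal.ofReal (2 ^ a * (2 * n / b) ^ n)
        * ENNReal.ofReal ((b / 2) ^ a / Real.Gamma a * x ^ (-a - 1) * Real.exp (-(b / 2) / x)) := by
        refine setLIntegral_mono' measurableSet_Ioi fun x hx => ?_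
        have hx : 0 < x := hx
        rw [Pi.mul_apply, ← ENNReal.ofReal_mul (invGammaPDF_nonneg ha hb hx),
          ← ENNReal.ofReal_mul (by positivity)]
        apply ENNReal.ofReal_le_ofReal
        rw [Real.sq_sqrt hx.le]
        -- half of the exponential factor absorbs the negative power of `x`
        have h1 : x⁻¹ ^ n * Real.exp (-(b / 2) / x) ≤ (2 * n / b) ^ n := by
          have h2 := Real.pow_div_factorial_le_exp (b / 2 * x⁻¹) (by positivity) n
          rw [div_le_iff₀ (by positivity), mul_pow] at h2
          have h3 : ((n.factorial : ℕ) : ℝ) ≤ (n : ℝ) ^ n := by exact_mod_cast n.factorial_le_pow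
          rw [show -(b / 2) / x = -(b / 2 * x⁻¹) by ring, Real.exp_neg,
            ← div_eq_mul_inv, div_le_iff₀ (Real.exp_pos _)]
          have h4 : (2 * n / b) ^ n = (n : ℝ) ^ n * ((b / 2) ^ n)⁻¹ := by
            rw [← inv_pow, ← mul_pow]; congr 1; field_simp
          rw [h4, mul_right_comm, ← div_eq_mul_inv, le_div_iff₀ (by positivity)]
          calc x⁻¹ ^ n * (b / 2) ^ n ≤ Real.exp (b / 2 * x⁻¹) * n.factorial := by
                rw [mul_comm]; exact h2
            _ ≤ Real.exp (b / 2 * x⁻¹) * n ^ n := by gcongr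
            _ = _ := by ring
        have h5 : Real.exp (-b / x) = Real.exp (-(b / 2) / x) * Real.exp (-(b / 2) / x) := by
          rw [← Real.exp_add]; congr 1; ring
        have h6 : b ^ a = 2 ^ a * (b / 2) ^ a := by
          rw [← Real.mul_rpow (by norm_num) hb2.le]; congr 1; ring
        calc _ = (2 ^ a * ((b / 2) ^ a / Real.Gamma a * x ^ (-a - 1)
                * Real.exp (-(b / 2) / x))) * (x⁻¹ ^ n * Real.exp (-(b / 2) / x)) := by
              rw [h5, h6]; ring
          _ ≤ (2 ^ a * ((b / 2) ^ a / Real.Gamma a * x ^ (-a - 1)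
                * Real.exp (-(b / 2) / x))) * (2 * n / b) ^ n := by gcongr
          _ = _ := by ring
    _ = ENNReal.ofReal (2 ^ a * (2 * n / b) ^ n) * invGamma a (b / 2) Set.univ := by
        rw [lintegral_const_mul _ (measurable_invGammaPDF a (b / 2)).ennreal_ofReal, invGamma,
          withDensity_apply _ MeasurableSet.univ, Measure.restrict_univ]
    _ = _ := by rw [measure_univ, mul_one]

end InvGamma

/-! ### The likelihood ratio in closed form -/

section Ratio

variable {d : ℕ}

theorem lratio_eq {p₀ p : EuclideanSpace ℝ (Fin d) × ℝ} (h0 : 0 < p₀.2) (h : 0 < p.2)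
    (w : ℝ × EuclideanSpace ℝ (Fin d)) :
    lratio p₀ p w = ENNReal.ofReal (p₀.2 / p.2 * Real.exp ((w.1 - inner ℝ w.2 p₀.1) ^ 2
      / (2 * p₀.2 ^ 2) - (w.1 - inner ℝ w.2 p.1) ^ 2 / (2 * p.2 ^ 2))) := by
  have hv : Real.toNNReal (p₀.2 ^ 2) ≠ 0 := by simpa using h0.ne'
  simp only [lratio, dens, gaussianPDF]
  rw [← ENNReal.ofReal_inv_of_pos (gaussianPDFReal_pos _ _ _ hv),
    ← ENNReal.ofReal_mul (inv_nonneg.2 (gaussianPDFReal_nonneg _ _ _))]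
  congr 1
  simp only [gaussianPDFReal]
  rw [Real.coe_toNNReal _ (by positivity), Real.coe_toNNReal _ (by positivity),
    Real.sqrt_mul (by positivity) (p₀.2 ^ 2), Real.sqrt_mul (by positivity) (p.2 ^ 2),
    Real.sqrt_sq h0.le, Real.sqrt_sq h.le, Real.exp_sub, neg_div, neg_div, Real.exp_neg, Real.exp_neg]
  field_simp

theorem lratioProd_eq {n : ℕ} {p₀ p : EuclideanSpace ℝ (Fin d) × ℝ} (h0 : 0 < p₀.2) (h : 0 < p.2)
    (z : Fin n → ℝ × EuclideanSpace ℝ (Fin d)) :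
    lratioProd p₀ z p = ENNReal.ofReal ((p₀.2 / p.2) ^ n * Real.exp
      (∑ i, (((z i).1 - inner ℝ (z i).2 p₀.1) ^ 2 / (2 * p₀.2 ^ 2)
        - ((z i).1 - inner ℝ (z i).2 p.1) ^ 2 / (2 * p.2 ^ 2)))) := by
  rw [lratioProd, Finset.prod_congr rfl fun i _ => lratio_eq h0 h (z i),
    ← ENNReal.ofReal_prod_of_nonneg fun i _ => by positivity, Finset.prod_mul_distrib,
    Finset.prod_const, Finset.card_univ, Fintype.card_fin, Real.exp_sum]

end Ratio

/-! ### Lower bound on the evidence -/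

section Evidence

variable {d : ℕ} {τ η : ℝ}

theorem measurable_prod_stuPDF (τ : ℝ) : Measurable fun θ : EuclideanSpace ℝ (Fin d) =>
    ∏ j, ENNReal.ofReal (stuPDF τ (θ j)) :=
  Finset.measurable_fun_prod _ fun j _ =>
    (measurable_stuPDF τ).ennreal_ofReal.comp (by fun_prop)

theorem lintegral_stuPi_eq (hτ : 0 < τ) {f : EuclideanSpace ℝ (Fin d) → ℝ≥0∞}
    (hf : Measurable f) : ∫⁻ θ, f θ ∂(stuPi d τ)
      = ∫⁻ θ, (∏ j, ENNReal.ofReal (stuPDF τ (θ j))) * f θ := by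
  rw [stuPi_eq hτ, lintegral_withDensity_eq_lintegral_mul _ (measurable_prod_stuPDF τ) hf]
  rfl

theorem lintegral_neg_stuPi (hτ : 0 < τ) {f : EuclideanSpace ℝ (Fin d) → ℝ≥0∞}
    (hf : Measurable f) : ∫⁻ θ, f (-θ) ∂(stuPi d τ) = ∫⁻ θ, f θ ∂(stuPi d τ) := by
  have hm := measurable_prod_stuPDF (d := d) τ
  rw [lintegral_stuPi_eq hτ hf, lintegral_stuPi_eq hτ (by fun_prop),
    ← lintegral_neg_eq_self (f := fun θ : EuclideanSpace ℝ (Fin d) =>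
      (∏ j, ENNReal.ofReal (stuPDF τ (θ j))) * f θ)]
  simp only [PiLp.neg_apply, stuPDF_neg]

/-- Polynomial tails: translating the Student density by `a` and shrinking its scale by `η` costs
only a polynomial factor. -/
theorem stuPDF_add_ge (hτ : 0 < τ) (hη : 0 < η) (hη1 : η ≤ 1) (a x : ℝ) :
    η * ((1 + |a| / τ) ^ 4)⁻¹ * stuPDF (η * τ) x ≤ stuPDF τ (a + x) := by
  have ha : 0 ≤ |a| := abs_nonneg a
  have h1 : τ ^ 2 + (a + x) ^ 2 ≤ (τ ^ 2 + x ^ 2) * (1 + |a| / τ) ^ 2 := by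
    rw [one_add_div hτ.ne', div_pow, ← mul_div_assoc, le_div_iff₀ (by positivity)]
    have hx : a * x ≤ |a| * |x| := by rw [← abs_mul]; exact le_abs_self _
    have h2 : (a + x) ^ 2 ≤ |a| ^ 2 + 2 * |a| * |x| + |x| ^ 2 := by
      rw [sq_abs, sq_abs]; nlinarith
    rw [← sq_abs x]
    have hx0 := abs_nonneg x
    nlinarith [mul_nonneg ha hτ.le, sq_nonneg (τ ^ 2 - |a| * |x|), mul_nonneg ha hx0,
      mul_le_mul_of_nonneg_right h2 (sq_nonneg τ), pow_pos hτ 3,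
      mul_nonneg ha (mul_nonneg hτ.le (sq_nonneg (τ - |x|))), mul_nonneg ha (pow_pos hτ 3).le,
      mul_nonneg (mul_nonneg ha hτ.le) (sq_nonneg (τ - |x|))]
  -- `(τ² + x²) η² ≤ (ητ)² + x²`
  have h3 : (τ ^ 2 + x ^ 2) * η ^ 2 ≤ (η * τ) ^ 2 + x ^ 2 := by
    have : η ^ 2 ≤ 1 := pow_le_one₀ hη.le hη1
    nlinarith [mul_le_mul_of_nonneg_left this (sq_nonneg x)]
  have hp : 0 < τ ^ 2 + x ^ 2 := by positivity
  have hq : 0 < τ ^ 2 + (a + x) ^ 2 := by positivity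
  have h4 : (τ ^ 2 + (a + x) ^ 2) ^ 2 ≤ ((τ ^ 2 + x ^ 2) * (1 + |a| / τ) ^ 2) ^ 2 := by gcongr
  have h5 : ((τ ^ 2 + x ^ 2) * η ^ 2) ^ 2 ≤ ((η * τ) ^ 2 + x ^ 2) ^ 2 := by gcongr
  unfold stuPDF
  have hA : 0 < 1 + |a| / τ := by positivity
  calc η * ((1 + |a| / τ) ^ 4)⁻¹ * (2 * (η * τ) ^ 3 / Real.pi * (((η * τ) ^ 2 + x ^ 2) ^ 2)⁻¹)
      ≤ η * ((1 + |a| / τ) ^ 4)⁻¹ * (2 * (η * τ) ^ 3 / Real.pi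
          * (((τ ^ 2 + x ^ 2) * η ^ 2) ^ 2)⁻¹) := by gcongr
    _ = 2 * τ ^ 3 / Real.pi * (((τ ^ 2 + x ^ 2) * (1 + |a| / τ) ^ 2) ^ 2)⁻¹ := by
        field_simp
    _ ≤ _ := by gcongr

theorem lintegral_stuPi_translate_le (hτ : 0 < τ) (hη : 0 < η) (hη1 : η ≤ 1)
    (θ₀ : EuclideanSpace ℝ (Fin d)) {f : EuclideanSpace ℝ (Fin d) → ℝ≥0∞} (hf : Measurable f) :
    ENNReal.ofReal (η ^ d * (∏ j, (1 + |θ₀ j| / τ) ^ 4)⁻¹)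
        * ∫⁻ θ, f (θ₀ + θ) ∂(stuPi d (η * τ)) ≤ ∫⁻ θ, f θ ∂(stuPi d τ) := by
  have hητ : 0 < η * τ := by positivity
  have hm := measurable_prod_stuPDF (d := d) (η * τ)
  rw [lintegral_stuPi_eq hτ hf, lintegral_stuPi_eq hητ (by fun_prop),
    ← lintegral_add_left_eq_self (fun θ : EuclideanSpace ℝ (Fin d) =>
      (∏ j, ENNReal.ofReal (stuPDF τ (θ j))) * f θ) θ₀,
    ← lintegral_const_mul _ (by fun_prop)]
  refine lintegral_mono fun θ => ?_
  rw [← mul_assoc]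
  gcongr
  rw [← ENNReal.ofReal_prod_of_nonneg fun j _ => (stuPDF_pos hητ _).le,
    ← ENNReal.ofReal_prod_of_nonneg fun j _ => (stuPDF_pos hτ _).le,
    ← ENNReal.ofReal_mul (by positivity)]
  apply ENNReal.ofReal_le_ofReal
  have : η ^ d * (∏ j, (1 + |θ₀ j| / τ) ^ 4)⁻¹ * ∏ j, stuPDF (η * τ) (θ j)
      = ∏ j, (η * ((1 + |θ₀ j| / τ) ^ 4)⁻¹ * stuPDF (η * τ) (θ j)) := by
    rw [Finset.prod_mul_distrib, Finset.prod_mul_distrib, Finset.prod_const, Finset.card_univ,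
      Fintype.card_fin, Finset.prod_inv_distrib]
  rw [this]
  refine Finset.prod_le_prod (fun j _ => ?_) fun j _ => ?_
  · have := (stuPDF_pos hητ (θ j)).le; positivity
  · exact stuPDF_add_ge hτ hη hη1 _ _

/-- Symmetrisation removes a term that is odd in `θ`, whatever its size; Markov's inequality then
handles the even term. -/
theorem le_setLIntegral_exp_stuPi (hτ : 0 < τ) (hd : 0 < d) {r : ℝ} (hr : 2 * d * τ ≤ r)
    {L Q : EuclideanSpace ℝ (Fin d) → ℝ} (hL : Measurable L) (hQ : Measurable Q)
    (hLneg : ∀ θ, L (-θ) = -L θ) (hQneg : ∀ θ, Q (-θ) = Q θ) {q : ℝ} (hq : 0 ≤ q)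
    (hQq : ∫⁻ θ, ENNReal.ofReal (Q θ) ∂(stuPi d τ) ≤ ENNReal.ofReal q) :
    ENNReal.ofReal (1 / 4 * Real.exp (-(4 * q + 1)))
      ≤ ∫⁻ θ in {θ | l1Norm θ ≤ r}, ENNReal.ofReal (Real.exp (L θ - Q θ)) ∂(stuPi d τ) := by
  have hP := isProbabilityMeasure_stuPi (d := d) hτ
  have hE : MeasurableSet {θ : EuclideanSpace ℝ (Fin d) | l1Norm θ ≤ r} :=
    measurable_l1Norm measurableSet_Iic
  set E := {θ : EuclideanSpace ℝ (Fin d) | l1Norm θ ≤ r} with hEdef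
  have hEneg : ∀ θ, -θ ∈ E ↔ θ ∈ E := fun θ => by simp [hEdef, l1Norm]
  set F := E.indicator fun θ => ENNReal.ofReal (Real.exp (L θ - Q θ)) with hF
  have hFm : Measurable F := (by fun_prop : Measurable fun θ =>
    ENNReal.ofReal (Real.exp (L θ - Q θ))).indicator hE
  set S := E ∩ {θ | Q θ ≤ 4 * q + 1} with hS
  have hSm : MeasurableSet S := hE.inter (hQ measurableSet_Iic)
  have hmark : stuPi d τ {θ | 4 * q + 1 < Q θ} ≤ 1 / 4 := by
    have h1 := meas_ge_le_lintegral_div (μ := stuPi d τ)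
      (f := fun θ => ENNReal.ofReal (Q θ)) (by fun_prop) (ε := ENNReal.ofReal (4 * q + 1))
      (by simpa using by positivity) ENNReal.ofReal_ne_top
    calc stuPi d τ {θ | 4 * q + 1 < Q θ}
        ≤ stuPi d τ {θ | ENNReal.ofReal (4 * q + 1) ≤ ENNReal.ofReal (Q θ)} :=
          measure_mono fun θ (hθ : 4 * q + 1 < Q θ) => ENNReal.ofReal_le_ofReal hθ.le
      _ ≤ ENNReal.ofReal q / ENNReal.ofReal (4 * q + 1) := h1.trans (by gcongr)
      _ = ENNReal.ofReal (q / (4 * q + 1)) := by rw [ENNReal.ofReal_div_of_pos (by positivity)]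
      _ ≤ ENNReal.ofReal (1 / 4) := by
          apply ENNReal.ofReal_le_ofReal
          rw [div_le_div_iff₀ (by positivity) (by norm_num)]; linarith
      _ = 1 / 4 := by
          rw [ENNReal.ofReal_div_of_pos (by norm_num)]; simp
  have hSmass : (1 / 4 : ℝ≥0∞) ≤ stuPi d τ S := by
    have h1 := stuPi_l1Norm_le hτ hd hr
    have h2 : stuPi d τ E ≤ stuPi d τ S + stuPi d τ {θ | 4 * q + 1 < Q θ} := by
      refine (measure_mono fun θ hθ => ?_).trans (measure_union_le _ _)
      by_cases h : Q θ ≤ 4 * q + 1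
      · exact Or.inl ⟨hθ, h⟩
      · exact Or.inr (not_le.1 h)
    have h3 : (1 / 4 : ℝ≥0∞) + 1 / 4 = 1 / 2 := by
      rw [ENNReal.div_add_div_same, one_add_one_eq_two,
        ENNReal.div_eq_div_iff (by norm_num) (by norm_num) (by norm_num) (by norm_num)]
      norm_num
    have h4 : (1 / 4 : ℝ≥0∞) + 1 / 4 ≤ stuPi d τ S + 1 / 4 := by
      rw [h3]; exact h1.trans (h2.trans (by gcongr))
    exact (ENNReal.add_le_add_iff_right (by norm_num)).1 h4
  have hpt : ∀ θ, S.indicator (fun _ => 2 * ENNReal.ofReal (Real.exp (-(4 * q + 1)))) θ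
      ≤ F θ + F (-θ) := by
    intro θ
    by_cases h : θ ∈ S
    · have hθ : θ ∈ E := h.1
      have hQ4 : Q θ ≤ 4 * q + 1 := h.2
      rw [Set.indicator_of_mem h, hF, Set.indicator_of_mem hθ,
        Set.indicator_of_mem ((hEneg θ).2 hθ), hLneg, hQneg,
        ← ENNReal.ofReal_add (Real.exp_pos _).le (Real.exp_pos _).le,
        show (2 : ℝ≥0∞) = ENNReal.ofReal 2 by simp, ← ENNReal.ofReal_mul (by norm_num)]
      apply ENNReal.ofReal_le_ofReal
      have h1 : Real.exp (-(4 * q + 1)) ≤ Real.exp (-Q θ) := Real.exp_le_exp.2 (by linarith)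
      have h2 : 2 ≤ Real.exp (L θ) + Real.exp (-L θ) := by
        have h3 := Real.add_one_le_exp (L θ)
        have h4 := Real.add_one_le_exp (-L θ)
        linarith
      have h5 := Real.exp_pos (-Q θ)
      rw [sub_eq_add_neg, sub_eq_add_neg, Real.exp_add, Real.exp_add, ← add_mul]
      nlinarith
    · rw [Set.indicator_of_notMem h]; exact bot_le
  have hsum : 2 * ∫⁻ θ, F θ ∂(stuPi d τ) = ∫⁻ θ, (F θ + F (-θ)) ∂(stuPi d τ) := by
    rw [lintegral_add_left hFm, lintegral_neg_stuPi hτ hFm, two_mul]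
  rw [← lintegral_indicator hE]
  have h2 : (2 : ℝ≥0∞) * ENNReal.ofReal (1 / 4 * Real.exp (-(4 * q + 1)))
      ≤ 2 * ∫⁻ θ, F θ ∂(stuPi d τ) := by
    rw [hsum]
    refine le_trans ?_ (lintegral_mono hpt)
    rw [lintegral_indicator hSm, setLIntegral_const, mul_assoc]
    gcongr
    rw [mul_comm (1 / 4 : ℝ), ENNReal.ofReal_mul (Real.exp_pos _).le]
    gcongr
    rw [ENNReal.ofReal_div_of_pos (by norm_num)]
    simpa using hSmass
  exact (ENNReal.mul_le_mul_iff_right (by norm_num) (by norm_num)).1 h2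

/-- A lower bound on the evidence that holds for every sample: the only random quantity in it is
`∑ᵢ ‖xᵢ‖²`. -/
theorem evidence_ge {n : ℕ} (hn : 1 ≤ n) (hd : 0 < d) (hτ : 0 < τ) (hη : 0 < η) (hη1 : η ≤ 1)
    {θ₀ : EuclideanSpace ℝ (Fin d)} {σ₀ C₁ a b : ℝ} (ha : 0 < a) (hb : 0 < b) (hσ₀ : 0 < σ₀)
    (hC : l1Norm θ₀ ≤ C₁ - 2 * d * τ) (z : Fin n → ℝ × EuclideanSpace ℝ (Fin d)) :
    ENNReal.ofReal (η ^ d * (∏ j, (1 + |θ₀ j| / τ) ^ 4)⁻¹)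
        * priorSigma a b {σ | 0 < σ ∧ σ₀ ^ 2 ≤ σ ^ 2 ∧ σ ^ 2 ≤ σ₀ ^ 2 * (1 + 1 / n)}
        * ENNReal.ofReal (1 / 4 * Real.exp
          (-(4 * (η ^ 2 * τ ^ 2 * (∑ i, ‖(z i).2‖ ^ 2) / (2 * σ₀ ^ 2)) + 3 / 2)))
      ≤ ∫⁻ p, lratioProd (θ₀, σ₀) z p ∂(prior d C₁ τ a b) := by
  have hητ : 0 < η * τ := by positivity
  have hn' : (1 : ℝ) ≤ n := by exact_mod_cast hn
  have := isProbabilityMeasure_priorSigma ha hb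
  have hl0 : 0 ≤ l1Norm θ₀ := Finset.sum_nonneg fun i _ => abs_nonneg _
  have := isProbabilityMeasure_priorTheta (d := d) hτ hd (C₁ := C₁) (by linarith)
  set S := {σ : ℝ | 0 < σ ∧ σ₀ ^ 2 ≤ σ ^ 2 ∧ σ ^ 2 ≤ σ₀ ^ 2 * (1 + 1 / n)} with hS
  set q := η ^ 2 * τ ^ 2 * (∑ i, ‖(z i).2‖ ^ 2) / (2 * σ₀ ^ 2) with hq
  have hq0 : 0 ≤ q := by positivity
  set L : EuclideanSpace ℝ (Fin d) → ℝ := fun Δ => ∑ i, 2 * ((z i).1 - inner ℝ (z i).2 θ₀)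
    * inner ℝ (z i).2 Δ / (2 * σ₀ ^ 2) with hL
  set Q : EuclideanSpace ℝ (Fin d) → ℝ := fun Δ => ∑ i, (inner ℝ (z i).2 Δ) ^ 2 / (2 * σ₀ ^ 2)
    with hQ
  have hLm : Measurable L := by fun_prop
  have hQm : Measurable Q := by fun_prop
  set B := {θ : EuclideanSpace ℝ (Fin d) | l1Norm θ ≤ C₁} with hB
  have hBm : MeasurableSet B := measurable_l1Norm measurableSet_Iic
  set f := B.indicator fun θ : EuclideanSpace ℝ (Fin d) =>
    ENNReal.ofReal (Real.exp (-(1 / 2)) * Real.exp (L (θ - θ₀) - Q (θ - θ₀))) with hf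
  have hfm : Measurable f := (by fun_prop : Measurable fun θ : EuclideanSpace ℝ (Fin d) =>
    ENNReal.ofReal (Real.exp (-(1 / 2)) * Real.exp (L (θ - θ₀) - Q (θ - θ₀)))).indicator hBm
  have hlr : ∀ θ, ∀ σ ∈ S, ENNReal.ofReal (Real.exp (-(1 / 2)) * Real.exp (L (θ - θ₀) - Q (θ - θ₀)))
      ≤ lratioProd (θ₀, σ₀) z (θ, σ) := by
    rintro θ σ ⟨hσ, h1, h2⟩
    rw [lratioProd_eq (p₀ := (θ₀, σ₀)) (p := (θ, σ)) hσ₀ hσ]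
    apply ENNReal.ofReal_le_ofReal
    simp only
    have h3 : Real.exp (-(1 / 2)) ≤ (σ₀ / σ) ^ n := by
      have h4 : σ / σ₀ ≤ Real.exp (1 / (2 * n)) := by
        refine (sq_le_sq₀ (by positivity) (Real.exp_pos _).le).1 ?_
        rw [← Real.exp_nat_mul, div_pow, div_le_iff₀ (by positivity)]
        calc σ ^ 2 ≤ σ₀ ^ 2 * (1 + 1 / n) := h2
          _ ≤ σ₀ ^ 2 * Real.exp (1 / n) := by
              gcongr; linarith [Real.add_one_le_exp (1 / (n : ℝ))]
          _ = _ := by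
              rw [mul_comm]; congr 2; push_cast; field_simp
      have h5 : (σ / σ₀) ^ n ≤ Real.exp (1 / 2) := by
        calc (σ / σ₀) ^ n ≤ Real.exp (1 / (2 * n)) ^ n := by gcongr
          _ = Real.exp (1 / 2) := by
              rw [← Real.exp_nat_mul]; congr 1; field_simp
      rw [Real.exp_neg, show σ₀ / σ = (σ / σ₀)⁻¹ by rw [inv_div], inv_pow]
      exact inv_anti₀ (by positivity) h5
    have h6 : L (θ - θ₀) - Q (θ - θ₀) ≤ ∑ i, (((z i).1 - inner ℝ (z i).2 θ₀) ^ 2 / (2 * σ₀ ^ 2)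
        - ((z i).1 - inner ℝ (z i).2 θ) ^ 2 / (2 * σ ^ 2)) := by
      rw [hL, hQ, ← Finset.sum_sub_distrib]
      refine Finset.sum_le_sum fun i _ => ?_
      have h7 : ((z i).1 - inner ℝ (z i).2 θ) ^ 2 / (2 * σ ^ 2)
          ≤ ((z i).1 - inner ℝ (z i).2 θ) ^ 2 / (2 * σ₀ ^ 2) := by gcongr
      refine le_trans (le_of_eq ?_) (sub_le_sub_left h7 _)
      rw [inner_sub_right]
      ring
    gcongr
  have key : ENNReal.ofReal (η ^ d * (∏ j, (1 + |θ₀ j| / τ) ^ 4)⁻¹)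
      * ENNReal.ofReal (1 / 4 * Real.exp (-(4 * q + 3 / 2)))
      ≤ ∫⁻ θ in B, ENNReal.ofReal
        (Real.exp (-(1 / 2)) * Real.exp (L (θ - θ₀) - Q (θ - θ₀))) ∂(priorTheta d C₁ τ) := by
    calc _ ≤ ENNReal.ofReal (η ^ d * (∏ j, (1 + |θ₀ j| / τ) ^ 4)⁻¹)
          * ∫⁻ Δ, f (θ₀ + Δ) ∂(stuPi d (η * τ)) := by
          gcongr
          have h1 := le_setLIntegral_exp_stuPi (r := 2 * d * τ) hητ hd
            (by have : η * τ ≤ τ := by nlinarith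
                gcongr) hLm hQm
            (fun θ => by simp [hL, neg_div, Finset.sum_neg_distrib])
            (fun θ => by simp [hQ]) hq0 (by
              rw [hQ]
              have h2 : ∀ θ : EuclideanSpace ℝ (Fin d), ENNReal.ofReal
                  (∑ i, (inner ℝ (z i).2 θ) ^ 2 / (2 * σ₀ ^ 2)) = ∑ i, ENNReal.ofReal
                    ((2 * σ₀ ^ 2)⁻¹) * ENNReal.ofReal ((inner ℝ (z i).2 θ) ^ 2) := fun θ => by
                rw [ENNReal.ofReal_sum_of_nonneg fun i _ => by positivity]
                refine Finset.sum_congr rfl fun i _ => ?_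
                rw [← ENNReal.ofReal_mul (by positivity)]
                congr 1; ring
              simp_rw [h2]
              rw [lintegral_finsetSum _ fun i _ => by fun_prop]
              have h3 : ∀ i : Fin n, ∫⁻ θ, ENNReal.ofReal ((2 * σ₀ ^ 2)⁻¹)
                  * ENNReal.ofReal ((inner ℝ (z i).2 θ) ^ 2) ∂(stuPi d (η * τ))
                  = ENNReal.ofReal ((2 * σ₀ ^ 2)⁻¹ * ((η * τ) ^ 2 * ‖(z i).2‖ ^ 2)) := fun i => by
                rw [lintegral_const_mul _ (by fun_prop), lintegral_inner_sq_stuPi hητ,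
                  ← ENNReal.ofReal_mul (by positivity)]
              simp_rw [h3]
              rw [← ENNReal.ofReal_sum_of_nonneg fun i _ => by positivity]
              apply ENNReal.ofReal_le_ofReal
              rw [hq, ← Finset.mul_sum, ← Finset.mul_sum]
              apply le_of_eq
              field_simp)
          have hEm : MeasurableSet {θ : EuclideanSpace ℝ (Fin d) | l1Norm θ ≤ 2 * d * τ} :=
            measurable_l1Norm measurableSet_Iic
          calc _ = ENNReal.ofReal (Real.exp (-(1 / 2)))
                * ENNReal.ofReal (1 / 4 * Real.exp (-(4 * q + 1))) := by
                rw [← ENNReal.ofReal_mul (Real.exp_pos _).le, mul_left_comm, ← Real.exp_add]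
                congr 3; ring
            _ ≤ ENNReal.ofReal (Real.exp (-(1 / 2))) * ∫⁻ Δ in {θ | l1Norm θ ≤ 2 * d * τ},
                  ENNReal.ofReal (Real.exp (L Δ - Q Δ)) ∂(stuPi d (η * τ)) := by gcongr
            _ = ∫⁻ Δ in {θ | l1Norm θ ≤ 2 * d * τ}, ENNReal.ofReal
                  (Real.exp (-(1 / 2)) * Real.exp (L Δ - Q Δ)) ∂(stuPi d (η * τ)) := by
                rw [← lintegral_const_mul _ (by fun_prop)]
                simp_rw [ENNReal.ofReal_mul (Real.exp_pos (-(1 / 2))).le]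
            _ ≤ _ := by
                rw [← lintegral_indicator hEm]
                refine lintegral_mono fun Δ => Set.indicator_apply_le (a := Δ)
                  (g := fun Δ => f (θ₀ + Δ)) fun hΔ => ?_
                have hmem : θ₀ + Δ ∈ B := by
                  have h4 : l1Norm (θ₀ + Δ) ≤ l1Norm θ₀ + l1Norm Δ := by
                    simp only [l1Norm, ← Finset.sum_add_distrib, PiLp.add_apply]
                    exact Finset.sum_le_sum fun i _ => abs_add_le _ _
                  have h5 : l1Norm Δ ≤ 2 * d * τ := hΔ
                  have : l1Norm (θ₀ + Δ) ≤ C₁ := by linarith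
                  exact this
                simp only [hf, Set.indicator_of_mem hmem, add_sub_cancel_left, le_refl]
      _ ≤ ∫⁻ θ, f θ ∂(stuPi d τ) := lintegral_stuPi_translate_le hτ hη hη1 θ₀ hfm
      _ = ∫⁻ θ in B, ENNReal.ofReal
        (Real.exp (-(1 / 2)) * Real.exp (L (θ - θ₀) - Q (θ - θ₀))) ∂((stuPi d τ).restrict B) := by
          rw [hf, lintegral_indicator hBm, Measure.restrict_restrict hBm, Set.inter_self]
      _ ≤ _ := by
          exact lintegral_mono' (Measure.restrict_mono le_rfl (restrict_le_priorTheta hτ C₁)) le_rfl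
  have hSm : MeasurableSet S := by
    have h2 : Measurable fun σ : ℝ => σ ^ 2 := by fun_prop
    exact measurableSet_Ioi.inter
      ((measurableSet_le measurable_const h2).inter (measurableSet_le h2 measurable_const))
  calc _ = (ENNReal.ofReal (η ^ d * (∏ j, (1 + |θ₀ j| / τ) ^ 4)⁻¹)
      * ENNReal.ofReal (1 / 4 * Real.exp (-(4 * q + 3 / 2)))) * priorSigma a b S := by ring
    _ ≤ (∫⁻ θ in B, ENNReal.ofReal
        (Real.exp (-(1 / 2)) * Real.exp (L (θ - θ₀) - Q (θ - θ₀))) ∂(priorTheta d C₁ τ))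
          * priorSigma a b S := by gcongr
    _ ≤ (∫⁻ θ, ENNReal.ofReal
        (Real.exp (-(1 / 2)) * Real.exp (L (θ - θ₀) - Q (θ - θ₀))) ∂(priorTheta d C₁ τ))
          * priorSigma a b S := by gcongr; exact Measure.restrict_le_self
    _ = ∫⁻ θ, ENNReal.ofReal
        (Real.exp (-(1 / 2)) * Real.exp (L (θ - θ₀) - Q (θ - θ₀))) * priorSigma a b S
          ∂(priorTheta d C₁ τ) := by
        rw [lintegral_mul_const _ (by fun_prop)]
    _ ≤ ∫⁻ θ, ∫⁻ σ, lratioProd (θ₀, σ₀) z (θ, σ) ∂(priorSigma a b) ∂(priorTheta d C₁ τ) := by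
        refine lintegral_mono fun θ => ?_
        rw [← setLIntegral_const]
        exact (setLIntegral_mono' hSm fun σ hσ => hlr θ σ hσ).trans (setLIntegral_le_lintegral _ _)
    _ = _ := by
        rw [prior, lintegral_prod _ (measurable_lratioProd_right _ z).aemeasurable]

end Evidence

/-! ### The Hellinger loss -/

section Loss

variable {d : ℕ}

/-- The loss `-log ρ`, where `ρ` is the Hellinger affinity of `P_p` and `P_{p₀}`; it dominates
every Rényi divergence of order in `(0, 1)` up to a factor. -/
def loss (PX : Measure (EuclideanSpace ℝ (Fin d))) (p₀ p : EuclideanSpace ℝ (Fin d) × ℝ) : ℝ :=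
  -Real.log (rho PX p p₀)

theorem measurable_rho (PX : Measure (EuclideanSpace ℝ (Fin d))) [IsProbabilityMeasure PX]
    (q : EuclideanSpace ℝ (Fin d) × ℝ) : Measurable fun p => rho PX p q := by
  have h1 : Measurable fun a : (EuclideanSpace ℝ (Fin d) × ℝ) × EuclideanSpace ℝ (Fin d) =>
      Real.exp (-(inner ℝ a.2 (a.1.1 - q.1)) ^ 2 / (4 * (a.1.2 ^ 2 + q.2 ^ 2))) := by fun_prop
  have h2 : Measurable fun p : EuclideanSpace ℝ (Fin d) × ℝ =>
      ∫ x, Real.exp (-(inner ℝ x (p.1 - q.1)) ^ 2 / (4 * (p.2 ^ 2 + q.2 ^ 2))) ∂PX :=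
    h1.stronglyMeasurable.integral_prod_right'.measurable
  have h3 : Measurable fun p : EuclideanSpace ℝ (Fin d) × ℝ => gaussScale p.2 q.2 := by
    unfold gaussScale; fun_prop
  exact h3.mul h2

theorem measurable_loss (PX : Measure (EuclideanSpace ℝ (Fin d))) [IsProbabilityMeasure PX]
    (p₀ : EuclideanSpace ℝ (Fin d) × ℝ) : Measurable (loss PX p₀) :=
  (measurable_rho PX p₀).log.neg

theorem gaussScale_le_one (s t : ℝ) : gaussScale s t ≤ 1 := by
  unfold gaussScale
  rw [Real.sqrt_le_left zero_le_one, one_pow]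
  exact div_le_one_of_le₀ (by nlinarith [sq_nonneg (s - t)]) (by positivity)

theorem integral_exp_neg_sq_le_one (PX : Measure (EuclideanSpace ℝ (Fin d)))
    [IsProbabilityMeasure PX] (θ : EuclideanSpace ℝ (Fin d)) {v : ℝ} (hv : 0 ≤ v) :
    ∫ x, Real.exp (-(inner ℝ x θ) ^ 2 / v) ∂PX ≤ 1 := by
  calc _ ≤ ∫ _x, (1 : ℝ) ∂PX := by
        refine integral_mono (integrable_exp_neg_sq PX θ hv) (integrable_const _) fun x => ?_
        rw [Real.exp_le_one_iff]
        exact div_nonpos_of_nonpos_of_nonneg (by nlinarith [sq_nonneg (inner ℝ x θ : ℝ)]) hv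
    _ = 1 := by simp

theorem rho_le_gaussScale (PX : Measure (EuclideanSpace ℝ (Fin d))) [IsProbabilityMeasure PX]
    (p q : EuclideanSpace ℝ (Fin d) × ℝ) : rho PX p q ≤ gaussScale p.2 q.2 :=
  mul_le_of_le_one_right (Real.sqrt_nonneg _) (integral_exp_neg_sq_le_one PX _ (by positivity))

theorem rho_le_one (PX : Measure (EuclideanSpace ℝ (Fin d))) [IsProbabilityMeasure PX]
    (p q : EuclideanSpace ℝ (Fin d) × ℝ) : rho PX p q ≤ 1 :=
  (rho_le_gaussScale PX p q).trans (gaussScale_le_one _ _)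

theorem loss_nonneg (PX : Measure (EuclideanSpace ℝ (Fin d))) [IsProbabilityMeasure PX]
    (p₀ p : EuclideanSpace ℝ (Fin d) × ℝ) : 0 ≤ loss PX p₀ p :=
  neg_nonneg.2 (Real.log_nonpos (rho_nonneg PX p p₀) (rho_le_one PX p p₀))

theorem exp_neg_loss (PX : Measure (EuclideanSpace ℝ (Fin d))) [IsProbabilityMeasure PX]
    {p₀ p : EuclideanSpace ℝ (Fin d) × ℝ} (h0 : 0 < p₀.2) (h : 0 < p.2) :
    Real.exp (-loss PX p₀ p) = rho PX p p₀ := by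
  rw [loss, neg_neg, Real.exp_log (rho_pos PX h h0)]

/-- Where the loss is bounded, it is comparable with the squared Hellinger distance `1 - ρ`. -/
theorem loss_le_exp_mul (PX : Measure (EuclideanSpace ℝ (Fin d))) [IsProbabilityMeasure PX]
    {p₀ p : EuclideanSpace ℝ (Fin d) × ℝ} (h0 : 0 < p₀.2) (h : 0 < p.2) {Λ : ℝ}
    (hΛ : loss PX p₀ p ≤ Λ) : loss PX p₀ p ≤ Real.exp Λ * (1 - rho PX p p₀) := by
  rw [← exp_neg_loss PX h0 h]
  set J := loss PX p₀ p
  have hJ : 0 ≤ J := loss_nonneg PX p₀ p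
  have h1 : J * Real.exp (-J) ≤ 1 - Real.exp (-J) := by
    have := Real.add_one_le_exp J
    have h2 : Real.exp J * Real.exp (-J) = 1 := by rw [← Real.exp_add]; simp
    nlinarith [Real.exp_pos (-J)]
  have h3 : Real.exp J * Real.exp (-J) = 1 := by rw [← Real.exp_add]; simp
  calc J = Real.exp J * (J * Real.exp (-J)) := by rw [mul_left_comm, h3, mul_one]
    _ ≤ Real.exp J * (1 - Real.exp (-J)) := by gcongr
    _ ≤ _ := by
        have h4 : 0 ≤ 1 - Real.exp (-J) := le_trans (by positivity) h1
        gcongr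

/-- The loss controls the noise level from above. -/
theorem le_of_loss_le (PX : Measure (EuclideanSpace ℝ (Fin d))) [IsProbabilityMeasure PX]
    {p₀ p : EuclideanSpace ℝ (Fin d) × ℝ} (h0 : 0 < p₀.2) (h : 0 < p.2) {Λ : ℝ}
    (hΛ : loss PX p₀ p ≤ Λ) : p.2 ≤ 2 * p₀.2 * Real.exp (2 * Λ) := by
  have h1 : Real.exp (-Λ) ≤ gaussScale p.2 p₀.2 := by
    calc Real.exp (-Λ) ≤ Real.exp (-loss PX p₀ p) := Real.exp_le_exp.2 (by linarith)
      _ = rho PX p p₀ := exp_neg_loss PX h0 h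
      _ ≤ _ := rho_le_gaussScale PX p p₀
  have h2 : Real.exp (-Λ) ^ 2 ≤ 2 * p.2 * p₀.2 / (p.2 ^ 2 + p₀.2 ^ 2) := by
    calc Real.exp (-Λ) ^ 2 ≤ gaussScale p.2 p₀.2 ^ 2 := by gcongr
      _ = _ := Real.sq_sqrt (by positivity)
  have h3 : 2 * p.2 * p₀.2 / (p.2 ^ 2 + p₀.2 ^ 2) ≤ 2 * p₀.2 / p.2 := by
    rw [div_le_div_iff₀ (by positivity) h]
    nlinarith [mul_pos h h0, mul_pos h0 (pow_pos h0 2)]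
  have h4 : Real.exp (-Λ) ^ 2 * p.2 ≤ 2 * p₀.2 := (le_div_iff₀ h).1 (h2.trans h3)
  have h5 : Real.exp (2 * Λ) * Real.exp (-Λ) ^ 2 = 1 := by
    rw [← Real.exp_nat_mul, ← Real.exp_add]; simp
  calc p.2 = Real.exp (2 * Λ) * (Real.exp (-Λ) ^ 2 * p.2) := by rw [← mul_assoc, h5, one_mul]
    _ ≤ Real.exp (2 * Λ) * (2 * p₀.2) := by gcongr
    _ = _ := by ring

end Loss

/-! ### Crude control of parameters with large loss -/

section Rough

variable {d : ℕ}

/-- The likelihood ratio factors into a function of the noise and a function of the design. -/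
theorem lratio_le {p₀ p : EuclideanSpace ℝ (Fin d) × ℝ} (h0 : 0 < p₀.2) (h : 0 < p.2)
    (w : ℝ × EuclideanSpace ℝ (Fin d)) :
    lratio p₀ p w ≤ ENNReal.ofReal (Real.exp ((w.1 - inner ℝ w.2 p₀.1) ^ 2 / (4 * p₀.2 ^ 2))) ^ 4
      * ENNReal.ofReal (p₀.2 / p.2 *
        Real.exp (-(inner ℝ w.2 (p.1 - p₀.1)) ^ 2 / (4 * (p.2 ^ 2 + p₀.2 ^ 2)))) := by
  rw [lratio_eq h0 h, ← ENNReal.ofReal_pow (Real.exp_pos _).le,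
    ← ENNReal.ofReal_mul (by positivity), ← Real.exp_nat_mul, mul_left_comm, ← Real.exp_add]
  apply ENNReal.ofReal_le_ofReal
  gcongr
  rw [inner_sub_right]
  set e := w.1 - inner ℝ w.2 p₀.1 with he
  have h1 : w.1 - inner ℝ w.2 p.1 = e - (inner ℝ w.2 p.1 - inner ℝ w.2 p₀.1) := by rw [he]; ring
  rw [h1]
  set u : ℝ := inner ℝ w.2 p.1 - inner ℝ w.2 p₀.1
  set s := p.2
  set t := p₀.2
  -- Cauchy's inequality for `u = (u - e) + e` with weights `s ^ 2` and `t ^ 2`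
  have h2 : u ^ 2 / (s ^ 2 + t ^ 2) ≤ (e - u) ^ 2 / s ^ 2 + e ^ 2 / t ^ 2 := by
    rw [div_add_div _ _ (by positivity) (by positivity), div_le_div_iff₀ (by positivity)
      (by positivity)]
    have : 0 ≤ ((e - u) * t ^ 2 + e * s ^ 2) ^ 2 := sq_nonneg _
    nlinarith [this]
  have h3 : 0 ≤ u ^ 2 / (s ^ 2 + t ^ 2) := by positivity
  have e1 : -u ^ 2 / (4 * (s ^ 2 + t ^ 2)) = -(1 / 4) * (u ^ 2 / (s ^ 2 + t ^ 2)) := by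
    field_simp
  have e2 : (e - u) ^ 2 / (2 * s ^ 2) = 1 / 2 * ((e - u) ^ 2 / s ^ 2) := by field_simp
  have e3 : e ^ 2 / (2 * t ^ 2) = 1 / 2 * (e ^ 2 / t ^ 2) := by field_simp
  have e4 : ((4 : ℕ) : ℝ) * (e ^ 2 / (4 * t ^ 2)) = e ^ 2 / t ^ 2 := by push_cast; field_simp
  rw [e1, e2, e3, e4]
  linarith

theorem lintegral_exp_sq_gaussianReal {σ : ℝ} (hσ : 0 < σ) :
    ∫⁻ e, ENNReal.ofReal (Real.exp (e ^ 2 / (4 * σ ^ 2)))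
      ∂(gaussianReal 0 (Real.toNNReal (σ ^ 2))) ≤ 2 := by
  have hv : Real.toNNReal (σ ^ 2) ≠ 0 := by simpa using hσ.ne'
  have hv2 : 2 * Real.toNNReal (σ ^ 2) ≠ 0 := by simpa using hσ.ne'
  have hm : Measurable fun e : ℝ => ENNReal.ofReal (Real.exp (e ^ 2 / (4 * σ ^ 2))) := by fun_prop
  rw [gaussianReal_of_var_ne_zero _ hv,
    lintegral_withDensity_eq_lintegral_mul _ (measurable_gaussianPDF _ _) hm]
  calc _ = ∫⁻ e, ENNReal.ofReal √2 * gaussianPDF 0 (2 * Real.toNNReal (σ ^ 2)) e := by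
        refine lintegral_congr fun e => ?_
        simp only [Pi.mul_apply, gaussianPDF]
        rw [← ENNReal.ofReal_mul (gaussianPDFReal_nonneg _ _ _),
          ← ENNReal.ofReal_mul (Real.sqrt_nonneg _)]
        congr 1
        simp only [gaussianPDFReal, NNReal.coe_mul, Real.coe_toNNReal _ (sq_nonneg σ)]
        have e1 : √(2 * Real.pi * (((2 : ℝ≥0) : ℝ) * σ ^ 2)) = √2 * √(2 * Real.pi * σ ^ 2) := by
          rw [← Real.sqrt_mul (by norm_num)]; congr 1; push_cast; ring
        rw [e1, mul_assoc, ← Real.exp_add]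
        have e2 : -(e - 0) ^ 2 / (2 * σ ^ 2) + e ^ 2 / (4 * σ ^ 2)
            = -(e - 0) ^ 2 / (2 * (((2 : ℝ≥0) : ℝ) * σ ^ 2)) := by
          push_cast; field_simp; ring
        rw [e2]
        have : √(2 : ℝ) ≠ 0 := by positivity
        field_simp
    _ = ENNReal.ofReal √2 := by
        rw [lintegral_const_mul _ (measurable_gaussianPDF _ _), lintegral_gaussianPDF_eq_one _ hv2,
          mul_one]
    _ ≤ ENNReal.ofReal 2 := by
        apply ENNReal.ofReal_le_ofReal
        rw [Real.sqrt_le_left (by norm_num)]; norm_num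
    _ = 2 := by simp

theorem lintegral_regModel (PX : Measure (EuclideanSpace ℝ (Fin d))) [IsProbabilityMeasure PX]
    (θ : EuclideanSpace ℝ (Fin d)) (σ : ℝ) {f : ℝ × EuclideanSpace ℝ (Fin d) → ℝ≥0∞}
    (hf : Measurable f) : ∫⁻ w, f w ∂(regModel PX θ σ)
      = ∫⁻ x, ∫⁻ e, f (inner ℝ x θ + e, x) ∂(gaussianReal 0 (Real.toNNReal (σ ^ 2))) ∂PX := by
  have hm : Measurable fun p : EuclideanSpace ℝ (Fin d) × ℝ => (inner ℝ p.1 θ + p.2, p.1) := by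
    fun_prop
  rw [regModel, lintegral_map hf hm, lintegral_prod]
  have h := hf.comp hm
  simpa only [Function.comp_def] using h.aemeasurable

theorem lintegral_snd_regModel (PX : Measure (EuclideanSpace ℝ (Fin d))) [IsProbabilityMeasure PX]
    (θ : EuclideanSpace ℝ (Fin d)) (σ : ℝ) {f : EuclideanSpace ℝ (Fin d) → ℝ≥0∞}
    (hf : Measurable f) : ∫⁻ w, f w.2 ∂(regModel PX θ σ) = ∫⁻ x, f x ∂PX := by
  rw [lintegral_regModel PX θ σ (by fun_prop)]
  simp

/-- The design factor of the likelihood ratio averages to the affinity, up to a power of the ratio of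
the noise levels. -/
theorem lintegral_design_le (PX : Measure (EuclideanSpace ℝ (Fin d))) [IsProbabilityMeasure PX]
    {p₀ p : EuclideanSpace ℝ (Fin d) × ℝ} (h0 : 0 < p₀.2) (h : 0 < p.2) :
    ∫⁻ x, ENNReal.ofReal (p₀.2 / p.2 *
        Real.exp (-(inner ℝ x (p.1 - p₀.1)) ^ 2 / (4 * (p.2 ^ 2 + p₀.2 ^ 2)))) ∂PX
      ≤ ENNReal.ofReal (rho PX p p₀ * max 1 (p₀.2 ^ 2 / p.2 ^ 2)) := by
  have hi := integrable_exp_neg_sq PX (p.1 - p₀.1)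
    (v := 4 * (p.2 ^ 2 + p₀.2 ^ 2)) (by positivity)
  rw [← ofReal_integral_eq_lintegral_ofReal (hi.const_mul _)
    (Filter.Eventually.of_forall fun x => by positivity), integral_const_mul, rho, mul_right_comm]
  apply ENNReal.ofReal_le_ofReal
  refine mul_le_mul_of_nonneg_right ?_ (integral_nonneg fun _ => (Real.exp_pos _).le)
  have hm : 1 ≤ max 1 (p₀.2 ^ 2 / p.2 ^ 2) := le_max_left _ _
  have hm2 : p₀.2 ^ 2 / p.2 ^ 2 ≤ max 1 (p₀.2 ^ 2 / p.2 ^ 2) := le_max_right _ _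
  have hp := gaussScale_pos h h0
  set M := max 1 (p₀.2 ^ 2 / p.2 ^ 2)
  set s := p.2
  set t := p₀.2
  refine (sq_le_sq₀ (by positivity) (by positivity)).1 ?_
  rw [mul_pow, gaussScale, Real.sq_sqrt (by positivity), div_pow]
  -- with `x = t / s` the claim is `x (1 + x²) ≤ 2 M²`
  set x := t / s with hx
  have hx0 : 0 < x := by positivity
  have hts : t = x * s := by rw [hx]; field_simp
  rw [hts] at hm2 ⊢
  have hm3 : x ^ 2 ≤ M := by
    refine le_trans (le_of_eq ?_) hm2; field_simp
  have hkey : x * (1 + x ^ 2) ≤ 2 * M ^ 2 := by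
    have h1 : x ^ 4 ≤ M ^ 2 := by nlinarith [sq_nonneg x]
    nlinarith [sq_nonneg (x - 1), sq_nonneg (x ^ 2 - 1), sq_nonneg (x ^ 2 - x),
      mul_nonneg hx0.le (sq_nonneg (x - 1))]
  have e1 : (x * s) ^ 2 / s ^ 2 = x ^ 2 := by field_simp
  have e2 : 2 * s * (x * s) / (s ^ 2 + (x * s) ^ 2) = 2 * x / (1 + x ^ 2) := by
    field_simp
  rw [e1, e2, div_mul_eq_mul_div, le_div_iff₀ (by positivity)]
  nlinarith

/-- On a set of parameters with large loss, the likelihood ratio weighted by `e^{n J / 2}` is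
small in the `1 / 5`-th moment: the unbounded noise factor is split off by Hölder's inequality, and
the design factor averages to `e^{-J}` per observation. -/
theorem lintegral_rough_le (PX : Measure (EuclideanSpace ℝ (Fin d))) [IsProbabilityMeasure PX]
    {p₀ : EuclideanSpace ℝ (Fin d) × ℝ} (h0 : 0 < p₀.2) (n : ℕ)
    (ν : Measure (EuclideanSpace ℝ (Fin d) × ℝ)) [SFinite ν] (hν : ∀ᵐ p ∂ν, 0 < p.2) :
    ∫⁻ z, (∫⁻ p, ENNReal.ofReal (Real.exp (n / 2 * loss PX p₀ p)) * lratioProd p₀ z p ∂ν)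
        ^ (1 / 5 : ℝ) ∂(Measure.pi fun _ : Fin n => regModel PX p₀.1 p₀.2)
      ≤ 2 ^ n * (∫⁻ p, ENNReal.ofReal (Real.exp (-(n / 2 * loss PX p₀ p))
        * max 1 (p₀.2 ^ 2 / p.2 ^ 2) ^ n) ∂ν) ^ (1 / 5 : ℝ) := by
  have := isProbabilityMeasure_regModel PX p₀.1 p₀.2
  set P := regModel PX p₀.1 p₀.2 with hP
  set c : ℝ × EuclideanSpace ℝ (Fin d) → ℝ≥0∞ := fun w =>
    ENNReal.ofReal (Real.exp ((w.1 - inner ℝ w.2 p₀.1) ^ 2 / (4 * p₀.2 ^ 2))) with hc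
  set G : EuclideanSpace ℝ (Fin d) × ℝ → ℝ × EuclideanSpace ℝ (Fin d) → ℝ≥0∞ := fun p w =>
    ENNReal.ofReal (p₀.2 / p.2 *
      Real.exp (-(inner ℝ w.2 (p.1 - p₀.1)) ^ 2 / (4 * (p.2 ^ 2 + p₀.2 ^ 2)))) with hG
  have hcm : Measurable c := by fun_prop
  have hGm : ∀ p, Measurable (G p) := fun p => by fun_prop
  have hJm := measurable_loss PX p₀
  set A : (Fin n → ℝ × EuclideanSpace ℝ (Fin d)) → ℝ≥0∞ := fun z => ∏ i, c (z i) with hA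
  set F : (Fin n → ℝ × EuclideanSpace ℝ (Fin d)) → EuclideanSpace ℝ (Fin d) × ℝ → ℝ≥0∞ :=
    fun z p => ENNReal.ofReal (Real.exp (n / 2 * loss PX p₀ p)) * ∏ i, G p (z i) with hF
  have hAm : Measurable A :=
    Finset.measurable_fun_prod _ fun i _ => hcm.comp (measurable_pi_apply i)
  have hFm : Measurable (Function.uncurry F) := by
    refine Measurable.mul (by fun_prop) (Finset.measurable_fun_prod _ fun i _ => ?_)
    have h1 : Measurable fun a : (Fin n → ℝ × EuclideanSpace ℝ (Fin d)) ×
        (EuclideanSpace ℝ (Fin d) × ℝ) => (a.1 i).2 :=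
      measurable_snd.comp ((measurable_pi_apply i).comp measurable_fst)
    simp only [hG]
    fun_prop
  have hHm : Measurable fun z => ∫⁻ p, F z p ∂ν := hFm.lintegral_prod_right
  have hle : ∀ z, ∫⁻ p, ENNReal.ofReal (Real.exp (n / 2 * loss PX p₀ p)) * lratioProd p₀ z p ∂ν
      ≤ A z ^ 4 * ∫⁻ p, F z p ∂ν := by
    intro z
    have hz : Measurable (F z) := hFm.of_uncurry_left
    rw [← lintegral_const_mul _ hz]
    refine lintegral_mono_ae (hν.mono fun p hp => ?_)
    have h1 : lratioProd p₀ z p ≤ A z ^ 4 * ∏ i, G p (z i) := by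
      rw [hA, ← Finset.prod_pow, ← Finset.prod_mul_distrib]
      exact Finset.prod_le_prod' fun i _ => lratio_le h0 hp (z i)
    calc _ ≤ ENNReal.ofReal (Real.exp (n / 2 * loss PX p₀ p)) * (A z ^ 4 * ∏ i, G p (z i)) := by
          gcongr
      _ = _ := by rw [hF]; ring
  have hAint : ∫⁻ z, A z ∂(Measure.pi fun _ : Fin n => P) ≤ 2 ^ n := by
    rw [hA, lintegral_pi_prod _ _ fun _ => hcm]
    rw [Finset.prod_const, Finset.card_univ, Fintype.card_fin]
    gcongr
    rw [hP, lintegral_regModel PX _ _ hcm]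
    calc _ ≤ ∫⁻ _x, 2 ∂PX := by
          refine lintegral_mono fun x => ?_
          simp only [hc, add_sub_cancel_left]
          exact lintegral_exp_sq_gaussianReal h0
      _ = 2 := by simp
  have hHint : ∫⁻ z, ∫⁻ p, F z p ∂ν ∂(Measure.pi fun _ : Fin n => P)
      ≤ ∫⁻ p, ENNReal.ofReal (Real.exp (-(n / 2 * loss PX p₀ p))
        * max 1 (p₀.2 ^ 2 / p.2 ^ 2) ^ n) ∂ν := by
    rw [lintegral_lintegral_swap hFm.aemeasurable]
    refine lintegral_mono_ae (hν.mono fun p hp => ?_)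
    have h1 : Measurable fun z : Fin n → ℝ × EuclideanSpace ℝ (Fin d) => ∏ i, G p (z i) :=
      Finset.measurable_fun_prod _ fun i _ => (hGm p).comp (measurable_pi_apply i)
    simp only [hF]
    rw [lintegral_const_mul _ h1, lintegral_pi_prod _ _ fun _ => hGm p, Finset.prod_const,
      Finset.card_univ, Fintype.card_fin]
    have h2 : ∫⁻ w, G p w ∂P ≤ ENNReal.ofReal (rho PX p p₀ * max 1 (p₀.2 ^ 2 / p.2 ^ 2)) := by
      refine le_trans (le_of_eq ?_) (lintegral_design_le PX h0 hp)
      exact lintegral_snd_regModel PX _ _ (f := fun x => ENNReal.ofReal (p₀.2 / p.2 *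
        Real.exp (-(inner ℝ x (p.1 - p₀.1)) ^ 2 / (4 * (p.2 ^ 2 + p₀.2 ^ 2))))) (by fun_prop)
    have h3 := rho_nonneg PX p p₀
    calc _ ≤ ENNReal.ofReal (Real.exp (n / 2 * loss PX p₀ p))
          * ENNReal.ofReal (rho PX p p₀ * max 1 (p₀.2 ^ 2 / p.2 ^ 2)) ^ n := by gcongr
      _ = ENNReal.ofReal (Real.exp (n / 2 * loss PX p₀ p)
          * (rho PX p p₀ * max 1 (p₀.2 ^ 2 / p.2 ^ 2)) ^ n) := by
          rw [← ENNReal.ofReal_pow (by positivity), ← ENNReal.ofReal_mul (Real.exp_pos _).le]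
      _ = _ := by
          rw [mul_pow, ← exp_neg_loss PX h0 hp, ← Real.exp_nat_mul, ← mul_assoc, ← Real.exp_add]
          congr 3; ring
  calc _ ≤ ∫⁻ z, A z ^ (4 / 5 : ℝ) * (∫⁻ p, F z p ∂ν) ^ (1 / 5 : ℝ)
        ∂(Measure.pi fun _ : Fin n => P) := by
        refine lintegral_mono fun z => ?_
        calc _ ≤ (A z ^ 4 * ∫⁻ p, F z p ∂ν) ^ (1 / 5 : ℝ) := by gcongr; exact hle z
          _ = _ := by
            rw [ENNReal.mul_rpow_of_nonneg _ _ (by norm_num), ← ENNReal.rpow_natCast,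
              ← ENNReal.rpow_mul]
            norm_num
    _ ≤ (∫⁻ z, A z ∂(Measure.pi fun _ : Fin n => P)) ^ (4 / 5 : ℝ)
        * (∫⁻ z, ∫⁻ p, F z p ∂ν ∂(Measure.pi fun _ : Fin n => P)) ^ (1 / 5 : ℝ) :=
        ENNReal.lintegral_mul_norm_pow_le hAm.aemeasurable hHm.aemeasurable (by norm_num)
          (by norm_num) (by norm_num)
    _ ≤ (2 ^ n) ^ (4 / 5 : ℝ) * (∫⁻ p, ENNReal.ofReal (Real.exp (-(n / 2 * loss PX p₀ p))
        * max 1 (p₀.2 ^ 2 / p.2 ^ 2) ^ n) ∂ν) ^ (1 / 5 : ℝ) := by gcongr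
    _ ≤ (2 ^ n) ^ (1 : ℝ) * (∫⁻ p, ENNReal.ofReal (Real.exp (-(n / 2 * loss PX p₀ p))
        * max 1 (p₀.2 ^ 2 / p.2 ^ 2) ^ n) ∂ν) ^ (1 / 5 : ℝ) := by
        gcongr
        · exact one_le_pow_of_one_le' (by norm_num) n
        · norm_num
    _ = _ := by rw [ENNReal.rpow_one]

end Rough

/-! ### A grid for the regression vector -/

section Grid

variable {d : ℕ} {τ T : ℝ}

/-- The integer coordinates of the point of the grid `w ℤ^d` nearest to `θ`. -/
def cellIdx (w : ℝ) (θ : EuclideanSpace ℝ (Fin d)) : Fin d → ℤ := fun j => round (θ j / w)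

/-- The point of the grid `w ℤ^d` with integer coordinates `k`. -/
def gridPt (w : ℝ) (k : Fin d → ℤ) : EuclideanSpace ℝ (Fin d) := WithLp.toLp 2 fun j => w * k j

theorem measurable_round_div (w : ℝ) : Measurable fun x : ℝ => round (x / w) := by
  simp only [round_eq]
  fun_prop

theorem measurable_cellIdx (w : ℝ) : Measurable (cellIdx (d := d) w) := by
  refine measurable_pi_iff.2 fun j => ?_
  have h : Measurable fun θ : EuclideanSpace ℝ (Fin d) => θ j := by fun_prop
  exact (measurable_round_div w).comp h

theorem norm_sub_gridPt_sq (w : ℝ) (θ : EuclideanSpace ℝ (Fin d)) :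
    ‖θ - gridPt w (cellIdx w θ)‖ ^ 2 = ∑ j, (θ j - w * round (θ j / w)) ^ 2 := by
  rw [EuclideanSpace.norm_sq_eq]
  refine Finset.sum_congr rfl fun j _ => ?_
  rw [Real.norm_eq_abs, sq_abs]
  rfl

theorem abs_sub_round_le (hw : 0 < τ) (x : ℝ) : |x - τ * round (x / τ)| ≤ τ / 2 := by
  have h := abs_sub_round (x / τ)
  rw [show x - τ * round (x / τ) = τ * (x / τ - round (x / τ)) by field_simp, abs_mul,
    abs_of_pos hw]
  nlinarith

theorem abs_sub_round_le_abs (hw : 0 < τ) (x : ℝ) : |x - τ * round (x / τ)| ≤ |x| := by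
  have h := round_le (x / τ) 0
  rw [show x - τ * round (x / τ) = τ * (x / τ - round (x / τ)) by field_simp, abs_mul,
    abs_of_pos hw]
  rw [Int.cast_zero, sub_zero, abs_div, abs_of_pos hw, le_div_iff₀ hw] at h
  linarith

/-- The cubic decay of the Student tails over the cells of a grid of mesh `τ T`. -/
theorem stu_round_le (hτ : 0 < τ) (hT : 0 < T) {k : ℤ} (hk : k ≠ 0) :
    stu τ {x | round (x / (τ * T)) = k}
      ≤ ENNReal.ofReal (11 * (T⁻¹ ^ 3 * (1 / (k : ℝ) ^ 4))) := by
  have hw : 0 < τ * T := by positivity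
  have hk1 : (1 : ℝ) ≤ |(k : ℝ)| := by
    have := Int.one_le_abs hk
    exact_mod_cast this
  have hk0 : (k : ℝ) ≠ 0 := by exact_mod_cast hk
  have hsub : {x | round (x / (τ * T)) = k}
      ⊆ Set.Icc (τ * T * k - τ * T / 2) (τ * T * k + τ * T / 2) := by
    intro x (hx : round (x / (τ * T)) = k)
    have h := abs_le.1 (abs_sub_round_le hw x)
    rw [hx] at h
    constructor <;> linarith [h.1, h.2]
  refine (measure_mono hsub).trans ?_
  rw [stu, withDensity_apply _ measurableSet_Icc]
  calc _ ≤ ∫⁻ _x in Set.Icc (τ * T * k - τ * T / 2) (τ * T * k + τ * T / 2),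
        ENNReal.ofReal (2 * τ ^ 3 / Real.pi * ((τ * T * |(k : ℝ)| / 2) ^ 4)⁻¹) := by
        refine setLIntegral_mono' measurableSet_Icc fun x hx => ENNReal.ofReal_le_ofReal ?_
        unfold stuPDF
        have h1 : |τ * T * k - x| ≤ τ * T / 2 := by
          rw [abs_le]; constructor <;> linarith [hx.1, hx.2]
        have h2 : τ * T * |(k : ℝ)| - |x| ≤ τ * T / 2 := by
          refine le_trans ?_ h1
          have := abs_sub_abs_le_abs_sub (τ * T * k) x
          rwa [abs_mul, abs_of_pos hw] at this
        have h3 : τ * T * |(k : ℝ)| / 2 ≤ |x| := by nlinarith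
        have h4 : (τ * T * |(k : ℝ)| / 2) ^ 2 ≤ τ ^ 2 + x ^ 2 := by
          have : (τ * T * |(k : ℝ)| / 2) ^ 2 ≤ |x| ^ 2 := by gcongr
          rw [sq_abs] at this
          nlinarith [sq_nonneg τ]
        have h5 : (τ * T * |(k : ℝ)| / 2) ^ 4 ≤ (τ ^ 2 + x ^ 2) ^ 2 := by
          calc _ = ((τ * T * |(k : ℝ)| / 2) ^ 2) ^ 2 := by ring
            _ ≤ _ := by gcongr
        gcongr
    _ = ENNReal.ofReal (32 / Real.pi * (T⁻¹ ^ 3 * (1 / (k : ℝ) ^ 4))) := by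
        rw [setLIntegral_const, Real.volume_Icc, ← ENNReal.ofReal_mul (by positivity)]
        congr 1
        have : |(k : ℝ)| ^ 4 = (k : ℝ) ^ 4 := by
          rw [show (4 : ℕ) = 2 * 2 by norm_num, pow_mul, pow_mul, sq_abs]
        rw [div_pow, mul_pow, this]
        field_simp
        ring
    _ ≤ _ := by
        apply ENNReal.ofReal_le_ofReal
        have : 32 / Real.pi ≤ 11 := by
          rw [div_le_iff₀ Real.pi_pos]; linarith [Real.pi_gt_three]
        gcongr

/-- A grid of mesh `τ T` has about `e^{d T^{-27/10}}` cells, when these are counted with the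
`9 / 10`-th power of their Student mass. -/
theorem exists_tsum_stuPi_cell_le : ∃ C : ℝ, 0 < C ∧ ∀ (d : ℕ) (τ T : ℝ), 0 < τ → 0 < T →
    ∑' k : Fin d → ℤ, stuPi d τ {θ | cellIdx (τ * T) θ = k} ^ (9 / 10 : ℝ)
      ≤ ENNReal.ofReal (Real.exp (C * (d * (T⁻¹ ^ 3) ^ (9 / 10 : ℝ)))) := by
  have hsum : Summable fun k : ℤ => 1 / (k : ℝ) ^ 2 :=
    Real.summable_one_div_int_pow.2 (by norm_num)
  set S := ∑' k : ℤ, 1 / (k : ℝ) ^ 2 with hS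
  have hS0 : 0 ≤ S := tsum_nonneg fun k => by positivity
  refine ⟨11 * S + 1, by positivity, fun d τ T hτ hT => ?_⟩
  have := isProbabilityMeasure_stu hτ
  set t := (T⁻¹ ^ 3) ^ (9 / 10 : ℝ) with ht
  have ht0 : 0 ≤ t := by positivity
  have hms : ∀ k : ℤ, MeasurableSet {x : ℝ | round (x / (τ * T)) = k} := fun k =>
    measurable_round_div (τ * T) (measurableSet_singleton k)
  have hcell : ∀ k : Fin d → ℤ, stuPi d τ {θ | cellIdx (τ * T) θ = k}
      = ∏ j, stu τ {x | round (x / (τ * T)) = k j} := by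
    intro k
    have h1 : MeasurableSet {θ : EuclideanSpace ℝ (Fin d) | cellIdx (τ * T) θ = k} :=
      measurable_cellIdx (τ * T) (measurableSet_singleton k)
    rw [stuPi, Measure.map_apply (by fun_prop) h1, ← Measure.pi_pi]
    congr 1
    ext x
    simp [cellIdx, funext_iff]
  simp_rw [hcell, ← ENNReal.prod_rpow_of_nonneg (by norm_num : (0 : ℝ) ≤ 9 / 10)]
  rw [tsum_pi_prod (fun k : ℤ => stu τ {x | round (x / (τ * T)) = k} ^ (9 / 10 : ℝ)) d]
  have hone : ∀ k : ℤ, stu τ {x | round (x / (τ * T)) = k} ^ (9 / 10 : ℝ)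
      ≤ (if k = 0 then 1 else 0) + ENNReal.ofReal (11 * t) * ENNReal.ofReal (1 / (k : ℝ) ^ 2) := by
    intro k
    rcases eq_or_ne k 0 with rfl | hk
    · simp only [if_true]
      exact le_add_right (ENNReal.rpow_le_one prob_le_one (by norm_num))
    · rw [if_neg hk, zero_add, ← ENNReal.ofReal_mul (by positivity)]
      have hk1 : (1 : ℝ) ≤ (k : ℝ) ^ 2 := by
        have := Int.one_le_abs hk
        have h2 : (1 : ℝ) ≤ |(k : ℝ)| := by exact_mod_cast this
        rw [← sq_abs]; nlinarith
      refine (ENNReal.rpow_le_rpow (stu_round_le hτ hT hk) (by norm_num)).trans ?_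
      rw [ENNReal.ofReal_rpow_of_nonneg (by positivity) (by norm_num)]
      apply ENNReal.ofReal_le_ofReal
      rw [Real.mul_rpow (by norm_num) (by positivity), Real.mul_rpow (by positivity)
        (by positivity), ← ht, ← mul_assoc]
      have h1 : (11 : ℝ) ^ (9 / 10 : ℝ) ≤ 11 :=
        (Real.rpow_le_rpow_of_exponent_le (by norm_num) (by norm_num)).trans (Real.rpow_one _).le
      have h2 : (1 / (k : ℝ) ^ 4) ^ (9 / 10 : ℝ) ≤ 1 / (k : ℝ) ^ 2 := by
        have h3 : (1 : ℝ) / (k : ℝ) ^ 4 ≤ 1 := by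
          rw [div_le_one (by positivity)]; nlinarith
        calc (1 / (k : ℝ) ^ 4) ^ (9 / 10 : ℝ) ≤ (1 / (k : ℝ) ^ 4) ^ (1 / 2 : ℝ) :=
              Real.rpow_le_rpow_of_exponent_ge (by positivity) h3 (by norm_num)
          _ = 1 / (k : ℝ) ^ 2 := by
              rw [← Real.sqrt_eq_rpow,
                show 1 / (k : ℝ) ^ 4 = (1 / (k : ℝ) ^ 2) ^ 2 by field_simp]
              exact Real.sqrt_sq (by positivity)
      gcongr
  calc _ ≤ (∑' k : ℤ, ((if k = 0 then 1 else 0)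
        + ENNReal.ofReal (11 * t) * ENNReal.ofReal (1 / (k : ℝ) ^ 2))) ^ d := by
        gcongr with k
        exact hone k
    _ = (1 + ENNReal.ofReal (11 * t * S)) ^ d := by
        rw [ENNReal.tsum_add, tsum_ite_eq, ENNReal.tsum_mul_left,
          ← ENNReal.ofReal_tsum_of_nonneg (fun k => by positivity) hsum,
          ← ENNReal.ofReal_mul (by positivity)]
    _ = ENNReal.ofReal ((1 + 11 * t * S) ^ d) := by
        rw [← ENNReal.ofReal_one, ← ENNReal.ofReal_add (by norm_num) (by positivity),
          ENNReal.ofReal_pow (by positivity)]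
    _ ≤ _ := by
        apply ENNReal.ofReal_le_ofReal
        calc (1 + 11 * t * S) ^ d ≤ Real.exp (11 * t * S) ^ d := by
              gcongr; linarith [Real.add_one_le_exp (11 * t * S)]
          _ ≤ _ := by
              rw [← Real.exp_nat_mul]
              apply Real.exp_le_exp.2
              have : 0 ≤ (d : ℝ) * t := by positivity
              nlinarith

/-- Rounding to the grid of mesh `τ T` rarely moves a Student vector by more than a multiple of
its own typical size. -/
theorem stuPi_rounding_le (hτ : 0 < τ) (hT : 0 < T) (hd : 0 < d) (m : ℝ) :
    stuPi d τ {θ | m * d * τ ^ 2 < ‖θ - gridPt (τ * T) (cellIdx (τ * T) θ)‖ ^ 2}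
      ≤ ENNReal.ofReal (Real.exp (-(d / T ^ 2 * (m - 2)))) := by
  have := isProbabilityMeasure_stu hτ
  have := isProbabilityMeasure_stuPi (d := d) hτ
  have hw : 0 < τ * T := by positivity
  set f : ℝ → ℝ≥0∞ := fun x =>
    ENNReal.ofReal (Real.exp ((x - τ * T * round (x / (τ * T))) ^ 2 / (τ * T) ^ 2)) with hf
  have hfm : Measurable f := by
    have h : Measurable fun x : ℝ => ((round (x / (τ * T)) : ℤ) : ℝ) :=
      measurable_from_top.comp (measurable_round_div (τ * T))
    simp only [hf]
    fun_prop
  have hf1 : ∫⁻ x, f x ∂(stu τ) ≤ ENNReal.ofReal (Real.exp (2 / T ^ 2)) := by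
    have hpt : ∀ x, f x ≤ 1 + ENNReal.ofReal (2 / (τ * T) ^ 2) * ENNReal.ofReal (x ^ 2) := by
      intro x
      set δ := x - τ * T * round (x / (τ * T)) with hδ
      have h1 : δ ^ 2 ≤ x ^ 2 := sq_le_sq.2 (abs_sub_round_le_abs hw x)
      have h2 : δ ^ 2 / (τ * T) ^ 2 ≤ 1 / 4 := by
        have h3 := abs_sub_round_le hw x
        rw [div_le_iff₀ (by positivity)]
        have : |δ| ^ 2 ≤ (τ * T / 2) ^ 2 := by gcongr
        rw [sq_abs] at this
        linarith
      have h4 : Real.exp (δ ^ 2 / (τ * T) ^ 2) ≤ 1 + 2 * (δ ^ 2 / (τ * T) ^ 2) := by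
        have h5 : 0 ≤ δ ^ 2 / (τ * T) ^ 2 := by positivity
        set y := δ ^ 2 / (τ * T) ^ 2
        have h6 : 1 - y ≤ Real.exp (-y) := by linarith [Real.add_one_le_exp (-y)]
        have h7 : Real.exp y * Real.exp (-y) = 1 := by rw [← Real.exp_add]; simp
        nlinarith [Real.exp_pos y]
      rw [← ENNReal.ofReal_one, ← ENNReal.ofReal_mul (by positivity),
        ← ENNReal.ofReal_add (by norm_num) (by positivity)]
      apply ENNReal.ofReal_le_ofReal
      refine h4.trans ?_
      have : 2 * (δ ^ 2 / (τ * T) ^ 2) ≤ 2 / (τ * T) ^ 2 * x ^ 2 := by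
        rw [← mul_div_assoc, div_mul_eq_mul_div]; gcongr
      linarith
    calc _ ≤ ∫⁻ x, (1 + ENNReal.ofReal (2 / (τ * T) ^ 2) * ENNReal.ofReal (x ^ 2)) ∂(stu τ) :=
          lintegral_mono hpt
      _ = ENNReal.ofReal (1 + 2 / (τ * T) ^ 2 * τ ^ 2) := by
          rw [lintegral_add_left measurable_const, lintegral_const_mul _ (by fun_prop),
            lintegral_sq_stu hτ, lintegral_const, measure_univ, mul_one,
            ENNReal.ofReal_add (by norm_num) (by positivity), ENNReal.ofReal_one,
            ← ENNReal.ofReal_mul (by positivity)]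
      _ ≤ _ := by
          apply ENNReal.ofReal_le_ofReal
          have : 2 / (τ * T) ^ 2 * τ ^ 2 = 2 / T ^ 2 := by field_simp
          rw [this]
          linarith [Real.add_one_le_exp (2 / T ^ 2)]
  have hI : ∫⁻ θ, ∏ j, f (θ j) ∂(stuPi d τ) ≤ ENNReal.ofReal (Real.exp (d * (2 / T ^ 2))) := by
    rw [lintegral_prod_stuPi hτ fun _ => hfm, Finset.prod_const, Finset.card_univ,
      Fintype.card_fin, Real.exp_nat_mul, ENNReal.ofReal_pow (Real.exp_pos _).le]
    gcongr
  have hPm : Measurable fun θ : EuclideanSpace ℝ (Fin d) => ∏ j, f (θ j) :=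
    Finset.measurable_fun_prod _ fun j _ => hfm.comp (by fun_prop)
  have hmark := meas_ge_le_lintegral_div hPm.aemeasurable (μ := stuPi d τ)
    (ε := ENNReal.ofReal (Real.exp (m * d / T ^ 2)))
    (ENNReal.ofReal_pos.2 (Real.exp_pos _)).ne' ENNReal.ofReal_ne_top
  calc _ ≤ stuPi d τ {θ | ENNReal.ofReal (Real.exp (m * d / T ^ 2)) ≤ ∏ j, f (θ j)} := by
        refine measure_mono fun θ (hθ : m * d * τ ^ 2 < _) => ?_
        rw [norm_sub_gridPt_sq] at hθ
        change ENNReal.ofReal (Real.exp (m * d / T ^ 2)) ≤ ∏ j, f (θ j)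
        rw [← ENNReal.ofReal_prod_of_nonneg fun j _ => (Real.exp_pos _).le, ← Real.exp_sum,
          ← Finset.sum_div]
        apply ENNReal.ofReal_le_ofReal
        apply Real.exp_le_exp.2
        rw [div_le_div_iff₀ (by positivity) (by positivity)]
        nlinarith [sq_nonneg T]
    _ ≤ ENNReal.ofReal (Real.exp (d * (2 / T ^ 2)))
        / ENNReal.ofReal (Real.exp (m * d / T ^ 2)) := hmark.trans (by gcongr)
    _ = _ := by
        rw [← ENNReal.ofReal_div_of_pos (Real.exp_pos _), ← Real.exp_sub]
        congr 2
        field_simp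
        ring

end Grid

/-! ### Mixtures of regression densities -/

section Mixture

variable {d : ℕ}

theorem lintegral_inner_sq_le (PX : Measure (EuclideanSpace ℝ (Fin d))) {Cx : ℝ}
    (hX : ∫⁻ x, ‖x‖ₑ ^ 2 ∂PX ≤ ENNReal.ofReal (Cx ^ 2)) (δ : EuclideanSpace ℝ (Fin d)) :
    ∫⁻ x, ENNReal.ofReal ((inner ℝ x δ) ^ 2) ∂PX ≤ ENNReal.ofReal (Cx ^ 2 * ‖δ‖ ^ 2) := by
  calc _ ≤ ∫⁻ x, ENNReal.ofReal (‖δ‖ ^ 2) * ‖x‖ₑ ^ 2 ∂PX := by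
        refine lintegral_mono fun x => ?_
        rw [← ofReal_norm, ← ENNReal.ofReal_pow (norm_nonneg _),
          ← ENNReal.ofReal_mul (by positivity)]
        apply ENNReal.ofReal_le_ofReal
        have h := abs_real_inner_le_norm x δ
        calc (inner ℝ x δ) ^ 2 = |inner ℝ x δ| ^ 2 := (sq_abs _).symm
          _ ≤ (‖x‖ * ‖δ‖) ^ 2 := by gcongr
          _ = _ := by ring
    _ = ENNReal.ofReal (‖δ‖ ^ 2) * ∫⁻ x, ‖x‖ₑ ^ 2 ∂PX := lintegral_const_mul _ (by fun_prop)
    _ ≤ ENNReal.ofReal (‖δ‖ ^ 2) * ENNReal.ofReal (Cx ^ 2) := by gcongr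
    _ = _ := by rw [← ENNReal.ofReal_mul (by positivity), mul_comm]

theorem rho_comm (PX : Measure (EuclideanSpace ℝ (Fin d)))
    (p q : EuclideanSpace ℝ (Fin d) × ℝ) : rho PX p q = rho PX q p := by
  unfold rho gaussScale
  have h : ∀ x : EuclideanSpace ℝ (Fin d),
      (inner ℝ x (p.1 - q.1) : ℝ) ^ 2 = (inner ℝ x (q.1 - p.1)) ^ 2 := fun x => by
    rw [← neg_sub q.1 p.1, inner_neg_right, neg_sq]
  simp_rw [h]
  rw [add_comm (p.2 ^ 2), mul_right_comm]

/-- Continuity of the affinity in the parameters. -/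
theorem one_le_rho_add (PX : Measure (EuclideanSpace ℝ (Fin d))) [IsProbabilityMeasure PX] {Cx : ℝ}
    (hX : ∫⁻ x, ‖x‖ₑ ^ 2 ∂PX ≤ ENNReal.ofReal (Cx ^ 2)) {p q : EuclideanSpace ℝ (Fin d) × ℝ}
    (hp : 0 < p.2) (hq : 0 < q.2) {σ : ℝ} (hσ : 0 < σ) (hσp : σ ≤ p.2) :
    1 ≤ rho PX p q + ((p.2 - q.2) ^ 2 / σ ^ 2 + Cx ^ 2 * ‖p.1 - q.1‖ ^ 2 / (4 * σ ^ 2)) := by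
  have hv : σ ^ 2 ≤ p.2 ^ 2 + q.2 ^ 2 := by nlinarith [sq_nonneg q.2]
  have hi := integrable_exp_neg_sq PX (p.1 - q.1) (v := 4 * (p.2 ^ 2 + q.2 ^ 2)) (by positivity)
  set I := ∫ x, Real.exp (-(inner ℝ x (p.1 - q.1)) ^ 2 / (4 * (p.2 ^ 2 + q.2 ^ 2))) ∂PX with hI
  have hI1 : I ≤ 1 := integral_exp_neg_sq_le_one PX _ (by positivity)
  have hIlow : 1 ≤ I + Cx ^ 2 * ‖p.1 - q.1‖ ^ 2 / (4 * σ ^ 2) := by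
    have h1 : (1 : ℝ≥0∞) ≤ ENNReal.ofReal I
        + ENNReal.ofReal ((4 * σ ^ 2)⁻¹) * ENNReal.ofReal (Cx ^ 2 * ‖p.1 - q.1‖ ^ 2) := by
      rw [hI, ofReal_integral_eq_lintegral_ofReal hi
        (Filter.Eventually.of_forall fun x => (Real.exp_pos _).le)]
      calc (1 : ℝ≥0∞) = ∫⁻ _x, 1 ∂PX := by simp
        _ ≤ ∫⁻ x, (ENNReal.ofReal (Real.exp (-(inner ℝ x (p.1 - q.1)) ^ 2
              / (4 * (p.2 ^ 2 + q.2 ^ 2))))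
            + ENNReal.ofReal ((4 * σ ^ 2)⁻¹) * ENNReal.ofReal ((inner ℝ x (p.1 - q.1)) ^ 2)) ∂PX := by
            refine lintegral_mono fun x => ?_
            rw [← ENNReal.ofReal_mul (by positivity), ← ENNReal.ofReal_add (Real.exp_pos _).le
              (by positivity), ← ENNReal.ofReal_one]
            apply ENNReal.ofReal_le_ofReal
            have h2 := Real.add_one_le_exp
              (-(inner ℝ x (p.1 - q.1)) ^ 2 / (4 * (p.2 ^ 2 + q.2 ^ 2)))
            have h3 : (inner ℝ x (p.1 - q.1)) ^ 2 / (4 * (p.2 ^ 2 + q.2 ^ 2))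
                ≤ (inner ℝ x (p.1 - q.1)) ^ 2 / (4 * σ ^ 2) := by gcongr
            rw [neg_div] at h2 ⊢
            rw [inv_mul_eq_div]
            linarith
        _ = _ := by
            rw [lintegral_add_left (by fun_prop), lintegral_const_mul _ (by fun_prop)]
        _ ≤ _ := by
            gcongr
            exact lintegral_inner_sq_le PX hX _
    have hI0 : 0 ≤ I := integral_nonneg fun _ => (Real.exp_pos _).le
    rw [← ENNReal.ofReal_mul (by positivity), ← ENNReal.ofReal_add hI0 (by positivity),
      ENNReal.one_le_ofReal, inv_mul_eq_div] at h1
    exact h1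
  have hg1 := gaussScale_le_one p.2 q.2
  have hg0 := gaussScale_pos hp hq
  have hg : 1 ≤ gaussScale p.2 q.2 + (p.2 - q.2) ^ 2 / σ ^ 2 := by
    have h1 : gaussScale p.2 q.2 ^ 2 = 1 - (p.2 - q.2) ^ 2 / (p.2 ^ 2 + q.2 ^ 2) := by
      rw [gaussScale, Real.sq_sqrt (by positivity)]
      field_simp
      ring
    have h2 : (p.2 - q.2) ^ 2 / (p.2 ^ 2 + q.2 ^ 2) ≤ (p.2 - q.2) ^ 2 / σ ^ 2 := by gcongr
    nlinarith
  have : rho PX p q = gaussScale p.2 q.2 * I := rfl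
  rw [this]
  nlinarith [mul_nonneg (sub_nonneg.2 hg1) (sub_nonneg.2 hI1)]

/-- The `9 / 10`-moment of a mixture of likelihood ratios is a `9 / 10`-affinity. -/
theorem lintegral_mixture_lratio (PX : Measure (EuclideanSpace ℝ (Fin d)))
    [IsProbabilityMeasure PX] {p₀ : EuclideanSpace ℝ (Fin d) × ℝ} (h0 : 0 < p₀.2)
    {ν : Measure (EuclideanSpace ℝ (Fin d) × ℝ)} [SFinite ν]
    {g : EuclideanSpace ℝ (Fin d) × ℝ → ℝ≥0∞} (hg : Measurable g) :
    ∫⁻ w, (∫⁻ t, lratio p₀ t w * g t ∂ν) ^ (9 / 10 : ℝ) ∂(regModel PX p₀.1 p₀.2)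
      = ∫⁻ w, (∫⁻ t, dens t w * g t ∂ν) ^ (9 / 10 : ℝ) * dens p₀ w ^ (1 / 10 : ℝ)
        ∂((volume : Measure ℝ).prod PX) := by
  have hq : Measurable fun a : (ℝ × EuclideanSpace ℝ (Fin d)) × (EuclideanSpace ℝ (Fin d) × ℝ) =>
      dens a.2 a.1 * g a.2 := by
    have h := measurable_dens (d := d).comp measurable_swap
    simp only [Function.comp_def, Function.uncurry] at h
    exact h.mul (hg.comp measurable_snd)
  have hqm : Measurable fun w => ∫⁻ t, dens t w * g t ∂ν := hq.lintegral_prod_right'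
  have h1 : ∀ w, ∫⁻ t, lratio p₀ t w * g t ∂ν = (dens p₀ w)⁻¹ * ∫⁻ t, dens t w * g t ∂ν := by
    intro w
    have h2 : Measurable fun t => dens t w * g t := hq.of_uncurry_left (f := fun w t => dens t w * g t)
    rw [← lintegral_const_mul _ h2]
    simp only [lratio, mul_assoc]
  have hm : Measurable fun w => ((dens p₀ w)⁻¹ * ∫⁻ t, dens t w * g t ∂ν) ^ (9 / 10 : ℝ) :=
    ((measurable_dens_right p₀).inv.mul hqm).pow_const _
  simp_rw [h1]
  rw [regModel_eq PX h0, lintegral_withDensity_eq_lintegral_mul _ (measurable_dens_right p₀) hm]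
  refine lintegral_congr fun w => ?_
  rw [Pi.mul_apply, mul_comm, inv_mul_rpow_mul (dens_ne_zero h0 w) (dens_ne_top p₀ w) (by norm_num)]
  norm_num

/-- A mixture of densities close to that of the parameter `c` keeps away from `P_{p₀}` whenever
`c` does. -/
theorem lintegral_mixture_le_of_near (PX : Measure (EuclideanSpace ℝ (Fin d)))
    [IsProbabilityMeasure PX] {p₀ c : EuclideanSpace ℝ (Fin d) × ℝ} (h0 : 0 < p₀.2) (hc : 0 < c.2)
    {ν : Measure (EuclideanSpace ℝ (Fin d) × ℝ)} [SFinite ν] {u : ℝ} (hu0 : 0 ≤ u)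
    (hu : ∀ᵐ t ∂ν, 0 < t.2 ∧ 1 ≤ rho PX c t + u)
    {g : EuclideanSpace ℝ (Fin d) × ℝ → ℝ≥0∞} (hg : Measurable g) (hg1 : ∫⁻ t, g t ∂ν = 1) :
    ∫⁻ w, (∫⁻ t, lratio p₀ t w * g t ∂ν) ^ (9 / 10 : ℝ) ∂(regModel PX p₀.1 p₀.2)
      ≤ ENNReal.ofReal (Real.exp ((u - (1 - rho PX c p₀) / 2) / 5)) := by
  have hq : Measurable fun a : (ℝ × EuclideanSpace ℝ (Fin d)) × (EuclideanSpace ℝ (Fin d) × ℝ) =>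
      dens a.2 a.1 * g a.2 := by
    have h := measurable_dens (d := d).comp measurable_swap
    simp only [Function.comp_def, Function.uncurry] at h
    exact h.mul (hg.comp measurable_snd)
  have hqm : Measurable fun w => ∫⁻ t, dens t w * g t ∂ν := hq.lintegral_prod_right'
  have hp1 : ∀ᵐ t ∂ν, ∫⁻ w, dens t w ∂((volume : Measure ℝ).prod PX) ≤ 1 :=
    hu.mono fun t ht => (lintegral_dens PX ht.1).le
  have haff := affinity_mixture_le (μ := (volume : Measure ℝ).prod PX) measurable_dens
    (measurable_dens_right c) (measurable_dens_right p₀) (lintegral_dens PX hc).le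
    (lintegral_dens PX h0).le hg hg1 (u := ENNReal.ofReal u) hp1 (hu.mono fun t ht => by
      rw [affinity_dens PX hc ht.1, ← ENNReal.ofReal_add (rho_nonneg _ _ _) hu0,
        ENNReal.one_le_ofReal]
      exact ht.2)
  rw [lintegral_mixture_lratio PX h0 hg]
  refine (rpow_mul_rpow_le_affinity _ hqm (measurable_dens_right p₀)
    (lintegral_mixture_le_one measurable_dens hg hg1 hp1)).trans ?_
  rw [affinity_dens PX hc h0] at haff
  set A := affinity ((volume : Measure ℝ).prod PX) (fun w => ∫⁻ t, dens t w * g t ∂ν) (dens p₀)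
  have hr := rho_nonneg PX c p₀
  have hA : A ≤ ENNReal.ofReal (Real.exp (u - (1 - rho PX c p₀) / 2)) := by
    have h2 : (4 : ℝ≥0∞) * A ≤ 4 * ENNReal.ofReal (1 + (u - (1 - rho PX c p₀) / 2)) := by
      refine haff.trans (le_of_eq ?_)
      rw [show (2 : ℝ≥0∞) = ENNReal.ofReal 2 by simp, show (4 : ℝ≥0∞) = ENNReal.ofReal 4 by simp,
        ← ENNReal.ofReal_mul (by norm_num), ← ENNReal.ofReal_mul (by norm_num),
        ← ENNReal.ofReal_mul (by norm_num), ← ENNReal.ofReal_add (by norm_num) (by positivity),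
        ← ENNReal.ofReal_add (by positivity) (by positivity)]
      congr 1; ring
    refine ((ENNReal.mul_le_mul_iff_right (by norm_num) (by norm_num)).1 h2).trans ?_
    apply ENNReal.ofReal_le_ofReal
    linarith [Real.add_one_le_exp (u - (1 - rho PX c p₀) / 2)]
  calc A ^ (1 / 5 : ℝ) ≤ ENNReal.ofReal (Real.exp (u - (1 - rho PX c p₀) / 2)) ^ (1 / 5 : ℝ) := by
        gcongr
    _ = _ := by
        rw [ENNReal.ofReal_rpow_of_pos (Real.exp_pos _), ← Real.exp_mul]
        congr 2; ring

theorem lintegral_sq_gaussianReal {σ : ℝ} :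
    ∫⁻ e, ENNReal.ofReal (e ^ 2) ∂(gaussianReal 0 (Real.toNNReal (σ ^ 2)))
      = ENNReal.ofReal (σ ^ 2) := by
  have h := ofReal_variance (memLp_id_gaussianReal (μ := 0) (v := Real.toNNReal (σ ^ 2)) 2)
  rw [variance_id_gaussianReal, evariance_eq_lintegral_ofReal] at h
  simp only [id, integral_id_gaussianReal, sub_zero, Real.coe_toNNReal _ (sq_nonneg σ)] at h
  exact h.symm

/-- A mixture of densities with noise level far below that of `p₀` and nearly constant regression
function is nearly singular to `P_{p₀}`: it is concentrated on a strip of width `w` around the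
regression function, which has small mass under `P_{p₀}`. -/
theorem lintegral_mixture_le_of_concentrated (PX : Measure (EuclideanSpace ℝ (Fin d)))
    [IsProbabilityMeasure PX] {p₀ : EuclideanSpace ℝ (Fin d) × ℝ} (h0 : 0 < p₀.2)
    (θ : EuclideanSpace ℝ (Fin d)) {w Cx : ℝ} (hw : 0 < w)
    (hX : ∫⁻ x, ‖x‖ₑ ^ 2 ∂PX ≤ ENNReal.ofReal (Cx ^ 2))
    {ν : Measure (EuclideanSpace ℝ (Fin d) × ℝ)} [SFinite ν]
    (hν : ∀ᵐ t ∂ν, 0 < t.2 ∧ 2 * (Cx ^ 2 * ‖t.1 - θ‖ ^ 2) + 2 * t.2 ^ 2 ≤ w ^ 2)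
    {g : EuclideanSpace ℝ (Fin d) × ℝ → ℝ≥0∞} (hg : Measurable g) (hg1 : ∫⁻ t, g t ∂ν = 1) :
    ∫⁻ z, (∫⁻ t, lratio p₀ t z * g t ∂ν) ^ (9 / 10 : ℝ) ∂(regModel PX p₀.1 p₀.2)
      ≤ 2 * ENNReal.ofReal (2 * w / p₀.2) ^ (1 / 10 : ℝ) := by
  have hq : Measurable fun a : (ℝ × EuclideanSpace ℝ (Fin d)) × (EuclideanSpace ℝ (Fin d) × ℝ) =>
      dens a.2 a.1 * g a.2 := by
    have h := measurable_dens (d := d).comp measurable_swap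
    simp only [Function.comp_def, Function.uncurry] at h
    exact h.mul (hg.comp measurable_snd)
  have hqm : Measurable fun w => ∫⁻ t, dens t w * g t ∂ν := hq.lintegral_prod_right'
  set q := fun z => ∫⁻ t, dens t z * g t ∂ν with hqdef
  set ψ : ℝ × EuclideanSpace ℝ (Fin d) → ℝ≥0∞ := fun z =>
    ENNReal.ofReal (1 + ((z.1 - inner ℝ z.2 θ) / w) ^ 2) with hψ
  have hψm : Measurable ψ := by fun_prop
  have hψ1 : ∀ z, 1 ≤ ψ z := fun z => by
    rw [hψ, ENNReal.one_le_ofReal]; nlinarith [sq_nonneg ((z.1 - inner ℝ z.2 θ) / w)]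
  have hψ0 : ∀ z, ψ z ≠ 0 := fun z => (lt_of_lt_of_le one_pos (hψ1 z)).ne'
  have hψT : ∀ z, ψ z ≠ ∞ := fun z => ENNReal.ofReal_ne_top
  have hp₀ := measurable_dens_right p₀
  -- the mixture concentrates where `ψ` is of order one
  have hqψ : ∫⁻ z, q z * ψ z ∂((volume : Measure ℝ).prod PX) ≤ 2 := by
    have hm : Measurable fun a : (ℝ × EuclideanSpace ℝ (Fin d)) × (EuclideanSpace ℝ (Fin d) × ℝ) =>
        dens a.2 a.1 * g a.2 * ψ a.1 := hq.mul (hψm.comp measurable_fst)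
    calc _ = ∫⁻ z, ∫⁻ t, dens t z * g t * ψ z ∂ν ∂((volume : Measure ℝ).prod PX) := by
          refine lintegral_congr fun z => ?_
          have h2 : Measurable fun t => dens t z * g t :=
            hq.of_uncurry_left (f := fun w t => dens t w * g t)
          rw [hqdef, lintegral_mul_const _ h2]
      _ = ∫⁻ t, ∫⁻ z, dens t z * g t * ψ z ∂((volume : Measure ℝ).prod PX) ∂ν :=
          lintegral_lintegral_swap hm.aemeasurable
      _ ≤ ∫⁻ t, 2 * g t ∂ν := by
          refine lintegral_mono_ae (hν.mono fun t ht => ?_)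
          have hdt := measurable_dens_right t
          calc _ = ∫⁻ z, (dens t * ψ) z * g t ∂((volume : Measure ℝ).prod PX) := by
                refine lintegral_congr fun z => ?_
                rw [Pi.mul_apply]; ring
            _ = (∫⁻ z, ψ z ∂(regModel PX t.1 t.2)) * g t := by
                rw [lintegral_mul_const _ (hdt.mul hψm), regModel_eq PX ht.1,
                  lintegral_withDensity_eq_lintegral_mul _ hdt hψm]
            _ ≤ 2 * g t := by
                gcongr
                rw [lintegral_regModel PX _ _ hψm]
                have hpt : ∀ x e, ψ (inner ℝ x t.1 + e, x) ≤ 1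
                    + (ENNReal.ofReal (2 / w ^ 2) * ENNReal.ofReal ((inner ℝ x (t.1 - θ)) ^ 2)
                    + ENNReal.ofReal (2 / w ^ 2) * ENNReal.ofReal (e ^ 2)) := by
                  intro x e
                  rw [← ENNReal.ofReal_mul (by positivity), ← ENNReal.ofReal_mul (by positivity),
                    ← ENNReal.ofReal_add (by positivity) (by positivity), ← ENNReal.ofReal_one,
                    ← ENNReal.ofReal_add (by norm_num) (by positivity)]
                  apply ENNReal.ofReal_le_ofReal
                  simp only
                  rw [inner_sub_right, div_pow, div_mul_eq_mul_div, div_mul_eq_mul_div,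
                    ← add_div]
                  gcongr
                  nlinarith [sq_nonneg (inner ℝ x t.1 - inner ℝ x θ - e)]
                calc _ ≤ ∫⁻ x, ∫⁻ e, (1
                    + (ENNReal.ofReal (2 / w ^ 2) * ENNReal.ofReal ((inner ℝ x (t.1 - θ)) ^ 2)
                    + ENNReal.ofReal (2 / w ^ 2) * ENNReal.ofReal (e ^ 2)))
                      ∂(gaussianReal 0 (Real.toNNReal (t.2 ^ 2))) ∂PX :=
                      lintegral_mono fun x => lintegral_mono fun e => hpt x e
                  _ = 1 + (ENNReal.ofReal (2 / w ^ 2)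
                        * ∫⁻ x, ENNReal.ofReal ((inner ℝ x (t.1 - θ)) ^ 2) ∂PX
                      + ENNReal.ofReal (2 / w ^ 2) * ENNReal.ofReal (t.2 ^ 2)) := by
                      have hx : ∀ x, ∫⁻ e, (1
                          + (ENNReal.ofReal (2 / w ^ 2)
                            * ENNReal.ofReal ((inner ℝ x (t.1 - θ)) ^ 2)
                          + ENNReal.ofReal (2 / w ^ 2) * ENNReal.ofReal (e ^ 2)))
                          ∂(gaussianReal 0 (Real.toNNReal (t.2 ^ 2)))
                          = 1 + (ENNReal.ofReal (2 / w ^ 2)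
                            * ENNReal.ofReal ((inner ℝ x (t.1 - θ)) ^ 2)
                          + ENNReal.ofReal (2 / w ^ 2) * ENNReal.ofReal (t.2 ^ 2)) := by
                        intro x
                        have he : Measurable fun e : ℝ => ENNReal.ofReal (e ^ 2) := by fun_prop
                        rw [lintegral_add_left measurable_const, lintegral_add_left measurable_const,
                          lintegral_const_mul _ he, lintegral_sq_gaussianReal]
                        simp
                      simp_rw [hx]
                      rw [lintegral_add_left (by fun_prop), lintegral_add_right _ (by fun_prop),
                        lintegral_const_mul _ (by fun_prop)]
                      simp
                  _ ≤ 1 + (ENNReal.ofReal (2 / w ^ 2)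
                        * ENNReal.ofReal (Cx ^ 2 * ‖t.1 - θ‖ ^ 2)
                      + ENNReal.ofReal (2 / w ^ 2) * ENNReal.ofReal (t.2 ^ 2)) := by
                      gcongr
                      exact lintegral_inner_sq_le PX hX _
                  _ ≤ 1 + 1 := by
                      gcongr
                      rw [← mul_add, ← ENNReal.ofReal_add (by positivity) (by positivity),
                        ← ENNReal.ofReal_mul (by positivity), ENNReal.ofReal_le_one,
                        div_mul_eq_mul_div, div_le_one (by positivity)]
                      linarith [ht.2]
                  _ = 2 := one_add_one_eq_two
      _ = 2 := by rw [lintegral_const_mul _ hg, hg1, mul_one]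
  -- whereas `p₀` gives little mass to that region
  have hp₀ψ : ∫⁻ z, dens p₀ z * (ψ z)⁻¹ ^ 9 ∂((volume : Measure ℝ).prod PX)
      ≤ ENNReal.ofReal (2 * w / p₀.2) := by
    have hdle : ∀ z, dens p₀ z ≤ ENNReal.ofReal (1 / (2 * p₀.2)) := by
      intro z
      simp only [dens, gaussianPDF]
      apply ENNReal.ofReal_le_ofReal
      rw [gaussianPDFReal, Real.coe_toNNReal _ (sq_nonneg _)]
      calc _ ≤ (√(2 * Real.pi * p₀.2 ^ 2))⁻¹ * 1 := by
            gcongr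
            rw [Real.exp_le_one_iff]
            exact div_nonpos_of_nonpos_of_nonneg (by nlinarith [sq_nonneg (z.1 - inner ℝ z.2 p₀.1)])
              (by positivity)
        _ ≤ _ := by
            rw [mul_one, ← one_div]
            gcongr
            apply Real.le_sqrt_of_sq_le
            nlinarith [Real.pi_gt_three, sq_nonneg p₀.2]
    calc _ ≤ ∫⁻ z, ENNReal.ofReal (1 / (2 * p₀.2)) * (ψ z)⁻¹ ∂((volume : Measure ℝ).prod PX) := by
          refine lintegral_mono fun z => ?_
          have h1 : (ψ z)⁻¹ ≤ 1 := ENNReal.inv_le_one.2 (hψ1 z)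
          have h2 : (ψ z)⁻¹ ^ 9 ≤ (ψ z)⁻¹ := pow_le_of_le_one (zero_le) h1 (by norm_num)
          gcongr
          exact hdle z
      _ = ENNReal.ofReal (1 / (2 * p₀.2)) * ∫⁻ x, ∫⁻ y, (ψ (y, x))⁻¹ ∂volume ∂PX := by
          have hi : Measurable fun z => (ψ z)⁻¹ := hψm.inv
          rw [lintegral_const_mul _ hi, lintegral_prod_symm _ hi.aemeasurable]
      _ = ENNReal.ofReal (1 / (2 * p₀.2)) * ENNReal.ofReal (w * Real.pi) := by
          congr 1
          have hx : ∀ x : EuclideanSpace ℝ (Fin d),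
              ∫⁻ y, (ψ (y, x))⁻¹ ∂volume = ENNReal.ofReal (w * Real.pi) := by
            intro x
            set f : ℝ → ℝ := fun y => (1 + y ^ 2)⁻¹ with hf
            have h1 : Integrable fun y => f ((y - inner ℝ x θ) / w) :=
              (integrable_inv_one_add_sq.comp_div hw.ne').comp_sub_right (inner ℝ x θ)
            have h2 : ∫ y, f ((y - inner ℝ x θ) / w) = w * Real.pi := by
              rw [integral_sub_right_eq_self (fun y => f (y / w)), Measure.integral_comp_div,
                hf, integral_univ_inv_one_add_sq, abs_of_pos hw, smul_eq_mul]
            rw [← h2, ofReal_integral_eq_lintegral_ofReal h1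
              (Filter.Eventually.of_forall fun y => by simp only [hf, Pi.zero_apply]; positivity)]
            refine lintegral_congr fun y => ?_
            rw [hψ, hf, ENNReal.ofReal_inv_of_pos (by positivity)]
          simp_rw [hx]
          simp
      _ ≤ _ := by
          rw [← ENNReal.ofReal_mul (by positivity)]
          apply ENNReal.ofReal_le_ofReal
          rw [div_mul_eq_mul_div, one_mul, div_le_div_iff₀ (by positivity) h0]
          nlinarith [mul_pos hw h0, Real.pi_lt_four]
  calc _ = ∫⁻ z, (q z * ψ z) ^ (9 / 10 : ℝ) * (dens p₀ z * (ψ z)⁻¹ ^ 9) ^ (1 / 10 : ℝ)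
        ∂((volume : Measure ℝ).prod PX) := by
        rw [lintegral_mixture_lratio PX h0 hg]
        refine lintegral_congr fun z => ?_
        rw [ENNReal.mul_rpow_of_nonneg _ _ (by norm_num), ENNReal.mul_rpow_of_nonneg _ _ (by norm_num),
          ← ENNReal.rpow_natCast, ← ENNReal.rpow_mul, ENNReal.inv_rpow]
        have h1 : ψ z ^ (9 / 10 : ℝ) * (ψ z ^ (((9 : ℕ) : ℝ) * (1 / 10)))⁻¹ = 1 := by
          norm_num
          exact ENNReal.mul_inv_cancel (by simp [hψ0 z, hψT z]) (by simp [hψ0 z, hψT z])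
        calc _ = q z ^ (9 / 10 : ℝ) * dens p₀ z ^ (1 / 10 : ℝ)
              * (ψ z ^ (9 / 10 : ℝ) * (ψ z ^ (((9 : ℕ) : ℝ) * (1 / 10)))⁻¹) := by rw [h1, mul_one]
          _ = _ := by ring
    _ ≤ (∫⁻ z, q z * ψ z ∂((volume : Measure ℝ).prod PX)) ^ (9 / 10 : ℝ)
        * (∫⁻ z, dens p₀ z * (ψ z)⁻¹ ^ 9 ∂((volume : Measure ℝ).prod PX)) ^ (1 / 10 : ℝ) :=
        ENNReal.lintegral_mul_norm_pow_le (hqm.mul hψm).aemeasurable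
          (hp₀.mul (hψm.inv.pow_const _)).aemeasurable (by norm_num) (by norm_num) (by norm_num)
    _ ≤ 2 ^ (9 / 10 : ℝ) * ENNReal.ofReal (2 * w / p₀.2) ^ (1 / 10 : ℝ) := by gcongr
    _ ≤ 2 ^ (1 : ℝ) * ENNReal.ofReal (2 * w / p₀.2) ^ (1 / 10 : ℝ) := by
        gcongr
        · norm_num
        · norm_num
    _ = _ := by rw [ENNReal.rpow_one]

end Mixture

/-! ### Summation over the cells -/

section Cells

variable {d : ℕ}

/-- Splitting the mixing measure into cells, by subadditivity of `x ↦ x ^ β`. -/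
theorem lintegral_rpow_le_tsum_cells {Z T ι : Type*} [MeasurableSpace Z] [MeasurableSpace T]
    [Countable ι] [MeasurableSpace ι] [MeasurableSingletonClass ι] (P : Measure Z) (ν : Measure T)
    [SFinite ν] {idx : T → ι} (hidx : Measurable idx) {f : Z → T → ℝ≥0∞}
    (hf : Measurable (Function.uncurry f)) {β : ℝ} (h0 : 0 < β) (h1 : β ≤ 1) :
    ∫⁻ z, (∫⁻ t, f z t ∂ν) ^ β ∂P
      ≤ ∑' i, ∫⁻ z, (∫⁻ t in idx ⁻¹' {i}, f z t ∂ν) ^ β ∂P := by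
  rw [← lintegral_tsum fun i =>
    (Measurable.lintegral_prod_right (ν := ν.restrict (idx ⁻¹' {i})) hf).pow_const β |>.aemeasurable]
  refine lintegral_mono fun z => ?_
  have h : ∫⁻ t, f z t ∂ν = ∑' i, ∫⁻ t in idx ⁻¹' {i}, f z t ∂ν := by
    rw [← lintegral_iUnion (fun i => hidx (measurableSet_singleton i))
      (fun i j hij => Disjoint.preimage idx (by simpa using hij)), ← Set.preimage_iUnion,
      Set.iUnion_of_singleton, Set.preimage_univ, Measure.restrict_univ]
  rw [h]
  exact tsum_rpow_le _ h0 h1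

theorem measurable_lratioProd_swap {n : ℕ} (p₀ : EuclideanSpace ℝ (Fin d) × ℝ) :
    Measurable (Function.uncurry fun (z : Fin n → ℝ × EuclideanSpace ℝ (Fin d))
      (t : EuclideanSpace ℝ (Fin d) × ℝ) => lratioProd p₀ z t) := measurable_lratioProd p₀

/-- One cell, on which the parameters are close to `c`. -/
theorem lintegral_cell_le (PX : Measure (EuclideanSpace ℝ (Fin d))) [IsProbabilityMeasure PX]
    {p₀ c : EuclideanSpace ℝ (Fin d) × ℝ} (h0 : 0 < p₀.2) (hc : 0 < c.2) (n : ℕ)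
    {ν : Measure (EuclideanSpace ℝ (Fin d) × ℝ)} [SFinite ν] {u : ℝ} (hu0 : 0 ≤ u)
    (hu : ∀ᵐ t ∂ν, 0 < t.2 ∧ 1 ≤ rho PX c t + u) :
    ∫⁻ z, (∫⁻ t, ENNReal.ofReal (Real.exp (n / 20 * (1 - rho PX t p₀))) * lratioProd p₀ z t ∂ν)
        ^ (9 / 10 : ℝ) ∂(Measure.pi fun _ : Fin n => regModel PX p₀.1 p₀.2)
      ≤ ENNReal.ofReal (Real.exp (n * u)) * ν Set.univ ^ (9 / 10 : ℝ) := by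
  have := isProbabilityMeasure_regModel PX p₀.1 p₀.2
  set D := 1 - rho PX c p₀ with hD
  have hD0 : 0 ≤ D := sub_nonneg.2 (rho_le_one _ _ _)
  set K := Real.exp (n / 20 * (2 * u + 2 * D)) with hK
  have hK0 : 0 < K := Real.exp_pos _
  have hDt : ∀ᵐ t ∂ν, 1 - rho PX t p₀ ≤ 2 * u + 2 * D := by
    filter_upwards [hu] with t ht
    have h := affinity_triangle ((volume : Measure ℝ).prod PX) (measurable_dens_right t)
      (measurable_dens_right c) (measurable_dens_right p₀) (lintegral_dens PX ht.1).le
      (lintegral_dens PX hc).le (lintegral_dens PX h0).le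
    rw [affinity_dens PX ht.1 hc, affinity_dens PX hc h0, affinity_dens PX ht.1 h0,
      show (2 : ℝ≥0∞) = ENNReal.ofReal 2 by simp, show (4 : ℝ≥0∞) = ENNReal.ofReal 4 by simp,
      show (6 : ℝ≥0∞) = ENNReal.ofReal 6 by simp, ← ENNReal.ofReal_mul (by norm_num),
      ← ENNReal.ofReal_mul (by norm_num), ← ENNReal.ofReal_mul (by norm_num)] at h
    have r1 := rho_nonneg PX t c
    have r2 := rho_nonneg PX c p₀
    have r3 := rho_nonneg PX t p₀
    rw [← ENNReal.ofReal_add (by positivity) (by positivity),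
      ← ENNReal.ofReal_add (by positivity) (by positivity),
      ENNReal.ofReal_le_ofReal_iff (by positivity)] at h
    have h2 := ht.2
    rw [rho_comm] at h2
    rw [hD]
    linarith
  have hhull := lintegral_mixture_rpow_le (regModel PX p₀.1 p₀.2) ν (measurable_lratio p₀)
    (β := 9 / 10) (by norm_num)
    (R := ENNReal.ofReal (Real.exp ((u - D / 2) / 5)))
    (ENNReal.ofReal_pos.2 (Real.exp_pos _)).ne'
    (fun g hg hg1 => lintegral_mixture_le_of_near PX h0 hc hu0 hu hg hg1) n
  have hm : Measurable fun z => (∫⁻ t, lratioProd p₀ z t ∂ν) ^ (9 / 10 : ℝ) :=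
    ((measurable_lratioProd_swap (n := n) p₀).lintegral_prod_right).pow_const _
  calc _ ≤ ∫⁻ z, ENNReal.ofReal (K ^ (9 / 10 : ℝ)) * (∫⁻ t, lratioProd p₀ z t ∂ν) ^ (9 / 10 : ℝ)
        ∂(Measure.pi fun _ : Fin n => regModel PX p₀.1 p₀.2) := by
        refine lintegral_mono fun z => ?_
        rw [← ENNReal.ofReal_rpow_of_pos hK0, ← ENNReal.mul_rpow_of_nonneg _ _ (by norm_num),
          ← lintegral_const_mul _ (measurable_lratioProd_right p₀ z)]
        refine ENNReal.rpow_le_rpow (lintegral_mono_ae (hDt.mono fun t ht => ?_)) (by norm_num)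
        gcongr
        rw [hK]
        gcongr
    _ = ENNReal.ofReal (K ^ (9 / 10 : ℝ)) * ∫⁻ z, (∫⁻ t, lratioProd p₀ z t ∂ν) ^ (9 / 10 : ℝ)
        ∂(Measure.pi fun _ : Fin n => regModel PX p₀.1 p₀.2) := lintegral_const_mul _ hm
    _ ≤ ENNReal.ofReal (K ^ (9 / 10 : ℝ)) *
        (ENNReal.ofReal (Real.exp ((u - D / 2) / 5)) ^ n * ν Set.univ ^ (9 / 10 : ℝ)) := by
        gcongr
        exact hhull
    _ = ENNReal.ofReal (K ^ (9 / 10 : ℝ) * Real.exp ((u - D / 2) / 5) ^ n)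
        * ν Set.univ ^ (9 / 10 : ℝ) := by
        rw [← mul_assoc, ← ENNReal.ofReal_pow (Real.exp_pos _).le,
          ← ENNReal.ofReal_mul (by positivity)]
    _ ≤ _ := by
        gcongr
        rw [hK, ← Real.exp_mul, ← Real.exp_nat_mul, ← Real.exp_add]
        apply Real.exp_le_exp.2
        have hn : (0 : ℝ) ≤ n := Nat.cast_nonneg n
        nlinarith [mul_nonneg hn hu0, mul_nonneg hn hD0]

/-- Parameters in a bounded range of noise levels and near the grid: the exponential moment of the
squared Hellinger distance costs the entropy of the grid. -/
theorem lintegral_near_grid_le (PX : Measure (EuclideanSpace ℝ (Fin d))) [IsProbabilityMeasure PX]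
    {p₀ : EuclideanSpace ℝ (Fin d) × ℝ} (h0 : 0 < p₀.2) {n : ℕ} (hn : 1 ≤ n) {Cx w τ M σ₁ σ₂ u : ℝ}
    (hX : ∫⁻ x, ‖x‖ₑ ^ 2 ∂PX ≤ ENNReal.ofReal (Cx ^ 2)) (hσ₁ : 0 < σ₁)
    {ν : Measure (EuclideanSpace ℝ (Fin d) × ℝ)} [SFinite ν]
    (hν : ∀ S : Set (EuclideanSpace ℝ (Fin d)), MeasurableSet S →
      ν (Prod.fst ⁻¹' S) ≤ 2 * stuPi d τ S)
    (hae : ∀ᵐ t ∂ν, ‖t.1 - gridPt w (cellIdx w t.1)‖ ^ 2 ≤ M ∧ σ₁ ≤ t.2 ∧ t.2 ≤ σ₂)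
    (hu : 1 / n / σ₁ ^ 2 + Cx ^ 2 * M / (4 * σ₁ ^ 2) ≤ u) (hM : 0 ≤ M) :
    ∫⁻ z, (∫⁻ t, ENNReal.ofReal (Real.exp (n / 20 * (1 - rho PX t p₀))) * lratioProd p₀ z t ∂ν)
        ^ (9 / 10 : ℝ) ∂(Measure.pi fun _ : Fin n => regModel PX p₀.1 p₀.2)
      ≤ ENNReal.ofReal (Real.exp (n * u)) * ((⌊σ₂ * √n⌋₊ + 1 : ℕ) *
        (2 * ∑' k : Fin d → ℤ, stuPi d τ {θ | cellIdx w θ = k} ^ (9 / 10 : ℝ))) := by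
  have := isProbabilityMeasure_regModel PX p₀.1 p₀.2
  have hn0 : (0 : ℝ) < n := by exact_mod_cast hn
  have hs0 : 0 < √(n : ℝ) := Real.sqrt_pos.2 hn0
  have hu0 : 0 ≤ u := le_trans (by positivity) hu
  set J := ⌊σ₂ * √n⌋₊ + 1 with hJ
  set idx : EuclideanSpace ℝ (Fin d) × ℝ → (Fin d → ℤ) × ℕ :=
    fun t => (cellIdx w t.1, ⌊t.2 * √n⌋₊) with hidxdef
  have hidx : Measurable idx := by
    have h1 : Measurable fun t : EuclideanSpace ℝ (Fin d) × ℝ => ⌊t.2 * √n⌋₊ :=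
      Nat.measurable_floor.comp (by fun_prop)
    exact ((measurable_cellIdx w).comp measurable_fst).prodMk h1
  have hfm : Measurable (Function.uncurry fun (z : Fin n → ℝ × EuclideanSpace ℝ (Fin d))
      (t : EuclideanSpace ℝ (Fin d) × ℝ) =>
      ENNReal.ofReal (Real.exp (n / 20 * (1 - rho PX t p₀))) * lratioProd p₀ z t) := by
    have h1 := measurable_rho PX p₀
    have h2 : Measurable fun t : EuclideanSpace ℝ (Fin d) × ℝ =>
      ENNReal.ofReal (Real.exp (n / 20 * (1 - rho PX t p₀))) := by fun_prop
    exact (h2.comp measurable_snd).mul (measurable_lratioProd p₀)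
  refine (lintegral_rpow_le_tsum_cells _ ν hidx hfm (by norm_num) (by norm_num)).trans ?_
  have hcell : ∀ i : (Fin d → ℤ) × ℕ, ∫⁻ z, (∫⁻ t in idx ⁻¹' {i},
      ENNReal.ofReal (Real.exp (n / 20 * (1 - rho PX t p₀))) * lratioProd p₀ z t ∂ν)
        ^ (9 / 10 : ℝ) ∂(Measure.pi fun _ : Fin n => regModel PX p₀.1 p₀.2)
      ≤ ENNReal.ofReal (Real.exp (n * u)) *
        ((2 * stuPi d τ {θ | cellIdx w θ = i.1} ^ (9 / 10 : ℝ))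
          * (if i.2 < J then 1 else 0)) := by
    rintro ⟨k, j⟩
    have hms : MeasurableSet (idx ⁻¹' {(k, j)}) := hidx (measurableSet_singleton _)
    have hmem : ∀ᵐ t ∂(ν.restrict (idx ⁻¹' {(k, j)})), idx t = (k, j) ∧
        (‖t.1 - gridPt w (cellIdx w t.1)‖ ^ 2 ≤ M ∧ σ₁ ≤ t.2 ∧ t.2 ≤ σ₂) := by
      filter_upwards [ae_restrict_mem hms, ae_restrict_of_ae hae] with t ht1 ht2
      exact ⟨ht1, ht2⟩
    refine (lintegral_cell_le PX (c := (gridPt w k, (j + 1) / √n)) h0 (by simp only; positivity)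
      n hu0 ?_).trans ?_
    · filter_upwards [hmem] with t ht
      obtain ⟨hi, hg, hl, -⟩ := ht
      have ht0 : 0 < t.2 := lt_of_lt_of_le hσ₁ hl
      have hk : cellIdx w t.1 = k := congrArg Prod.fst hi
      have hj : ⌊t.2 * √n⌋₊ = j := congrArg Prod.snd hi
      refine ⟨ht0, ?_⟩
      have h1 := one_le_rho_add PX hX (p := t) (q := (gridPt w k, (j + 1) / √n)) ht0
        (by simp only; positivity) hσ₁ hl
      rw [rho_comm]
      refine h1.trans (add_le_add_right ?_ _)
      refine le_trans ?_ hu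
      simp only
      rw [hk] at hg
      have h2 : (t.2 - (j + 1) / √n) ^ 2 ≤ 1 / n := by
        have h3 : (j : ℝ) ≤ t.2 * √n := by rw [← hj]; exact Nat.floor_le (by positivity)
        have h4 : t.2 * √n < j + 1 := by rw [← hj]; exact Nat.lt_floor_add_one _
        have h5 : t.2 - (j + 1) / √n = (t.2 * √n - (j + 1)) / √n := by field_simp
        rw [h5, div_pow, Real.sq_sqrt hn0.le]
        gcongr
        nlinarith
      gcongr
    · gcongr
      rw [Measure.restrict_apply_univ]
      split_ifs with hjJ
      · rw [mul_one]
        have h1 : ν (idx ⁻¹' {(k, j)}) ≤ 2 * stuPi d τ {θ | cellIdx w θ = k} := by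
          refine le_trans (measure_mono ?_) (hν _ (measurable_cellIdx w (measurableSet_singleton k)))
          intro t ht
          exact congrArg Prod.fst ht
        calc _ ≤ (2 * stuPi d τ {θ | cellIdx w θ = k}) ^ (9 / 10 : ℝ) := by gcongr
          _ = 2 ^ (9 / 10 : ℝ) * stuPi d τ {θ | cellIdx w θ = k} ^ (9 / 10 : ℝ) :=
              ENNReal.mul_rpow_of_nonneg _ _ (by norm_num)
          _ ≤ 2 ^ (1 : ℝ) * stuPi d τ {θ | cellIdx w θ = k} ^ (9 / 10 : ℝ) := by
              gcongr
              · norm_num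
              · norm_num
          _ = _ := by rw [ENNReal.rpow_one]
      · have h1 : ν (idx ⁻¹' {(k, j)}) = 0 := by
          refine measure_mono_null (fun t ht => ?_) (ae_iff.1 hae)
          have hj : ⌊t.2 * √n⌋₊ = j := congrArg Prod.snd ht
          rw [Set.mem_ofPred_eq]
          rintro ⟨-, -, h2⟩
          apply hjJ
          rw [← hj, hJ]
          have : ⌊t.2 * √n⌋₊ ≤ ⌊σ₂ * √n⌋₊ := Nat.floor_le_floor (by gcongr)
          omega
        rw [h1, ENNReal.zero_rpow_of_pos (by norm_num)]
        exact bot_le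
  calc _ ≤ ∑' i : (Fin d → ℤ) × ℕ, ENNReal.ofReal (Real.exp (n * u)) *
        ((2 * stuPi d τ {θ | cellIdx w θ = i.1} ^ (9 / 10 : ℝ))
          * (if i.2 < J then 1 else 0)) := ENNReal.tsum_le_tsum hcell
    _ = _ := by
        have hcount : ∑' j : ℕ, (if j < J then (1 : ℝ≥0∞) else 0) = J := by
          rw [tsum_eq_sum (s := Finset.range J) fun j hj => by simpa using hj]
          rw [Finset.sum_congr rfl fun j hj => if_pos (Finset.mem_range.1 hj)]
          simp
        rw [ENNReal.tsum_mul_left, ENNReal.tsum_prod']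
        simp only
        simp_rw [ENNReal.tsum_mul_left, hcount, ENNReal.tsum_mul_right, ENNReal.tsum_mul_left]
        rw [mul_comm (J : ℝ≥0∞)]

/-- Parameters near the grid with small noise level: the data tell them from `p₀`. -/
theorem lintegral_small_noise_le (PX : Measure (EuclideanSpace ℝ (Fin d)))
    [IsProbabilityMeasure PX] {p₀ : EuclideanSpace ℝ (Fin d) × ℝ} (h0 : 0 < p₀.2) (n : ℕ)
    {Cx w τ M σb v : ℝ} (hX : ∫⁻ x, ‖x‖ₑ ^ 2 ∂PX ≤ ENNReal.ofReal (Cx ^ 2))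
    {ν : Measure (EuclideanSpace ℝ (Fin d) × ℝ)} [SFinite ν]
    (hν : ∀ S : Set (EuclideanSpace ℝ (Fin d)), MeasurableSet S →
      ν (Prod.fst ⁻¹' S) ≤ 2 * stuPi d τ S)
    (hae : ∀ᵐ t ∂ν, ‖t.1 - gridPt w (cellIdx w t.1)‖ ^ 2 ≤ M ∧ 0 < t.2 ∧ t.2 ≤ σb)
    (hv : 0 < v) (hM : 2 * (Cx ^ 2 * M) + 2 * σb ^ 2 ≤ v ^ 2) :
    ∫⁻ z, (∫⁻ t, lratioProd p₀ z t ∂ν)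
        ^ (9 / 10 : ℝ) ∂(Measure.pi fun _ : Fin n => regModel PX p₀.1 p₀.2)
      ≤ (2 * ENNReal.ofReal (2 * v / p₀.2) ^ (1 / 10 : ℝ)) ^ n *
        (2 * ∑' k : Fin d → ℤ, stuPi d τ {θ | cellIdx w θ = k} ^ (9 / 10 : ℝ)) := by
  have := isProbabilityMeasure_regModel PX p₀.1 p₀.2
  have hidx : Measurable fun t : EuclideanSpace ℝ (Fin d) × ℝ => cellIdx w t.1 :=
    (measurable_cellIdx w).comp measurable_fst
  refine (lintegral_rpow_le_tsum_cells _ ν hidx (measurable_lratioProd_swap p₀) (by norm_num)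
    (by norm_num)).trans ?_
  rw [← ENNReal.tsum_mul_left, ← ENNReal.tsum_mul_left]
  refine ENNReal.tsum_le_tsum fun k => ?_
  have hms : MeasurableSet ((fun t : EuclideanSpace ℝ (Fin d) × ℝ => cellIdx w t.1) ⁻¹' {k}) :=
    hidx (measurableSet_singleton _)
  have hae' : ∀ᵐ t ∂(ν.restrict ((fun t : EuclideanSpace ℝ (Fin d) × ℝ => cellIdx w t.1) ⁻¹' {k})),
      0 < t.2 ∧ 2 * (Cx ^ 2 * ‖t.1 - gridPt w k‖ ^ 2) + 2 * t.2 ^ 2 ≤ v ^ 2 := by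
    filter_upwards [ae_restrict_mem hms, ae_restrict_of_ae hae] with t ht1 ht2
    obtain ⟨hg, h1, h2⟩ := ht2
    have hk : cellIdx w t.1 = k := ht1
    rw [hk] at hg
    refine ⟨h1, le_trans ?_ hM⟩
    gcongr
  have hR : (2 * ENNReal.ofReal (2 * v / p₀.2) ^ (1 / 10 : ℝ)) ≠ 0 := by
    have : 0 < 2 * v / p₀.2 := by positivity
    have h2 : 0 < ENNReal.ofReal (2 * v / p₀.2) ^ (1 / 10 : ℝ) :=
      ENNReal.rpow_pos (ENNReal.ofReal_pos.2 this) ENNReal.ofReal_ne_top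
    exact mul_ne_zero (by norm_num) h2.ne'
  refine (lintegral_mixture_rpow_le (regModel PX p₀.1 p₀.2) _ (measurable_lratio p₀)
    (β := 9 / 10) (by norm_num) hR
    (fun g hg hg1 => lintegral_mixture_le_of_concentrated PX h0 (gridPt w k) hv hX hae' hg hg1)
    n).trans ?_
  gcongr
  rw [Measure.restrict_apply_univ]
  calc _ ≤ (2 * stuPi d τ {θ | cellIdx w θ = k}) ^ (9 / 10 : ℝ) := by
        gcongr
        exact hν _ (measurable_cellIdx w (measurableSet_singleton k))
    _ = 2 ^ (9 / 10 : ℝ) * stuPi d τ {θ | cellIdx w θ = k} ^ (9 / 10 : ℝ) :=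
        ENNReal.mul_rpow_of_nonneg _ _ (by norm_num)
    _ ≤ 2 ^ (1 : ℝ) * stuPi d τ {θ | cellIdx w θ = k} ^ (9 / 10 : ℝ) := by
        gcongr
        · norm_num
        · norm_num
    _ = _ := by rw [ENNReal.rpow_one]

end Cells

/-! ### The sparse regime -/

/-- The complexity `s log (C_x C₁ √(nd) / s)` of the sparse regression problem, so that
`rate c n d s Cx C₁ = c * complexity n d s Cx C₁ / n`. -/
def complexity (n d s : ℕ) (Cx C₁ : ℝ) : ℝ := s * Real.log (Cx * C₁ * √(n * d) / s)

/-- The assumptions on the sample size, the design and the true parameter, with the noise variance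
between `l` and `u`. -/
structure Regime (l u : ℝ) (n : ℕ) {d : ℕ} (Cx C₁ : ℝ) (PX : Measure (EuclideanSpace ℝ (Fin d)))
    (p₀ : EuclideanSpace ℝ (Fin d) × ℝ) : Prop where
  prob : IsProbabilityMeasure PX
  one_le : 1 ≤ l0Norm p₀.1
  lt_n : l0Norm p₀.1 < n
  lt_d : n < d
  pos_Cx : 0 < Cx
  moment : ∫⁻ x, ‖x‖ₑ ^ 2 ∂PX ≤ ENNReal.ofReal (Cx ^ 2)
  pos_sd : 0 < p₀.2
  le_var : l ≤ p₀.2 ^ 2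
  var_le : p₀.2 ^ 2 ≤ u
  norm_le : l1Norm p₀.1 ≤ C₁ - 2 * d * tauScale n d Cx

section Regime

variable {l u : ℝ} {n d : ℕ} {Cx C₁ : ℝ} {PX : Measure (EuclideanSpace ℝ (Fin d))}
  {p₀ : EuclideanSpace ℝ (Fin d) × ℝ}

namespace Regime

theorem two_le (h : Regime l u n Cx C₁ PX p₀) : (2 : ℝ) ≤ n := by
  have h1 := h.one_le
  have h2 := h.lt_n
  exact_mod_cast (by omega : 2 ≤ n)

theorem three_le (h : Regime l u n Cx C₁ PX p₀) : (3 : ℝ) ≤ d := by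
  have h1 := h.one_le
  have h2 := h.lt_n
  have h3 := h.lt_d
  exact_mod_cast (by omega : 3 ≤ d)

theorem one_le_s (h : Regime l u n Cx C₁ PX p₀) : (1 : ℝ) ≤ l0Norm p₀.1 := by
  exact_mod_cast h.one_le

theorem s_lt_d (h : Regime l u n Cx C₁ PX p₀) : (l0Norm p₀.1 : ℝ) < d := by
  exact_mod_cast h.lt_n.trans h.lt_d

theorem n_lt_d (h : Regime l u n Cx C₁ PX p₀) : (n : ℝ) < d := by
  exact_mod_cast h.lt_d

theorem pos_d (h : Regime l u n Cx C₁ PX p₀) : 0 < d := by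
  have h3 := h.lt_d
  omega

theorem tau_pos (h : Regime l u n Cx C₁ PX p₀) : 0 < tauScale n d Cx := by
  have h2 := h.two_le
  have h3 := h.three_le
  have h4 := h.pos_Cx
  unfold tauScale
  positivity

theorem sq_mul_tau_sq (h : Regime l u n Cx C₁ PX p₀) :
    Cx ^ 2 * tauScale n d Cx ^ 2 = 1 / (n * d) := by
  have h2 := h.two_le
  have h3 := h.three_le
  have h4 := h.pos_Cx
  rw [tauScale, div_pow, mul_pow, Real.sq_sqrt (by positivity)]
  field_simp

theorem l1Norm_nonneg (θ : EuclideanSpace ℝ (Fin d)) : 0 ≤ l1Norm θ :=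
  Finset.sum_nonneg fun _ _ => abs_nonneg _

theorem two_mul_le (h : Regime l u n Cx C₁ PX p₀) : 2 * d * tauScale n d Cx ≤ C₁ := by
  have := h.norm_le
  have := l1Norm_nonneg p₀.1
  linarith

/-- The argument of the logarithm in the complexity dominates both the mean size of the entries of
`θ₀` in units of `τ` and the inverse sparsity. -/
theorem le_arg (h : Regime l u n Cx C₁ PX p₀) :
    l1Norm p₀.1 / tauScale n d Cx / l0Norm p₀.1 + 2 * d / l0Norm p₀.1
      ≤ Cx * C₁ * √(n * d) / l0Norm p₀.1 := by
  have h1 := h.one_le_s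
  have hτ := h.tau_pos
  have e : Cx * C₁ * √(n * d) = C₁ / tauScale n d Cx := by
    rw [tauScale]; field_simp
  rw [e, ← add_div]
  gcongr
  rw [← sub_nonneg, ← sub_sub, ← sub_div, sub_nonneg, le_div_iff₀ hτ]
  linarith [h.norm_le]

theorem log_le_complexity (h : Regime l u n Cx C₁ PX p₀) :
    Real.log 2 * Real.log (2 * d) ≤ complexity n d (l0Norm p₀.1) Cx C₁
      ∧ l0Norm p₀.1 * Real.log 2 ≤ complexity n d (l0Norm p₀.1) Cx C₁ := by
  have h1 := h.one_le_s
  have h2 := h.s_lt_d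
  have hτ := h.tau_pos
  set s : ℝ := (l0Norm p₀.1 : ℝ) with hs
  have hs0 : 0 < s := by linarith
  have hd0 : (0 : ℝ) < d := by linarith
  have h3 : 2 * d / s ≤ Cx * C₁ * √(n * d) / s := by
    refine le_trans ?_ h.le_arg
    have := l1Norm_nonneg p₀.1
    rw [← hs]
    have h4 : 0 ≤ l1Norm p₀.1 / tauScale n d Cx / s := by positivity
    linarith
  have h4 : (2 : ℝ) ≤ 2 * d / s := by rw [le_div_iff₀ hs0]; linarith
  have hl2 : 0 < Real.log 2 := Real.log_pos (by norm_num)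
  have hl2' : Real.log 2 ≤ 1 := by linarith [Real.log_two_lt_d9]
  have h5 : Real.log 2 ≤ Real.log (2 * d / s) := Real.log_le_log (by norm_num) h4
  have h6 : Real.log (2 * d / s) ≤ Real.log (Cx * C₁ * √(n * d) / s) :=
    Real.log_le_log (by linarith) h3
  have hS : s * Real.log (2 * d / s) ≤ complexity n d (l0Norm p₀.1) Cx C₁ := by
    rw [complexity, ← hs]
    gcongr
  refine ⟨le_trans ?_ hS, le_trans (by gcongr) hS⟩
  have h7 : Real.log (2 * d) = Real.log s + Real.log (2 * d / s) := by
    rw [← Real.log_mul hs0.ne' (by positivity)]; congr 1; field_simp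
  have h8 := Real.log_le_sub_one_of_pos hs0
  rw [h7]
  have h9 : Real.log 2 * Real.log s ≤ (s - 1) * Real.log 2 := by nlinarith
  have h10 : (s - 1) * Real.log 2 ≤ (s - 1) * Real.log (2 * d / s) := by
    have : 0 ≤ s - 1 := by linarith
    gcongr
  nlinarith

theorem one_le_complexity (h : Regime l u n Cx C₁ PX p₀) :
    1 ≤ complexity n d (l0Norm p₀.1) Cx C₁ := by
  refine le_trans ?_ h.log_le_complexity.1
  have h1 : Real.log 4 ≤ Real.log (2 * d) :=
    Real.log_le_log (by norm_num) (by linarith [h.three_le])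
  have h2 : Real.log 6 ≤ Real.log (2 * d) :=
    Real.log_le_log (by norm_num) (by linarith [h.three_le])
  have h3 : Real.log 6 = Real.log 2 + Real.log 3 := by
    rw [← Real.log_mul (by norm_num) (by norm_num)]; norm_num
  have h4 : (1 : ℝ) ≤ Real.log 3 := by
    rw [Real.le_log_iff_exp_le (by norm_num)]
    linarith [Real.exp_one_lt_d9]
  have h5 := Real.log_two_gt_d9
  nlinarith

theorem s_le (h : Regime l u n Cx C₁ PX p₀) :
    (l0Norm p₀.1 : ℝ) ≤ 2 * complexity n d (l0Norm p₀.1) Cx C₁ := by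
  have h1 := h.log_le_complexity.2
  have h5 := Real.log_two_gt_d9
  nlinarith [h.one_le_s]

theorem log_n_le (h : Regime l u n Cx C₁ PX p₀) :
    Real.log n ≤ 2 * complexity n d (l0Norm p₀.1) Cx C₁ := by
  have h1 := h.log_le_complexity.1
  have h5 := Real.log_two_gt_d9
  have h2 : Real.log n ≤ Real.log (2 * d) :=
    Real.log_le_log (by linarith [h.two_le]) (by linarith [h.n_lt_d, h.two_le])
  have h3 : 0 ≤ Real.log (2 * d) := Real.log_nonneg (by linarith [h.three_le])
  nlinarith

theorem log_two_le (h : Regime l u n Cx C₁ PX p₀) : Real.log 2 ≤ Real.log n :=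
  Real.log_le_log (by norm_num) h.two_le

/-- The price of the prior for the size of the entries of `θ₀`, by the inequality of arithmetic and
geometric means over the support. -/
theorem prod_le (h : Regime l u n Cx C₁ PX p₀) :
    ∏ j, (1 + |p₀.1 j| / tauScale n d Cx) ≤ Real.exp (complexity n d (l0Norm p₀.1) Cx C₁) := by
  have hs := h.one_le_s
  have hτ := h.tau_pos
  set τ := tauScale n d Cx
  set s := l0Norm p₀.1 with hsdef
  set A := Cx * C₁ * √(n * d) / s with hA
  have hA1 : 1 + l1Norm p₀.1 / τ / s ≤ A := by
    refine le_trans ?_ h.le_arg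
    have : (1 : ℝ) ≤ 2 * d / s := by
      rw [le_div_iff₀ (by linarith)]; linarith [h.s_lt_d, h.one_le_s]
    linarith
  have hl := l1Norm_nonneg p₀.1
  have hA0 : 0 < A := lt_of_lt_of_le (by positivity) hA1
  set U := Finset.univ.filter fun i => p₀.1 i ≠ 0 with hU
  have hcard : U.card = s := rfl
  have h1 : ∏ j, (1 + |p₀.1 j| / τ) = ∏ j ∈ U, (1 + |p₀.1 j| / τ) := by
    refine (Finset.prod_subset (Finset.subset_univ U) fun j _ hj => ?_).symm
    have : p₀.1 j = 0 := by simpa [hU] using hj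
    simp [this]
  have hsum : ∑ j ∈ U, |p₀.1 j| = l1Norm p₀.1 := by
    refine Finset.sum_subset (Finset.subset_univ U) fun j _ hj => ?_
    have : p₀.1 j = 0 := by simpa [hU] using hj
    simp [this]
  rw [h1]
  calc ∏ j ∈ U, (1 + |p₀.1 j| / τ)
      ≤ ∏ j ∈ U, (A * Real.exp ((1 + |p₀.1 j| / τ) / A - 1)) := by
        refine Finset.prod_le_prod (fun j _ => by positivity) fun j _ => ?_
        have h2 := Real.add_one_le_exp ((1 + |p₀.1 j| / τ) / A - 1)
        rw [sub_add_cancel, div_le_iff₀ hA0] at h2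
        linarith
    _ = A ^ s * Real.exp (∑ j ∈ U, ((1 + |p₀.1 j| / τ) / A - 1)) := by
        rw [Finset.prod_mul_distrib, Finset.prod_const, hcard, Real.exp_sum]
    _ ≤ A ^ s * Real.exp 0 := by
        gcongr
        rw [Finset.sum_sub_distrib, ← Finset.sum_div, Finset.sum_add_distrib, ← Finset.sum_div,
          hsum, Finset.sum_const, hcard, nsmul_eq_mul, mul_one, sub_nonpos,
          div_le_iff₀ hA0]
        calc (s : ℝ) + l1Norm p₀.1 / τ = s * (1 + l1Norm p₀.1 / τ / s) := by
              field_simp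
          _ ≤ s * A := by gcongr
    _ = _ := by
        rw [Real.exp_zero, mul_one, complexity, ← hA, Real.exp_nat_mul, Real.exp_log hA0]

end Regime

/-! ### The evidence in the sparse regime -/

theorem lintegral_sum_norm_sq (P : Measure (ℝ × EuclideanSpace ℝ (Fin d)))
    [IsProbabilityMeasure P] {K : ℝ≥0∞} (hK : ∫⁻ w, ‖w.2‖ₑ ^ 2 ∂P ≤ K) :
    ∫⁻ z, ENNReal.ofReal (∑ i, ‖(z i).2‖ ^ 2) ∂(Measure.pi fun _ : Fin n => P) ≤ n * K := by
  have h1 : ∀ z : Fin n → ℝ × EuclideanSpace ℝ (Fin d),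
      ENNReal.ofReal (∑ i, ‖(z i).2‖ ^ 2) = ∑ i, ‖(z i).2‖ₑ ^ 2 := fun z => by
    rw [ENNReal.ofReal_sum_of_nonneg fun i _ => by positivity]
    refine Finset.sum_congr rfl fun i _ => ?_
    rw [ENNReal.ofReal_pow (norm_nonneg _), ofReal_norm]
  have hf : Measurable fun w : ℝ × EuclideanSpace ℝ (Fin d) => ‖w.2‖ₑ ^ 2 := by fun_prop
  simp_rw [h1]
  have hfi : ∀ i : Fin n, Measurable fun z : Fin n → ℝ × EuclideanSpace ℝ (Fin d) =>
      ‖(z i).2‖ₑ ^ 2 := fun i => hf.comp (measurable_pi_apply i)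
  rw [lintegral_finsetSum _ fun i _ => hfi i]
  calc _ = ∑ _i : Fin n, ∫⁻ w, ‖w.2‖ₑ ^ 2 ∂P := by
        refine Finset.sum_congr rfl fun i _ => ?_
        exact (measurePreserving_eval (fun _ : Fin n => P) i).lintegral_comp hf
    _ ≤ ∑ _i : Fin n, K := Finset.sum_le_sum fun _ _ => hK
    _ = n * K := by simp

/-- The evidence is at least `e^{-C S - V}`, where `S` is the complexity and the design enters
through `V`, whose mean is small: of order `1 / d`, and below any prescribed constant. -/
theorem exists_evidence_ge {a b l u : ℝ} (ha : 0 < a) (hb : 0 < b) (hl : 0 < l) (hu : 0 < u) :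
    ∃ K₀ : ℝ, 0 < K₀ ∧ ∀ δ : ℝ, 0 < δ → ∃ C : ℝ, 0 < C ∧
      ∀ (n d : ℕ) (Cx C₁ : ℝ) (PX : Measure (EuclideanSpace ℝ (Fin d)))
        (p₀ : EuclideanSpace ℝ (Fin d) × ℝ), Regime l u n Cx C₁ PX p₀ →
      ∃ V : (Fin n → ℝ × EuclideanSpace ℝ (Fin d)) → ℝ, Measurable V ∧ (∀ z, 0 ≤ V z) ∧
        ∫⁻ z, ENNReal.ofReal (V z) ∂(Measure.pi fun _ : Fin n => regModel PX p₀.1 p₀.2)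
          ≤ ENNReal.ofReal δ ∧
        ∫⁻ z, ENNReal.ofReal (V z) ∂(Measure.pi fun _ : Fin n => regModel PX p₀.1 p₀.2)
          ≤ ENNReal.ofReal (K₀ / d) ∧
        ∀ z, ENNReal.ofReal (Real.exp (-(C * complexity n d (l0Norm p₀.1) Cx C₁ + V z)))
          ≤ ∫⁻ p, lratioProd p₀ z p ∂(prior d C₁ (tauScale n d Cx) a b) := by
  obtain ⟨c, hc, hprior⟩ := exists_le_priorSigma ha hb hl hu
  refine ⟨2 / l, by positivity, fun δ hδ => ⟨2 / l / δ + 6 + |Real.log c| + 4, by positivity,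
    fun n d Cx C₁ PX p₀ h => ?_⟩⟩
  have := h.prob
  have := isProbabilityMeasure_regModel PX p₀.1 p₀.2
  have hτ := h.tau_pos
  have hd3 := h.three_le
  have hn2 := h.two_le
  have hσ := h.pos_sd
  have hlv := h.le_var
  have hS := h.one_le_complexity
  have hd0 : (0 : ℝ) < d := by linarith
  have hn0 : (0 : ℝ) < n := by linarith
  set τ := tauScale n d Cx with hτdef
  set S := complexity n d (l0Norm p₀.1) Cx C₁ with hSdef
  set K₀ := 2 / l with hK₀
  have hK₀pos : 0 < K₀ := by positivity
  -- the scale of the neighbourhood of `θ₀`, shrunk only when `d` is small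
  set e := min 1 (δ * d / K₀) with he
  have he0 : 0 < e := lt_min one_pos (by positivity)
  have he1 : e ≤ 1 := min_le_left _ _
  set η := √e with hη
  have hη0 : 0 < η := Real.sqrt_pos.2 he0
  have hη1 : η ≤ 1 := by rw [hη, Real.sqrt_le_left zero_le_one]; simpa using he1
  have hηsq : η ^ 2 = e := Real.sq_sqrt he0.le
  set V : (Fin n → ℝ × EuclideanSpace ℝ (Fin d)) → ℝ := fun z =>
    4 * (η ^ 2 * τ ^ 2 * (∑ i, ‖(z i).2‖ ^ 2) / (2 * p₀.2 ^ 2)) with hV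
  have hVint : ∫⁻ z, ENNReal.ofReal (V z) ∂(Measure.pi fun _ : Fin n => regModel PX p₀.1 p₀.2)
      ≤ ENNReal.ofReal (K₀ / d * e) := by
    have h1 : ∀ z, ENNReal.ofReal (V z) = ENNReal.ofReal (2 * e * τ ^ 2 / p₀.2 ^ 2)
        * ENNReal.ofReal (∑ i, ‖(z i).2‖ ^ 2) := fun z => by
      rw [← ENNReal.ofReal_mul (by positivity), hV, hηsq]
      congr 1
      field_simp
      ring
    simp_rw [h1]
    have hm : Measurable fun z : Fin n → ℝ × EuclideanSpace ℝ (Fin d) =>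
        ENNReal.ofReal (∑ i, ‖(z i).2‖ ^ 2) := by fun_prop
    have hf : Measurable fun x : EuclideanSpace ℝ (Fin d) => ‖x‖ₑ ^ 2 := by fun_prop
    rw [lintegral_const_mul _ hm]
    calc _ ≤ ENNReal.ofReal (2 * e * τ ^ 2 / p₀.2 ^ 2) * (n * ENNReal.ofReal (Cx ^ 2)) := by
          gcongr
          refine lintegral_sum_norm_sq _ ?_
          rw [lintegral_snd_regModel PX p₀.1 p₀.2 hf]
          exact h.moment
      _ = ENNReal.ofReal (2 * e * (Cx ^ 2 * τ ^ 2) * n / p₀.2 ^ 2) := by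
          rw [← ENNReal.ofReal_natCast n, ← ENNReal.ofReal_mul (by positivity),
            ← ENNReal.ofReal_mul (by positivity)]
          congr 1; ring
      _ ≤ _ := by
          apply ENNReal.ofReal_le_ofReal
          rw [h.sq_mul_tau_sq, hK₀]
          calc 2 * e * (1 / (n * d)) * n / p₀.2 ^ 2 = 2 * e / d / p₀.2 ^ 2 := by field_simp
            _ ≤ 2 * e / d / l := by gcongr
            _ = _ := by ring
  refine ⟨V, by fun_prop, fun z => by positivity, ?_, ?_, fun z => ?_⟩
  · refine hVint.trans (ENNReal.ofReal_le_ofReal ?_)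
    calc K₀ / d * e ≤ K₀ / d * (δ * d / K₀) := by gcongr; exact min_le_right _ _
      _ = δ := by field_simp
  · refine hVint.trans (ENNReal.ofReal_le_ofReal ?_)
    exact mul_le_of_le_one_right (by positivity) he1
  · have hn1 : 1 ≤ n := by have := h.one_le; have := h.lt_n; omega
    refine le_trans ?_ (evidence_ge hn1 h.pos_d hτ hη0 hη1 ha hb hσ h.norm_le z)
    refine le_trans ?_ (mul_le_mul_left (mul_le_mul_right (hprior (p₀.2 ^ 2) hlv h.var_le n hn1) _) _)
    have hprod0 : 0 < ∏ j, (1 + |p₀.1 j| / τ) :=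
      Finset.prod_pos fun j _ => by positivity
    rw [← ENNReal.ofReal_mul (by positivity), ← ENNReal.ofReal_mul (by positivity)]
    apply ENNReal.ofReal_le_ofReal
    have h1 : Real.exp (-(K₀ / δ)) ≤ η ^ d := by
      rcases le_total 1 (δ * d / K₀) with h2 | h2
      · have : e = 1 := min_eq_left h2
        rw [hη, this, Real.sqrt_one, one_pow, Real.exp_le_one_iff, neg_nonpos]
        positivity
      · have h3 : e = δ * d / K₀ := min_eq_right h2
        have h4 : Real.exp (1 - e⁻¹) ≤ e := by
          have h5 := Real.one_sub_inv_le_log_of_pos he0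
          calc _ ≤ Real.exp (Real.log e) := Real.exp_le_exp.2 h5
            _ = e := Real.exp_log he0
        have h6 : e ≤ η := by rw [← hηsq]; nlinarith
        calc Real.exp (-(K₀ / δ)) ≤ Real.exp (1 - e⁻¹) ^ d := by
              rw [← Real.exp_nat_mul]
              apply Real.exp_le_exp.2
              rw [h3, inv_div, mul_sub, mul_div_assoc']
              have : (d : ℝ) * K₀ / (δ * d) = K₀ / δ := by field_simp
              rw [this]
              linarith
          _ ≤ η ^ d := by
              gcongr
              exact h4.trans h6
    have h2 : Real.exp (-(4 * S)) ≤ (∏ j, (1 + |p₀.1 j| / τ) ^ 4)⁻¹ := by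
      rw [Finset.prod_pow, Real.exp_neg]
      apply inv_anti₀ (by positivity)
      calc _ ≤ Real.exp S ^ 4 := by gcongr; exact h.prod_le
        _ = _ := by rw [← Real.exp_nat_mul]; norm_num
    have h3 : Real.exp (-|Real.log c| - 2 * S) ≤ c / n := by
      have h4 := h.log_n_le
      have h5 := neg_abs_le (Real.log c)
      calc _ ≤ Real.exp (Real.log c - Real.log n) := Real.exp_le_exp.2 (by linarith)
        _ = c / n := by rw [Real.exp_sub, Real.exp_log hc, Real.exp_log hn0]
    have h4 : Real.exp (-4 - V z)
        ≤ 1 / 4 * Real.exp (-(4 * (η ^ 2 * τ ^ 2 * (∑ i, ‖(z i).2‖ ^ 2) / (2 * p₀.2 ^ 2)) + 3 / 2)) := by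
      have h5 : Real.exp (-2) ≤ 1 / 4 := by
        rw [Real.exp_neg, inv_le_comm₀ (Real.exp_pos _) (by norm_num)]
        have := Real.add_one_le_exp (1 : ℝ)
        have h6 : Real.exp 2 = Real.exp 1 * Real.exp 1 := by rw [← Real.exp_add]; norm_num
        rw [h6]; nlinarith
      calc Real.exp (-4 - V z) ≤ Real.exp (-2 + -(V z + 3 / 2)) := Real.exp_le_exp.2 (by linarith)
        _ = Real.exp (-2) * Real.exp (-(V z + 3 / 2)) := Real.exp_add _ _
        _ ≤ _ := by gcongr
    have hV0 : 0 ≤ V z := by positivity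
    calc Real.exp (-((K₀ / δ + 6 + |Real.log c| + 4) * S + V z))
        ≤ Real.exp (-(K₀ / δ) + -(4 * S) + (-|Real.log c| - 2 * S) + (-4 - V z)) := by
          apply Real.exp_le_exp.2
          have : 0 ≤ K₀ / δ + |Real.log c| + 4 := by positivity
          nlinarith
      _ = Real.exp (-(K₀ / δ)) * Real.exp (-(4 * S)) * Real.exp (-|Real.log c| - 2 * S)
          * Real.exp (-4 - V z) := by rw [Real.exp_add, Real.exp_add, Real.exp_add]
      _ ≤ _ := by gcongr

/-! ### Parameters with large loss -/

theorem isProbabilityMeasure_prior {a b : ℝ} (ha : 0 < a) (hb : 0 < b)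
    (h : Regime l u n Cx C₁ PX p₀) : IsProbabilityMeasure (prior d C₁ (tauScale n d Cx) a b) := by
  have := isProbabilityMeasure_priorSigma ha hb
  have := isProbabilityMeasure_priorTheta (d := d) h.tau_pos h.pos_d h.two_mul_le
  unfold prior
  infer_instance

theorem ae_pos_prior {τ a b : ℝ} (ha : 0 < a) (hb : 0 < b) :
    ∀ᵐ p ∂(prior d C₁ τ a b), 0 < p.2 := by
  have := isProbabilityMeasure_priorSigma ha hb
  exact Measure.quasiMeasurePreserving_snd.ae ae_pos_priorSigma

theorem lintegral_lratioProd_eq_one (hPX : IsProbabilityMeasure PX) (h0 : 0 < p₀.2)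
    {p : EuclideanSpace ℝ (Fin d) × ℝ} (hp : 0 < p.2) (n : ℕ) :
    ∫⁻ z, lratioProd p₀ z p ∂(Measure.pi fun _ : Fin n => regModel PX p₀.1 p₀.2) = 1 := by
  have := isProbabilityMeasure_regModel PX p₀.1 p₀.2
  have hm : Measurable (lratio p₀ p) := (measurable_lratio p₀).of_uncurry_left
  simp only [lratioProd]
  rw [lintegral_pi_prod _ _ fun _ => hm, Finset.prod_const, regModel_eq PX h0,
    lintegral_withDensity_eq_lintegral_mul _ (measurable_dens_right p₀) hm]
  have h1 : ∀ w, (dens p₀ * lratio p₀ p) w = dens p w := fun w => by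
    rw [Pi.mul_apply, lratio, ← mul_assoc, ENNReal.mul_inv_cancel (dens_ne_zero h0 w)
      (dens_ne_top p₀ w), one_mul]
  simp_rw [h1]
  rw [lintegral_dens PX hp, one_pow]

theorem lintegral_setLIntegral_lratioProd_le {a b : ℝ} (ha : 0 < a) (hb : 0 < b)
    (h : Regime l u n Cx C₁ PX p₀) (R : Set (EuclideanSpace ℝ (Fin d) × ℝ)) :
    ∫⁻ z, ∫⁻ p in R, lratioProd p₀ z p ∂(prior d C₁ (tauScale n d Cx) a b)
      ∂(Measure.pi fun _ : Fin n => regModel PX p₀.1 p₀.2)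
      ≤ prior d C₁ (tauScale n d Cx) a b R := by
  have := h.prob
  have := isProbabilityMeasure_prior ha hb h
  have := isProbabilityMeasure_regModel PX p₀.1 p₀.2
  rw [lintegral_lintegral_swap (measurable_lratioProd p₀).aemeasurable]
  calc _ = ∫⁻ _p in R, 1 ∂(prior d C₁ (tauScale n d Cx) a b) := by
        refine lintegral_congr_ae ?_
        filter_upwards [ae_restrict_of_ae (ae_pos_prior (d := d) (C₁ := C₁)
          (τ := tauScale n d Cx) ha hb)] with p hp
        exact lintegral_lratioProd_eq_one h.prob h.pos_sd hp n
    _ ≤ _ := by simp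

/-- On a set where the loss exceeds the growth `Q` per observation of the negative moments of the
noise level, the weighted likelihood ratio is negligible. -/
theorem lintegral_large_loss_le {a b : ℝ} (ha : 0 < a) (hb : 0 < b)
    (h : Regime l u n Cx C₁ PX p₀) {R : Set (EuclideanSpace ℝ (Fin d) × ℝ)} (hR : MeasurableSet R)
    {L : ℝ} (hL : ∀ p ∈ R, L ≤ loss PX p₀ p) {Q : ℝ} (hQ0 : 0 < Q)
    (hQ : ∫⁻ p in R, ENNReal.ofReal (max 1 (p₀.2 ^ 2 / p.2 ^ 2) ^ n)
      ∂(prior d C₁ (tauScale n d Cx) a b) ≤ ENNReal.ofReal (Q ^ n))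
    (hLQ : 4 + Real.log Q ≤ L / 2) :
    ∫⁻ z, (∫⁻ p in R, ENNReal.ofReal (Real.exp (n / 2 * loss PX p₀ p)) * lratioProd p₀ z p
        ∂(prior d C₁ (tauScale n d Cx) a b)) ^ (1 / 5 : ℝ)
        ∂(Measure.pi fun _ : Fin n => regModel PX p₀.1 p₀.2) ≤ 1 := by
  have := h.prob
  have := isProbabilityMeasure_prior ha hb h
  refine (lintegral_rough_le PX h.pos_sd n _ (ae_restrict_of_ae (ae_pos_prior ha hb))).trans ?_
  have h1 : ∫⁻ p in R, ENNReal.ofReal (Real.exp (-(n / 2 * loss PX p₀ p))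
      * max 1 (p₀.2 ^ 2 / p.2 ^ 2) ^ n) ∂(prior d C₁ (tauScale n d Cx) a b)
      ≤ ENNReal.ofReal ((2⁻¹ : ℝ) ^ 5) ^ n := by
    have hm : Measurable fun p : EuclideanSpace ℝ (Fin d) × ℝ =>
      ENNReal.ofReal (max 1 (p₀.2 ^ 2 / p.2 ^ 2) ^ n) := by fun_prop
    calc _ ≤ ∫⁻ p in R, ENNReal.ofReal (Real.exp (-(n / 2 * L)))
          * ENNReal.ofReal (max 1 (p₀.2 ^ 2 / p.2 ^ 2) ^ n)
            ∂(prior d C₁ (tauScale n d Cx) a b) := by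
          refine setLIntegral_mono' hR fun p hp => ?_
          rw [← ENNReal.ofReal_mul (Real.exp_pos _).le]
          have := hL p hp
          gcongr
      _ = ENNReal.ofReal (Real.exp (-(n / 2 * L))) * ∫⁻ p in R,
          ENNReal.ofReal (max 1 (p₀.2 ^ 2 / p.2 ^ 2) ^ n) ∂(prior d C₁ (tauScale n d Cx) a b) :=
          lintegral_const_mul _ hm
      _ ≤ ENNReal.ofReal (Real.exp (-(n / 2 * L))) * ENNReal.ofReal (Q ^ n) := by gcongr
      _ = ENNReal.ofReal (Real.exp (-(L / 2) + Real.log Q)) ^ n := by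
          rw [← ENNReal.ofReal_mul (Real.exp_pos _).le, ← ENNReal.ofReal_pow (Real.exp_pos _).le,
            Real.exp_add, Real.exp_log hQ0, mul_pow, ← Real.exp_nat_mul]
          congr 3; ring
      _ ≤ _ := by
          gcongr
          calc Real.exp (-(L / 2) + Real.log Q) ≤ Real.exp (-4) := Real.exp_le_exp.2 (by linarith)
            _ = (Real.exp 4)⁻¹ := Real.exp_neg _
            _ ≤ (2⁻¹ : ℝ) ^ 5 := by
                rw [inv_pow]
                apply inv_anti₀ (by norm_num)
                have h2 : Real.exp 4 = Real.exp 1 ^ 4 := by rw [← Real.exp_nat_mul]; norm_num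
                have h3 : (2.7 : ℝ) ≤ Real.exp 1 := by linarith [Real.exp_one_gt_d9]
                rw [h2]
                calc (2 : ℝ) ^ 5 ≤ 2.7 ^ 4 := by norm_num
                  _ ≤ _ := by gcongr
  calc _ ≤ 2 ^ n * (ENNReal.ofReal ((2⁻¹ : ℝ) ^ 5) ^ n) ^ (1 / 5 : ℝ) := by gcongr
    _ = 2 ^ n * ENNReal.ofReal (2⁻¹ : ℝ) ^ n := by
        rw [ENNReal.ofReal_pow (by norm_num), ← pow_mul, mul_comm 5 n, pow_mul,
          ← ENNReal.rpow_natCast _ 5, ← ENNReal.rpow_mul]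
        norm_num
    _ = 1 := by
        rw [← mul_pow, ENNReal.ofReal_inv_of_pos (by norm_num), ENNReal.ofReal_ofNat,
          ENNReal.mul_inv_cancel (by norm_num) (by norm_num), one_pow]

/-- Losses above a multiple of `log n`: the prior of `σ` has enough negative moments. -/
theorem exists_lintegral_loss_gt_log_le {a b l u : ℝ} (ha : 0 < a) (hb : 0 < b) (hu : 0 < u) :
    ∃ C : ℝ, 0 < C ∧
      ∀ (n d : ℕ) (Cx C₁ : ℝ) (PX : Measure (EuclideanSpace ℝ (Fin d)))
        (p₀ : EuclideanSpace ℝ (Fin d) × ℝ), Regime l u n Cx C₁ PX p₀ →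
      ∫⁻ z, (∫⁻ p in {p | C * Real.log n < loss PX p₀ p},
        ENNReal.ofReal (Real.exp (n / 2 * loss PX p₀ p)) * lratioProd p₀ z p
        ∂(prior d C₁ (tauScale n d Cx) a b)) ^ (1 / 5 : ℝ)
        ∂(Measure.pi fun _ : Fin n => regModel PX p₀.1 p₀.2) ≤ 1 := by
  set K := (1 + 2 ^ a) * (1 + 2 * u / b) with hK
  have h2a : (0 : ℝ) < 2 ^ a := by positivity
  have hK1 : 1 ≤ K := by
    have h1 : (0 : ℝ) ≤ 2 * u / b := by positivity
    rw [hK]; nlinarith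
  have hlK : 0 ≤ Real.log K := Real.log_nonneg hK1
  have hl2 : 0 < Real.log 2 := Real.log_pos (by norm_num)
  refine ⟨2 * (1 + (4 + Real.log K) / Real.log 2), by positivity,
    fun n d Cx C₁ PX p₀ h => ?_⟩
  have := h.prob
  have := isProbabilityMeasure_priorSigma ha hb
  have := isProbabilityMeasure_prior ha hb h
  have := isProbabilityMeasure_priorTheta (d := d) h.tau_pos h.pos_d h.two_mul_le
  have hn2 := h.two_le
  have hn0 : (0 : ℝ) < n := by linarith
  have hnn : n ≠ 0 := by
    rintro rfl
    norm_num at hn2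
  refine lintegral_large_loss_le ha hb h (Q := K * n)
    (measurableSet_lt measurable_const (measurable_loss PX p₀)) (fun p hp => le_of_lt hp)
    (by positivity) ?_ ?_
  · have hm : Measurable fun σ : ℝ => ENNReal.ofReal (max 1 (p₀.2 ^ 2 / σ ^ 2) ^ n) := by fun_prop
    refine (setLIntegral_le_lintegral _ _).trans ?_
    have e1 : ∫⁻ p, ENNReal.ofReal (max 1 (p₀.2 ^ 2 / p.2 ^ 2) ^ n)
        ∂(prior d C₁ (tauScale n d Cx) a b)
        = ∫⁻ σ, ENNReal.ofReal (max 1 (p₀.2 ^ 2 / σ ^ 2) ^ n) ∂(priorSigma a b) := by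
      have hm2 : Measurable fun p : EuclideanSpace ℝ (Fin d) × ℝ =>
        ENNReal.ofReal (max 1 (p₀.2 ^ 2 / p.2 ^ 2) ^ n) := by fun_prop
      rw [prior, lintegral_prod _ hm2.aemeasurable]
      simp
    rw [e1]
    have hm3 : Measurable fun σ : ℝ => ENNReal.ofReal ((σ ^ 2)⁻¹ ^ n) := by fun_prop
    calc _ ≤ ∫⁻ σ, (1 + ENNReal.ofReal (u ^ n) * ENNReal.ofReal ((σ ^ 2)⁻¹ ^ n))
          ∂(priorSigma a b) := by
          refine lintegral_mono fun σ => ?_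
          rw [← ENNReal.ofReal_mul (by positivity), ← ENNReal.ofReal_one,
            ← ENNReal.ofReal_add (by norm_num) (by positivity)]
          apply ENNReal.ofReal_le_ofReal
          rcases max_choice 1 (p₀.2 ^ 2 / σ ^ 2) with h3 | h3
          · rw [h3, one_pow]
            have : 0 ≤ u ^ n * (σ ^ 2)⁻¹ ^ n := by positivity
            linarith
          · rw [h3, div_eq_mul_inv, mul_pow]
            have : (p₀.2 ^ 2) ^ n * (σ ^ 2)⁻¹ ^ n ≤ u ^ n * (σ ^ 2)⁻¹ ^ n := by
              have := h.var_le
              gcongr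
            linarith
      _ = 1 + ENNReal.ofReal (u ^ n) * ∫⁻ σ, ENNReal.ofReal ((σ ^ 2)⁻¹ ^ n) ∂(priorSigma a b) := by
          rw [lintegral_add_left measurable_const, lintegral_const_mul _ hm3]
          simp
      _ ≤ 1 + ENNReal.ofReal (u ^ n) * ENNReal.ofReal (2 ^ a * (2 * n / b) ^ n) := by
          gcongr
          exact lintegral_inv_pow_priorSigma_le ha hb n
      _ = ENNReal.ofReal (1 + 2 ^ a * (2 * u / b * n) ^ n) := by
          rw [← ENNReal.ofReal_mul (by positivity), ← ENNReal.ofReal_one,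
            ← ENNReal.ofReal_add (by norm_num) (by positivity)]
          congr 2
          rw [mul_left_comm, ← mul_pow]
          congr 2
          ring
      _ ≤ _ := by
          apply ENNReal.ofReal_le_ofReal
          have h4 : (2 * u / b * n) ^ n ≤ ((1 + 2 * u / b) * n) ^ n := by
            gcongr; linarith
          have h5 : (1 : ℝ) ≤ ((1 + 2 * u / b) * n) ^ n := by
            apply one_le_pow₀
            have : (0 : ℝ) ≤ 2 * u / b := by positivity
            nlinarith
          have h6 : (1 : ℝ) + 2 ^ a ≤ (1 + 2 ^ a) ^ n := le_self_pow₀ (by linarith) hnn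
          calc (1 : ℝ) + 2 ^ a * (2 * u / b * n) ^ n
              ≤ (1 + 2 ^ a) * ((1 + 2 * u / b) * n) ^ n := by nlinarith
            _ ≤ (1 + 2 ^ a) ^ n * ((1 + 2 * u / b) * n) ^ n := by gcongr
            _ = _ := by rw [← mul_pow, hK, mul_assoc]
  · rw [Real.log_mul (by positivity) hn0.ne']
    have h3 := h.log_two_le
    have h4 : 4 + Real.log K ≤ (4 + Real.log K) / Real.log 2 * Real.log n := by
      rw [div_mul_eq_mul_div, le_div_iff₀ hl2]
      gcongr
    linarith

/-- Noise levels that are not too small: losses above a constant. -/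
theorem lintegral_loss_gt_le {a b : ℝ} (ha : 0 < a) (hb : 0 < b) (h : Regime l u n Cx C₁ PX p₀)
    {t Λ : ℝ} (ht : 0 ≤ t) (hΛ : 8 + 4 * t ≤ Λ) :
      ∫⁻ z, (∫⁻ p in {p | Λ < loss PX p₀ p ∧ p₀.2 * Real.exp (-t) ≤ p.2},
        ENNReal.ofReal (Real.exp (n / 2 * loss PX p₀ p)) * lratioProd p₀ z p
        ∂(prior d C₁ (tauScale n d Cx) a b)) ^ (1 / 5 : ℝ)
        ∂(Measure.pi fun _ : Fin n => regModel PX p₀.1 p₀.2) ≤ 1 := by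
  have := h.prob
  have := isProbabilityMeasure_prior ha hb h
  have hσ := h.pos_sd
  have hR : MeasurableSet {p : EuclideanSpace ℝ (Fin d) × ℝ |
      Λ < loss PX p₀ p ∧ p₀.2 * Real.exp (-t) ≤ p.2} :=
    (measurableSet_lt measurable_const (measurable_loss PX p₀)).inter
      (measurableSet_le measurable_const measurable_snd)
  refine lintegral_large_loss_le ha hb h (Q := Real.exp (2 * t)) hR (fun p hp => hp.1.le)
    (Real.exp_pos _) ?_ ?_
  · calc _ ≤ ∫⁻ _p in {p : EuclideanSpace ℝ (Fin d) × ℝ |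
          Λ < loss PX p₀ p ∧ p₀.2 * Real.exp (-t) ≤ p.2}, ENNReal.ofReal (Real.exp (2 * t) ^ n)
            ∂(prior d C₁ (tauScale n d Cx) a b) := by
          refine setLIntegral_mono' hR fun p hp => ENNReal.ofReal_le_ofReal ?_
          gcongr
          refine max_le (Real.one_le_exp (by linarith)) ?_
          have h1 : p₀.2 ≤ p.2 * Real.exp t := by
            have h2 := mul_le_mul_of_nonneg_right hp.2 (Real.exp_pos t).le
            rwa [mul_assoc, ← Real.exp_add, neg_add_cancel, Real.exp_zero, mul_one] at h2
          have h3 : 0 < p.2 := lt_of_lt_of_le (by positivity) hp.2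
          rw [div_le_iff₀ (by positivity)]
          calc p₀.2 ^ 2 ≤ (p.2 * Real.exp t) ^ 2 := by gcongr
            _ = _ := by rw [mul_pow, ← Real.exp_nat_mul]; push_cast; ring
      _ ≤ _ := by
          rw [setLIntegral_const]
          exact mul_le_of_le_one_right' prob_le_one
  · rw [Real.log_exp]
    linarith

end Regime

/-! ### The grid in the sparse regime -/

/-- The mesh of the grid in units of `τ`. The exponent makes the grid coarse enough to have only
`e^{O(s)}` cells, and fine enough for rounding errors to have prior deviations at an exponential
speed `d / T ^ 2` that is polynomial in `n`. -/
def meshRatio (d s : ℕ) : ℝ := ((d : ℝ) / s) ^ (2 / 5 : ℝ)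

/-- The squared distance of `θ` to the grid of mesh `w`. -/
def gridDist {d : ℕ} (w : ℝ) (θ : EuclideanSpace ℝ (Fin d)) : ℝ :=
  ‖θ - gridPt w (cellIdx w θ)‖ ^ 2

theorem measurable_gridDist {d : ℕ} (w : ℝ) : Measurable (gridDist (d := d) w) := by
  have h : gridDist (d := d) w = fun θ => ∑ j, (θ j - w * round (θ j / w)) ^ 2 :=
    funext fun θ => norm_sub_gridPt_sq w θ
  rw [h]
  refine Finset.measurable_fun_sum _ fun j _ => ?_
  have h1 : Measurable fun x : ℝ => ((round (x / w) : ℤ) : ℝ) :=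
    measurable_from_top.comp (measurable_round_div w)
  have h2 : Measurable fun x : ℝ => (x - w * round (x / w)) ^ 2 := by fun_prop
  exact h2.comp (by fun_prop : Measurable fun θ : EuclideanSpace ℝ (Fin d) => θ j)

section Regime

variable {l u : ℝ} {n d : ℕ} {Cx C₁ : ℝ} {PX : Measure (EuclideanSpace ℝ (Fin d))}
  {p₀ : EuclideanSpace ℝ (Fin d) × ℝ} {a b : ℝ}

theorem prior_fst_le (ha : 0 < a) (hb : 0 < b) (h : Regime l u n Cx C₁ PX p₀)
    (S : Set (EuclideanSpace ℝ (Fin d))) :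
    prior d C₁ (tauScale n d Cx) a b (Prod.fst ⁻¹' S) ≤ 2 * stuPi d (tauScale n d Cx) S := by
  have := isProbabilityMeasure_priorSigma ha hb
  have h1 : (Prod.fst ⁻¹' S : Set (EuclideanSpace ℝ (Fin d) × ℝ)) = S ×ˢ Set.univ := by
    ext p; simp
  rw [prior, h1, Measure.prod_prod, measure_univ, mul_one]
  exact priorTheta_le h.tau_pos h.pos_d h.two_mul_le S

theorem Regime.meshRatio_pos (h : Regime l u n Cx C₁ PX p₀) :
    0 < meshRatio d (l0Norm p₀.1) := by
  have h1 := h.one_le_s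
  have h2 := h.three_le
  unfold meshRatio
  positivity

theorem Regime.le_div_meshRatio_sq (h : Regime l u n Cx C₁ PX p₀) :
    (n : ℝ) ^ (1 / 5 : ℝ) ≤ d / meshRatio d (l0Norm p₀.1) ^ 2 := by
  have h1 := h.one_le_s
  have h2 := h.three_le
  have h3 := h.n_lt_d
  have hd0 : (0 : ℝ) < d := by linarith
  rw [le_div_iff₀ (by have := h.meshRatio_pos; positivity), meshRatio, ← Real.rpow_natCast,
    ← Real.rpow_mul (by positivity)]
  calc (n : ℝ) ^ (1 / 5 : ℝ) * ((d : ℝ) / l0Norm p₀.1) ^ (2 / 5 * ((2 : ℕ) : ℝ))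
      ≤ (d : ℝ) ^ (1 / 5 : ℝ) * (d : ℝ) ^ (2 / 5 * ((2 : ℕ) : ℝ)) := by
        gcongr
        exact div_le_self hd0.le h1
    _ = d := by
        rw [← Real.rpow_add hd0]; norm_num

theorem Regime.one_le_div_meshRatio_sq (h : Regime l u n Cx C₁ PX p₀) :
    1 ≤ d / meshRatio d (l0Norm p₀.1) ^ 2 :=
  le_trans (Real.one_le_rpow (by linarith [h.two_le]) (by norm_num)) h.le_div_meshRatio_sq

theorem Regime.mul_meshRatio_le (h : Regime l u n Cx C₁ PX p₀) :
    d * ((meshRatio d (l0Norm p₀.1))⁻¹ ^ 3) ^ (9 / 10 : ℝ) ≤ l0Norm p₀.1 := by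
  have h1 := h.one_le_s
  have h2 := h.s_lt_d
  set s : ℝ := (l0Norm p₀.1 : ℝ)
  have hs0 : 0 < s := by linarith
  have hd0 : (0 : ℝ) < d := by linarith
  rw [meshRatio, ← Real.inv_rpow (by positivity), inv_div, ← Real.rpow_natCast,
    ← Real.rpow_mul (by positivity), ← Real.rpow_mul (by positivity)]
  have h3 : s / d ≤ 1 := by rw [div_le_one hd0]; exact h2.le
  calc d * (s / d) ^ (2 / 5 * (((3 : ℕ) : ℝ) * (9 / 10))) ≤ d * (s / d) ^ (1 : ℝ) := by
        gcongr ?_ * ?_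
        exact Real.rpow_le_rpow_of_exponent_ge (by positivity) h3 (by norm_num)
    _ = s := by rw [Real.rpow_one]; field_simp

/-- The entropy of the grid is at most a multiple of the complexity. -/
theorem exists_tsum_cell_le : ∃ C : ℝ, 0 < C ∧ ∀ {l u : ℝ} {n d : ℕ} {Cx C₁ : ℝ}
    {PX : Measure (EuclideanSpace ℝ (Fin d))} {p₀ : EuclideanSpace ℝ (Fin d) × ℝ},
    Regime l u n Cx C₁ PX p₀ →
    2 * ∑' k : Fin d → ℤ, stuPi d (tauScale n d Cx)
        {θ | cellIdx (tauScale n d Cx * meshRatio d (l0Norm p₀.1)) θ = k} ^ (9 / 10 : ℝ)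
      ≤ ENNReal.ofReal (Real.exp (C * complexity n d (l0Norm p₀.1) Cx C₁)) := by
  obtain ⟨C, hC, hsum⟩ := exists_tsum_stuPi_cell_le
  refine ⟨2 * C + 1, by positivity, fun {l u n d Cx C₁ PX p₀} h => ?_⟩
  have hS := h.one_le_complexity
  have hd := h.mul_meshRatio_le.trans h.s_le
  calc _ ≤ 2 * ENNReal.ofReal (Real.exp (C * (d *
        ((meshRatio d (l0Norm p₀.1))⁻¹ ^ 3) ^ (9 / 10 : ℝ)))) := by
        gcongr
        exact hsum d _ _ h.tau_pos h.meshRatio_pos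
    _ ≤ ENNReal.ofReal (Real.exp 1) * ENNReal.ofReal (Real.exp (C * (2 *
        complexity n d (l0Norm p₀.1) Cx C₁))) := by
        refine mul_le_mul' ?_ (ENNReal.ofReal_le_ofReal (Real.exp_le_exp.2
          (mul_le_mul_of_nonneg_left hd hC.le)))
        · rw [show (2 : ℝ≥0∞) = ENNReal.ofReal 2 by simp]
          apply ENNReal.ofReal_le_ofReal
          linarith [Real.add_one_le_exp (1 : ℝ)]
    _ ≤ _ := by
        rw [← ENNReal.ofReal_mul (Real.exp_pos _).le, ← Real.exp_add]
        apply ENNReal.ofReal_le_ofReal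
        apply Real.exp_le_exp.2
        linarith

/-- The rounding errors that the sieve tolerates, as a multiple of `d τ ^ 2`. -/
def sieveLevel (A : ℝ) (n d s : ℕ) (Cx C₁ : ℝ) : ℝ :=
  A * complexity n d s Cx C₁ / (d / meshRatio d s ^ 2) + 2

theorem Regime.sieveLevel_nonneg (h : Regime l u n Cx C₁ PX p₀) {A : ℝ} (hA : 0 ≤ A) :
    0 ≤ sieveLevel A n d (l0Norm p₀.1) Cx C₁ := by
  have h1 := h.one_le_div_meshRatio_sq
  have h2 := h.one_le_complexity
  unfold sieveLevel
  positivity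

theorem Regime.sieveLevel_le (h : Regime l u n Cx C₁ PX p₀) {A : ℝ} (hA : 0 ≤ A) :
    sieveLevel A n d (l0Norm p₀.1) Cx C₁ ≤ (A + 2) * complexity n d (l0Norm p₀.1) Cx C₁ := by
  have h1 := h.one_le_div_meshRatio_sq
  have h2 := h.one_le_complexity
  have h3 : A * complexity n d (l0Norm p₀.1) Cx C₁ / (d / meshRatio d (l0Norm p₀.1) ^ 2)
      ≤ A * complexity n d (l0Norm p₀.1) Cx C₁ := div_le_self (by positivity) h1
  unfold sieveLevel
  linarith

theorem Regime.sieveLevel_div_le (h : Regime l u n Cx C₁ PX p₀) {A : ℝ} (hA : 0 ≤ A) :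
    sieveLevel A n d (l0Norm p₀.1) Cx C₁ / n
      ≤ (A + 2) * (1 + complexity n d (l0Norm p₀.1) Cx C₁ / n) / (n : ℝ) ^ (1 / 5 : ℝ) := by
  have h1 := h.le_div_meshRatio_sq
  have h2 := h.one_le_complexity
  have h3 := h.two_le
  have hn0 : (0 : ℝ) < n := by linarith
  set S := complexity n d (l0Norm p₀.1) Cx C₁
  set q := (n : ℝ) ^ (1 / 5 : ℝ) with hq
  have hq0 : 0 < q := by positivity
  have hqn : q ≤ n := by
    rw [hq]
    calc (n : ℝ) ^ (1 / 5 : ℝ) ≤ (n : ℝ) ^ (1 : ℝ) :=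
          Real.rpow_le_rpow_of_exponent_le (by linarith) (by norm_num)
      _ = n := Real.rpow_one _
  have h4 : A * S / (d / meshRatio d (l0Norm p₀.1) ^ 2) / n ≤ A * (S / n) / q := by
    calc _ ≤ A * S / q / n := by gcongr
      _ = _ := by ring
  have h5 : 2 / (n : ℝ) ≤ 2 / q := by gcongr
  have e : sieveLevel A n d (l0Norm p₀.1) Cx C₁ / n
      = A * S / (d / meshRatio d (l0Norm p₀.1) ^ 2) / n + 2 / n := by
    rw [sieveLevel, add_div]
  rw [e]
  calc _ ≤ A * (S / n) / q + 2 / q := add_le_add h4 h5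
    _ = (A * (S / n) + 2) / q := by ring
    _ ≤ _ := by
      gcongr
      have : 0 ≤ S / n := by positivity
      nlinarith

theorem Regime.sq_mul_sieve (h : Regime l u n Cx C₁ PX p₀) (m : ℝ) :
    Cx ^ 2 * (m * d * tauScale n d Cx ^ 2) = m / n := by
  have h3 := h.two_le
  have h2 := h.three_le
  calc _ = m * d * (Cx ^ 2 * tauScale n d Cx ^ 2) := by ring
    _ = _ := by
      rw [h.sq_mul_tau_sq]
      have hd0 : (d : ℝ) ≠ 0 := by linarith
      field_simp

/-- Outside the sieve the prior mass is exponentially small. -/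
theorem prior_sieve_compl_le (ha : 0 < a) (hb : 0 < b) (h : Regime l u n Cx C₁ PX p₀) (A : ℝ) :
    prior d C₁ (tauScale n d Cx) a b {p | sieveLevel A n d (l0Norm p₀.1) Cx C₁ * d
        * tauScale n d Cx ^ 2 < gridDist (tauScale n d Cx * meshRatio d (l0Norm p₀.1)) p.1}
      ≤ ENNReal.ofReal (Real.exp (1 - A * complexity n d (l0Norm p₀.1) Cx C₁)) := by
  refine (prior_fst_le ha hb h {θ | sieveLevel A n d (l0Norm p₀.1) Cx C₁ * d
        * tauScale n d Cx ^ 2 < gridDist (tauScale n d Cx * meshRatio d (l0Norm p₀.1)) θ}).trans ?_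
  have h1 := stuPi_rounding_le h.tau_pos h.meshRatio_pos h.pos_d
    (sieveLevel A n d (l0Norm p₀.1) Cx C₁)
  have h2 : (2 : ℝ≥0∞) ≤ ENNReal.ofReal (Real.exp 1) := by
    rw [show (2 : ℝ≥0∞) = ENNReal.ofReal 2 by simp]
    apply ENNReal.ofReal_le_ofReal
    linarith [Real.add_one_le_exp (1 : ℝ)]
  refine (mul_le_mul' h2 h1).trans (le_of_eq ?_)
  rw [← ENNReal.ofReal_mul (Real.exp_pos _).le, ← Real.exp_add]
  congr 2
  have h3 := h.one_le_div_meshRatio_sq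
  have h4 : (d : ℝ) / meshRatio d (l0Norm p₀.1) ^ 2 ≠ 0 := by linarith
  unfold sieveLevel
  rw [add_sub_cancel_right, mul_div_cancel₀ _ h4]
  ring

/-- On the sieve, with noise levels in a fixed range, the exponential moment of the squared
Hellinger distance is of order `e^{O(S)}`. -/
theorem exists_lintegral_sieve_le {l : ℝ} (hl : 0 < l) {t σ₂ A : ℝ} (hσ₂ : 0 < σ₂)
    (hA : 0 ≤ A) : ∃ C : ℝ, 0 < C ∧
      ∀ (n d : ℕ) (Cx C₁ : ℝ) (PX : Measure (EuclideanSpace ℝ (Fin d)))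
        (p₀ : EuclideanSpace ℝ (Fin d) × ℝ) (a b u : ℝ), 0 < a → 0 < b →
        Regime l u n Cx C₁ PX p₀ →
      ∫⁻ z, (∫⁻ p in {p | gridDist (tauScale n d Cx * meshRatio d (l0Norm p₀.1)) p.1
          ≤ sieveLevel A n d (l0Norm p₀.1) Cx C₁ * d * tauScale n d Cx ^ 2
          ∧ p₀.2 * Real.exp (-t) ≤ p.2 ∧ p.2 ≤ σ₂},
        ENNReal.ofReal (Real.exp (n / 20 * (1 - rho PX p p₀))) * lratioProd p₀ z p
        ∂(prior d C₁ (tauScale n d Cx) a b)) ^ (9 / 10 : ℝ)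
        ∂(Measure.pi fun _ : Fin n => regModel PX p₀.1 p₀.2)
      ≤ ENNReal.ofReal (Real.exp (C * complexity n d (l0Norm p₀.1) Cx C₁)) := by
  obtain ⟨Cg, hCg, hgrid⟩ := exists_tsum_cell_le
  refine ⟨(1 + (A + 2) / 4) * (Real.exp (2 * t) / l) + (|Real.log (σ₂ + 1)| + 2) + Cg,
    by positivity, fun n d Cx C₁ PX p₀ a b u ha hb h => ?_⟩
  have := h.prob
  have := isProbabilityMeasure_prior ha hb h
  have hn2 := h.two_le
  have hn0 : (0 : ℝ) < n := by linarith
  have hn1 : 1 ≤ n := by have := h.one_le; have := h.lt_n; omega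
  have hσ := h.pos_sd
  have hlv := h.le_var
  have hS := h.one_le_complexity
  have hm0 := h.sieveLevel_nonneg hA
  have hm := h.sieveLevel_le hA
  set τ := tauScale n d Cx with hτ
  set w := τ * meshRatio d (l0Norm p₀.1) with hw
  set m := sieveLevel A n d (l0Norm p₀.1) Cx C₁ with hmdef
  set S := complexity n d (l0Norm p₀.1) Cx C₁ with hSdef
  set R := {p : EuclideanSpace ℝ (Fin d) × ℝ | gridDist w p.1 ≤ m * d * τ ^ 2
          ∧ p₀.2 * Real.exp (-t) ≤ p.2 ∧ p.2 ≤ σ₂} with hR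
  have hRm : MeasurableSet R :=
    (measurableSet_le ((measurable_gridDist w).comp measurable_fst) measurable_const).inter
      ((measurableSet_le measurable_const measurable_snd).inter
        (measurableSet_le measurable_snd measurable_const))
  set σ₁ := p₀.2 * Real.exp (-t) with hσ₁
  have hσ₁0 : 0 < σ₁ := by positivity
  have hmain := lintegral_near_grid_le PX hσ hn1 (w := w) (τ := τ) (M := m * d * τ ^ 2)
    (σ₁ := σ₁) (σ₂ := σ₂) (u := 1 / n / σ₁ ^ 2 + Cx ^ 2 * (m * d * τ ^ 2) / (4 * σ₁ ^ 2))
    h.moment hσ₁0 (ν := (prior d C₁ τ a b).restrict R)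
    (fun U _ => (Measure.restrict_apply_le _ _).trans (prior_fst_le ha hb h U))
    ((ae_restrict_mem hRm).mono fun p hp => hp) le_rfl (by positivity)
  refine hmain.trans ?_
  have e1 : n * (1 / n / σ₁ ^ 2 + Cx ^ 2 * (m * d * τ ^ 2) / (4 * σ₁ ^ 2))
      ≤ (1 + (A + 2) / 4) * (Real.exp (2 * t) / l) * S := by
    rw [h.sq_mul_sieve]
    have e2 : (σ₁ ^ 2)⁻¹ ≤ Real.exp (2 * t) / l := by
      rw [hσ₁, mul_pow, ← Real.exp_nat_mul, mul_inv, ← Real.exp_neg, mul_comm, div_eq_mul_inv]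
      push_cast
      rw [mul_neg, neg_neg]
      gcongr
    calc n * (1 / n / σ₁ ^ 2 + m / n / (4 * σ₁ ^ 2)) = (1 + m / 4) * (σ₁ ^ 2)⁻¹ := by
          field_simp
      _ ≤ ((1 + (A + 2) / 4) * S) * (Real.exp (2 * t) / l) := by
          gcongr
          linarith
      _ = _ := by ring
  have e3 : (((⌊σ₂ * √n⌋₊ + 1 : ℕ) : ℕ) : ℝ≥0∞)
      ≤ ENNReal.ofReal (Real.exp ((|Real.log (σ₂ + 1)| + 2) * S)) := by
    rw [← ENNReal.ofReal_natCast]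
    apply ENNReal.ofReal_le_ofReal
    push_cast
    have h1 : (⌊σ₂ * √n⌋₊ : ℝ) ≤ σ₂ * √n := Nat.floor_le (by positivity)
    have h2 : √(n : ℝ) ≤ n := by
      rw [Real.sqrt_le_left (by positivity)]; nlinarith
    have h3 : Real.log n ≤ 2 * S := h.log_n_le
    have h4 : Real.log (σ₂ + 1) ≤ |Real.log (σ₂ + 1)| * S :=
      (le_abs_self _).trans (le_mul_of_one_le_right (abs_nonneg _) hS)
    calc (⌊σ₂ * √n⌋₊ : ℝ) + 1 ≤ (σ₂ + 1) * n := by nlinarith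
      _ = Real.exp (Real.log (σ₂ + 1) + Real.log n) := by
          rw [Real.exp_add, Real.exp_log (by positivity), Real.exp_log hn0]
      _ ≤ _ := Real.exp_le_exp.2 (by linarith)
  calc _ ≤ ENNReal.ofReal (Real.exp ((1 + (A + 2) / 4) * (Real.exp (2 * t) / l) * S)) *
        (ENNReal.ofReal (Real.exp ((|Real.log (σ₂ + 1)| + 2) * S)) *
          ENNReal.ofReal (Real.exp (Cg * S))) := by
        gcongr
        exact hgrid h
    _ = _ := by
        rw [← ENNReal.ofReal_mul (Real.exp_pos _).le, ← ENNReal.ofReal_mul (Real.exp_pos _).le,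
          ← Real.exp_add, ← Real.exp_add]
        congr 2; ring

/-- On the sieve, noise levels that are exponentially small in `ρ` have integrated likelihood
exponentially small in `n ρ`, provided the sieve itself is as fine. -/
theorem exists_lintegral_small_noise_le : ∃ Cg : ℝ, 0 < Cg ∧
    ∀ {l u : ℝ} {n d : ℕ} {Cx C₁ : ℝ} {PX : Measure (EuclideanSpace ℝ (Fin d))}
      {p₀ : EuclideanSpace ℝ (Fin d) × ℝ} {a b : ℝ}, 0 < a → 0 < b →
      Regime l u n Cx C₁ PX p₀ → ∀ {A K ρ : ℝ}, 1 ≤ ρ →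
      sieveLevel A n d (l0Norm p₀.1) Cx C₁ / n ≤ (p₀.2 * Real.exp (-(10 * (K + 3) * ρ))) ^ 2 →
      ∫⁻ z, (∫⁻ p in {p | gridDist (tauScale n d Cx * meshRatio d (l0Norm p₀.1)) p.1
          ≤ sieveLevel A n d (l0Norm p₀.1) Cx C₁ * d * tauScale n d Cx ^ 2
          ∧ p.2 < p₀.2 * Real.exp (-(10 * (K + 3) * ρ))}, lratioProd p₀ z p
        ∂(prior d C₁ (tauScale n d Cx) a b)) ^ (9 / 10 : ℝ)
        ∂(Measure.pi fun _ : Fin n => regModel PX p₀.1 p₀.2)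
      ≤ ENNReal.ofReal (Real.exp (Cg * complexity n d (l0Norm p₀.1) Cx C₁ - K * (n * ρ))) := by
  obtain ⟨Cg, hCg, hgrid⟩ := exists_tsum_cell_le
  refine ⟨Cg, hCg, fun {l u n d Cx C₁ PX p₀ a b} ha hb h {A K ρ} hρ hA => ?_⟩
  have := h.prob
  have := isProbabilityMeasure_prior ha hb h
  have hσ := h.pos_sd
  set τ := tauScale n d Cx with hτ
  set w := τ * meshRatio d (l0Norm p₀.1) with hw
  set m := sieveLevel A n d (l0Norm p₀.1) Cx C₁ with hmdef
  set S := complexity n d (l0Norm p₀.1) Cx C₁ with hSdef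
  set σb := p₀.2 * Real.exp (-(10 * (K + 3) * ρ)) with hσb
  have hσb0 : 0 < σb := by positivity
  set R := {p : EuclideanSpace ℝ (Fin d) × ℝ | gridDist w p.1 ≤ m * d * τ ^ 2 ∧ p.2 < σb} with hR
  have hRm : MeasurableSet R :=
    (measurableSet_le ((measurable_gridDist w).comp measurable_fst) measurable_const).inter
      (measurableSet_lt measurable_snd measurable_const)
  have hmain := lintegral_small_noise_le PX hσ n (w := w) (τ := τ) (M := m * d * τ ^ 2)
    (σb := σb) (v := 2 * σb)
    h.moment (ν := (prior d C₁ τ a b).restrict R)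
    (fun U _ => (Measure.restrict_apply_le _ _).trans (prior_fst_le ha hb h U))
    (by
      filter_upwards [ae_restrict_mem hRm, ae_restrict_of_ae (ae_pos_prior (d := d) (C₁ := C₁)
        (τ := τ) ha hb)] with p hp hp0
      exact ⟨hp.1, hp0, hp.2.le⟩) (by positivity)
    (by
      rw [h.sq_mul_sieve]
      nlinarith)
  refine hmain.trans ?_
  have e1 : 2 * ENNReal.ofReal (2 * (2 * σb) / p₀.2) ^ (1 / 10 : ℝ)
      ≤ ENNReal.ofReal (Real.exp (-(K * ρ))) := by
    have h1 : 2 * (2 * σb) / p₀.2 = 4 * Real.exp (-(10 * (K + 3) * ρ)) := by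
      rw [hσb]; field_simp; ring
    rw [h1, ENNReal.ofReal_rpow_of_pos (by positivity), Real.mul_rpow (by norm_num)
      (Real.exp_pos _).le, ← Real.exp_mul, show (2 : ℝ≥0∞) = ENNReal.ofReal 2 by simp,
      ← ENNReal.ofReal_mul (by norm_num)]
    apply ENNReal.ofReal_le_ofReal
    have h2 : (4 : ℝ) ^ (1 / 10 : ℝ) ≤ 4 :=
      (Real.rpow_le_rpow_of_exponent_le (by norm_num) (by norm_num)).trans (Real.rpow_one _).le
    have h3 : (8 : ℝ) ≤ Real.exp 3 := by
      have h4 : Real.exp 3 = Real.exp 1 ^ 3 := by rw [← Real.exp_nat_mul]; norm_num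
      have h5 : (2 : ℝ) ≤ Real.exp 1 := by linarith [Real.add_one_le_exp (1 : ℝ)]
      rw [h4]
      calc (8 : ℝ) = 2 ^ 3 := by norm_num
        _ ≤ _ := by gcongr
    calc 2 * ((4 : ℝ) ^ (1 / 10 : ℝ) * Real.exp (-(10 * (K + 3) * ρ) * (1 / 10)))
        ≤ Real.exp 3 * Real.exp (-(10 * (K + 3) * ρ) * (1 / 10)) := by
          rw [← mul_assoc]
          gcongr
          linarith
      _ = Real.exp (3 + -(10 * (K + 3) * ρ) * (1 / 10)) := (Real.exp_add _ _).symm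
      _ ≤ _ := Real.exp_le_exp.2 (by nlinarith)
  calc _ ≤ ENNReal.ofReal (Real.exp (-(K * ρ))) ^ n * ENNReal.ofReal (Real.exp (Cg * S)) := by
        gcongr
        exact hgrid h
    _ = _ := by
        rw [← ENNReal.ofReal_pow (Real.exp_pos _).le, ← Real.exp_nat_mul,
          ← ENNReal.ofReal_mul (Real.exp_pos _).le, ← Real.exp_add]
        congr 2; ring

end Regime

/-! ### Entropy bound for the posterior loss -/

section Posterior

variable {l u : ℝ} {n d : ℕ} {Cx C₁ : ℝ} {PX : Measure (EuclideanSpace ℝ (Fin d))}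
  {p₀ : EuclideanSpace ℝ (Fin d) × ℝ} {a b : ℝ}

theorem ae_pos_posterior (ha : 0 < a) (hb : 0 < b) (h0 : 0 < p₀.2) (τ : ℝ)
    (z : Fin n → ℝ × EuclideanSpace ℝ (Fin d)) : ∀ᵐ p ∂(posterior C₁ τ a b z), 0 < p.2 := by
  rw [posterior_eq h0, normalize]
  exact Measure.ae_smul_measure
    ((withDensity_absolutelyContinuous _ _).ae_le (ae_pos_prior ha hb)) _

/-- The function whose posterior mean is bounded by the entropy inequality: the loss, up to a
factor, on the sets `U` and `U'` where it is large, the squared Hellinger distance on the sieve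
`R`. -/
def tiltedLoss (PX : Measure (EuclideanSpace ℝ (Fin d))) (p₀ : EuclideanSpace ℝ (Fin d) × ℝ)
    (n : ℕ) (U U' R : Set (EuclideanSpace ℝ (Fin d) × ℝ))
    (p : EuclideanSpace ℝ (Fin d) × ℝ) : ℝ :=
  max ((U ∪ U').indicator (fun p => n / 2 * loss PX p₀ p) p)
    (R.indicator (fun p => n / 20 * (1 - rho PX p p₀)) p)

theorem measurable_tiltedLoss {U U' R : Set (EuclideanSpace ℝ (Fin d) × ℝ)}
    [IsProbabilityMeasure PX] (hU : MeasurableSet U) (hU' : MeasurableSet U') (hR : MeasurableSet R) :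
    Measurable (tiltedLoss PX p₀ n U U' R) := by
  have hJm := measurable_loss PX p₀
  have hρm := measurable_rho PX p₀
  have h1 : Measurable fun p => (n : ℝ) / 2 * loss PX p₀ p := by fun_prop
  have h2 : Measurable fun p => (n : ℝ) / 20 * (1 - rho PX p p₀) := by fun_prop
  exact (h1.indicator (hU.union hU')).max (h2.indicator hR)

theorem ofReal_exp_tiltedLoss_le (U U' R : Set (EuclideanSpace ℝ (Fin d) × ℝ))
    (p : EuclideanSpace ℝ (Fin d) × ℝ) :
    ENNReal.ofReal (Real.exp (tiltedLoss PX p₀ n U U' R p))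
      ≤ 1 + (U.indicator (fun p => ENNReal.ofReal (Real.exp (n / 2 * loss PX p₀ p))) p
        + U'.indicator (fun p => ENNReal.ofReal (Real.exp (n / 2 * loss PX p₀ p))) p
        + R.indicator (fun p => ENNReal.ofReal (Real.exp (n / 20 * (1 - rho PX p p₀)))) p) := by
  unfold tiltedLoss
  rcases max_choice ((U ∪ U').indicator (fun p => n / 2 * loss PX p₀ p) p)
    (R.indicator (fun p => n / 20 * (1 - rho PX p p₀)) p) with h | h <;> rw [h]
  · by_cases hU : p ∈ U
    · rw [Set.indicator_of_mem (show p ∈ U ∪ U' from Or.inl hU), Set.indicator_of_mem hU]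
      exact le_add_left (le_add_right (le_add_right le_rfl))
    · by_cases hU' : p ∈ U'
      · rw [Set.indicator_of_mem (show p ∈ U ∪ U' from Or.inr hU'), Set.indicator_of_mem hU']
        exact le_add_left (le_add_right (le_add_left le_rfl))
      · rw [Set.indicator_of_notMem (by simp [hU, hU']), Real.exp_zero, ENNReal.ofReal_one]
        exact le_add_right le_rfl
  · by_cases hR : p ∈ R
    · rw [Set.indicator_of_mem hR, Set.indicator_of_mem hR]
      exact le_add_left (le_add_left le_rfl)
    · rw [Set.indicator_of_notMem hR, Real.exp_zero, ENNReal.ofReal_one]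
      exact le_add_right le_rfl

/-- The entropy inequality for `tiltedLoss`, with the three exponential moments as hypotheses. -/
theorem lintegral_tiltedLoss_le (ha : 0 < a) (hb : 0 < b) (h : Regime l u n Cx C₁ PX p₀)
    {U U' R : Set (EuclideanSpace ℝ (Fin d) × ℝ)} (hU : MeasurableSet U) (hU' : MeasurableSet U')
    (hR : MeasurableSet R) {Q q B : ℝ} (hQ : 0 ≤ Q) (hq : 0 ≤ q) (hB : 0 ≤ B)
    {V : (Fin n → ℝ × EuclideanSpace ℝ (Fin d)) → ℝ} (hV0 : ∀ z, 0 ≤ V z)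
    (hZ : ∀ z, ENNReal.ofReal (Real.exp (-(B + V z)))
      ≤ ∫⁻ p, lratioProd p₀ z p ∂(prior d C₁ (tauScale n d Cx) a b))
    (hU1 : ∫⁻ z, (∫⁻ p in U, ENNReal.ofReal (Real.exp (n / 2 * loss PX p₀ p)) * lratioProd p₀ z p
        ∂(prior d C₁ (tauScale n d Cx) a b)) ^ (1 / 5 : ℝ)
        ∂(Measure.pi fun _ : Fin n => regModel PX p₀.1 p₀.2) ≤ 1)
    (hU1' : ∫⁻ z, (∫⁻ p in U', ENNReal.ofReal (Real.exp (n / 2 * loss PX p₀ p))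
        * lratioProd p₀ z p ∂(prior d C₁ (tauScale n d Cx) a b)) ^ (1 / 5 : ℝ)
        ∂(Measure.pi fun _ : Fin n => regModel PX p₀.1 p₀.2) ≤ 1)
    (hR1 : ∫⁻ z, (∫⁻ p in R, ENNReal.ofReal (Real.exp (n / 20 * (1 - rho PX p p₀)))
        * lratioProd p₀ z p ∂(prior d C₁ (tauScale n d Cx) a b)) ^ (9 / 10 : ℝ)
        ∂(Measure.pi fun _ : Fin n => regModel PX p₀.1 p₀.2) ≤ ENNReal.ofReal (Real.exp Q)) :
    ∃ W : (Fin n → ℝ × EuclideanSpace ℝ (Fin d)) → ℝ≥0∞, Measurable W ∧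
      ∫⁻ z, W z ∂(Measure.pi fun _ : Fin n => regModel PX p₀.1 p₀.2)
        ≤ ENNReal.ofReal (30 * Real.exp (-(q / 5))) ∧
      ∀ z, ∫⁻ p, ENNReal.ofReal (tiltedLoss PX p₀ n U U' R p)
          ∂(posterior C₁ (tauScale n d Cx) a b z)
        ≤ ENNReal.ofReal (B + 5 * Q + q + 1) + ENNReal.ofReal (V z) + W z := by
  have := h.prob
  have := isProbabilityMeasure_prior ha hb h
  have := isProbabilityMeasure_regModel PX p₀.1 p₀.2
  set π := prior d C₁ (tauScale n d Cx) a b with hπ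
  set P := Measure.pi fun _ : Fin n => regModel PX p₀.1 p₀.2 with hP
  have hJm := measurable_loss PX p₀
  have hρm := measurable_rho PX p₀
  set eJ : EuclideanSpace ℝ (Fin d) × ℝ → ℝ≥0∞ := fun p =>
    ENNReal.ofReal (Real.exp (n / 2 * loss PX p₀ p)) with heJ
  set eD : EuclideanSpace ℝ (Fin d) × ℝ → ℝ≥0∞ := fun p =>
    ENNReal.ofReal (Real.exp (n / 20 * (1 - rho PX p p₀))) with heD
  have heJm : Measurable eJ := by fun_prop
  have heDm : Measurable eD := by fun_prop
  set f := tiltedLoss PX p₀ n U U' R with hf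
  have hfm : Measurable f := measurable_tiltedLoss hU hU' hR
  have hLm := measurable_lratioProd (n := n) p₀
  have hmeas : ∀ (g : EuclideanSpace ℝ (Fin d) × ℝ → ℝ≥0∞), Measurable g →
      ∀ S : Set (EuclideanSpace ℝ (Fin d) × ℝ),
      Measurable fun z : Fin n → ℝ × EuclideanSpace ℝ (Fin d) =>
        ∫⁻ p in S, g p * lratioProd p₀ z p ∂π := fun g hg S =>
    ((hg.comp measurable_snd).mul hLm).lintegral_prod_right'
      (f := fun a : (Fin n → ℝ × EuclideanSpace ℝ (Fin d)) × (EuclideanSpace ℝ (Fin d) × ℝ) =>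
        g a.2 * lratioProd p₀ a.1 a.2)
  set X : (Fin n → ℝ × EuclideanSpace ℝ (Fin d)) → ℝ≥0∞ := fun z =>
    ∫⁻ p, ENNReal.ofReal (Real.exp (f p)) * lratioProd p₀ z p ∂π with hX
  have hXm : Measurable X := by
    have := hmeas (fun p => ENNReal.ofReal (Real.exp (f p))) (by fun_prop) Set.univ
    simpa only [Measure.restrict_univ] using this
  set Z : (Fin n → ℝ × EuclideanSpace ℝ (Fin d)) → ℝ≥0∞ := fun z =>
    ∫⁻ p, lratioProd p₀ z p ∂π with hZdef
  have hZ1 : ∫⁻ z, Z z ∂P ≤ 1 := by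
    have h1 := lintegral_setLIntegral_lratioProd_le ha hb h Set.univ
    simpa only [Measure.restrict_univ, measure_univ] using h1
  have hXle : ∀ z, X z ≤ Z z + ((∫⁻ p in U, eJ p * lratioProd p₀ z p ∂π)
      + (∫⁻ p in U', eJ p * lratioProd p₀ z p ∂π) + ∫⁻ p in R, eD p * lratioProd p₀ z p ∂π) := by
    intro z
    have hL := measurable_lratioProd_right p₀ z
    have hJL : Measurable fun p => eJ p * lratioProd p₀ z p := heJm.mul hL
    have hDL : Measurable fun p => eD p * lratioProd p₀ z p := heDm.mul hL
    rw [← lintegral_indicator hU, ← lintegral_indicator hU', ← lintegral_indicator hR,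
      ← lintegral_add_left (hJL.indicator hU), ← lintegral_add_right _ (hDL.indicator hR),
      ← lintegral_add_left hL]
    refine lintegral_mono fun p => ?_
    refine (mul_le_mul_left (ofReal_exp_tiltedLoss_le U U' R p) _).trans (le_of_eq ?_)
    simp only [add_mul, one_mul, Set.indicator_mul_left, heJ, heD]
  have hpow : ∀ x y : ℝ≥0∞, (x + y) ^ (1 / 5 : ℝ) ≤ x ^ (1 / 5 : ℝ) + y ^ (1 / 5 : ℝ) :=
    fun x y => ENNReal.rpow_add_le_add_rpow _ _ (by norm_num) (by norm_num)
  have hone : ∀ (x : ℝ≥0∞) (r : ℝ), 1 / 5 ≤ r → x ^ (1 / 5 : ℝ) ≤ 1 + x ^ r := by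
    intro x r hr
    rcases le_total x 1 with h1 | h1
    · exact le_add_right (ENNReal.rpow_le_one h1 (by norm_num))
    · exact le_add_left (ENNReal.rpow_le_rpow_of_exponent_le h1 hr)
  have hEX : ∫⁻ z, X z ^ (1 / 5 : ℝ) ∂P ≤ ENNReal.ofReal (6 * Real.exp Q) := by
    have m1 := ((hmeas eJ heJm U).pow_const (1 / 5 : ℝ))
    have m2 := ((hmeas eJ heJm U').pow_const (1 / 5 : ℝ))
    have m3 := ((hmeas eD heDm R).pow_const (9 / 10 : ℝ))
    calc _ ≤ ∫⁻ z, (2 + Z z + (∫⁻ p in U, eJ p * lratioProd p₀ z p ∂π) ^ (1 / 5 : ℝ)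
          + (∫⁻ p in U', eJ p * lratioProd p₀ z p ∂π) ^ (1 / 5 : ℝ)
          + (∫⁻ p in R, eD p * lratioProd p₀ z p ∂π) ^ (9 / 10 : ℝ)) ∂P := by
          refine lintegral_mono fun z => ?_
          refine (ENNReal.rpow_le_rpow (hXle z) (by norm_num)).trans ?_
          refine (hpow _ _).trans ?_
          refine (add_le_add (hone (Z z) 1 (by norm_num)) ((hpow _ _).trans
            (add_le_add (hpow _ _) (hone _ (9 / 10) (by norm_num))))).trans (le_of_eq ?_)
          rw [ENNReal.rpow_one]
          ring
      _ = 2 + ∫⁻ z, Z z ∂P + ∫⁻ z, (∫⁻ p in U, eJ p * lratioProd p₀ z p ∂π) ^ (1 / 5 : ℝ) ∂P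
          + ∫⁻ z, (∫⁻ p in U', eJ p * lratioProd p₀ z p ∂π) ^ (1 / 5 : ℝ) ∂P
          + ∫⁻ z, (∫⁻ p in R, eD p * lratioProd p₀ z p ∂π) ^ (9 / 10 : ℝ) ∂P := by
          rw [lintegral_add_right _ m3, lintegral_add_right _ m2, lintegral_add_right _ m1,
            lintegral_add_left measurable_const, lintegral_const, measure_univ, mul_one]
      _ ≤ 2 + 1 + 1 + 1 + ENNReal.ofReal (Real.exp Q) := by gcongr
      _ = ENNReal.ofReal (5 + Real.exp Q) := by
          rw [ENNReal.ofReal_add (by norm_num) (Real.exp_pos _).le]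
          norm_num
      _ ≤ _ := by
          apply ENNReal.ofReal_le_ofReal
          linarith [Real.one_le_exp hQ]
  refine ⟨fun z => ENNReal.ofReal (5 * Real.exp (-(Q + q / 5))) * X z ^ (1 / 5 : ℝ),
    (hXm.pow_const _).const_mul _, ?_, fun z => ?_⟩
  · rw [lintegral_const_mul _ (hXm.pow_const _)]
    refine (mul_le_mul_right hEX _).trans (le_of_eq ?_)
    rw [← ENNReal.ofReal_mul (by positivity)]
    congr 1
    rw [neg_add, Real.exp_add, Real.exp_neg Q]
    field_simp
    ring
  · rw [posterior_eq h.pos_sd]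
    refine (lintegral_normalize_le (measurable_lratioProd_right p₀ z)
      (B := B + V z) (b := 5 * Q + q) (γ := 1 / 5) (add_nonneg hB (hV0 z)) (by positivity)
      (by norm_num) (hZ z) hfm).trans ?_
    have e1 : B + V z + (5 * Q + q) + 1 = B + 5 * Q + q + 1 + V z := by ring
    rw [e1, ENNReal.ofReal_add (by positivity) (hV0 z)]
    gcongr
    rw [ENNReal.mul_rpow_of_nonneg _ _ (by norm_num), ENNReal.ofReal_rpow_of_pos (Real.exp_pos _),
      ← Real.exp_mul, ← mul_assoc, ← ENNReal.ofReal_mul (by norm_num)]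
    apply le_of_eq
    congr 3
    · norm_num
    · congr 1; ring

/-- A bound on the posterior probability of the union of a set `S₁` of small prior probability and
of a set `S₂` of small integrated likelihood. When the evidence is too small, which is unlikely, the
trivial bound is used. -/
theorem posterior_le_of_evidence (h : Regime l u n Cx C₁ PX p₀)
    {S₁ S₂ : Set (EuclideanSpace ℝ (Fin d) × ℝ)} (hS₁ : MeasurableSet S₁) (hS₂ : MeasurableSet S₂)
    {B K : ℝ} (hK : 0 < K)
    {V : (Fin n → ℝ × EuclideanSpace ℝ (Fin d)) → ℝ}
    (hZ : ∀ z, ENNReal.ofReal (Real.exp (-(B + V z)))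
      ≤ ∫⁻ p, lratioProd p₀ z p ∂(prior d C₁ (tauScale n d Cx) a b))
    (z : Fin n → ℝ × EuclideanSpace ℝ (Fin d)) :
    posterior C₁ (tauScale n d Cx) a b z (S₁ ∪ S₂) ≤ ENNReal.ofReal (Real.exp (B + K))
        * ∫⁻ p in S₁, lratioProd p₀ z p ∂(prior d C₁ (tauScale n d Cx) a b)
      + (ENNReal.ofReal (Real.exp (B + K))
        * ∫⁻ p in S₂, lratioProd p₀ z p ∂(prior d C₁ (tauScale n d Cx) a b)) ^ (9 / 10 : ℝ)
      + ENNReal.ofReal (V z / K) := by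
  rw [posterior_eq h.pos_sd]
  set post := normalize ((prior d C₁ (tauScale n d Cx) a b).withDensity (lratioProd p₀ z)) with hpost
  have h1 : ∀ S, post S ≤ 1 := fun S => (measure_mono (Set.subset_univ S)).trans
    (normalize_univ_le_one _)
  rcases le_total (V z) K with hV | hV
  · have hZ' : ENNReal.ofReal (Real.exp (-(B + K)))
        ≤ ∫⁻ p, lratioProd p₀ z p ∂(prior d C₁ (tauScale n d Cx) a b) := by
      refine le_trans (ENNReal.ofReal_le_ofReal (Real.exp_le_exp.2 ?_)) (hZ z)
      linarith
    have hL := measurable_lratioProd_right p₀ z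
    refine (measure_union_le _ _).trans (le_add_right (add_le_add ?_ ?_))
    · exact normalize_apply_le hZ' hS₁
    · -- `x ≤ x ^ (9 / 10)` for probabilities
      calc post S₂ = post S₂ ^ (1 : ℝ) := (ENNReal.rpow_one _).symm
        _ ≤ post S₂ ^ (9 / 10 : ℝ) := ENNReal.rpow_le_rpow_of_exponent_ge (h1 S₂) (by norm_num)
        _ ≤ _ := ENNReal.rpow_le_rpow (normalize_apply_le hZ' hS₂) (by norm_num)
  · refine le_add_left ((h1 _).trans ?_)
    rw [ENNReal.one_le_ofReal, le_div_iff₀ hK, one_mul]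
    exact hV

end Posterior

section Posterior

variable {l u : ℝ} {n d : ℕ} {Cx C₁ : ℝ} {PX : Measure (EuclideanSpace ℝ (Fin d))}
  {p₀ : EuclideanSpace ℝ (Fin d) × ℝ} {a b : ℝ}

theorem loss_le_tiltedLoss {U U' : Set (EuclideanSpace ℝ (Fin d) × ℝ)}
    (R : Set (EuclideanSpace ℝ (Fin d) × ℝ)) {p : EuclideanSpace ℝ (Fin d) × ℝ}
    (hp : p ∈ U ∪ U') : n / 2 * loss PX p₀ p ≤ tiltedLoss PX p₀ n U U' R p := by
  unfold tiltedLoss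
  rw [Set.indicator_of_mem hp]
  exact le_max_left _ _

theorem rho_le_tiltedLoss (U U' : Set (EuclideanSpace ℝ (Fin d) × ℝ))
    {R : Set (EuclideanSpace ℝ (Fin d) × ℝ)} {p : EuclideanSpace ℝ (Fin d) × ℝ}
    (hp : p ∈ R) : n / 20 * (1 - rho PX p p₀) ≤ tiltedLoss PX p₀ n U U' R p := by
  unfold tiltedLoss
  rw [Set.indicator_of_mem hp]
  exact le_max_right _ _

theorem tiltedLoss_nonneg [IsProbabilityMeasure PX]
    (U U' R : Set (EuclideanSpace ℝ (Fin d) × ℝ)) (p : EuclideanSpace ℝ (Fin d) × ℝ) :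
    0 ≤ tiltedLoss PX p₀ n U U' R p := by
  refine le_max_of_le_left (Set.indicator_nonneg (fun p _ => ?_) p)
  have := loss_nonneg PX p₀ p
  positivity

/-- The posterior mean of the loss, when the loss is dominated by a multiple of `tiltedLoss` off a
set `S₁ ∪ S₂` of small posterior probability, on which it is at most `M`. -/
theorem exists_posterior_loss_le_of_bounds (ha : 0 < a) (hb : 0 < b)
    (h : Regime l u n Cx C₁ PX p₀)
    {U U' R S₁ S₂ : Set (EuclideanSpace ℝ (Fin d) × ℝ)} (hU : MeasurableSet U)
    (hU' : MeasurableSet U') (hR : MeasurableSet R) (hS₁ : MeasurableSet S₁)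
    (hS₂ : MeasurableSet S₂) {Q B F M K c₁ : ℝ} (hQ : 0 ≤ Q) (hB : 0 ≤ B) (hF : 1 ≤ F)
    (hM : 0 ≤ M) (hK : 0 < K) (hc : 0 ≤ c₁)
    {V : (Fin n → ℝ × EuclideanSpace ℝ (Fin d)) → ℝ} (hVm : Measurable V) (hV0 : ∀ z, 0 ≤ V z)
    (hZ : ∀ z, ENNReal.ofReal (Real.exp (-(B + V z)))
      ≤ ∫⁻ p, lratioProd p₀ z p ∂(prior d C₁ (tauScale n d Cx) a b))
    (hU1 : ∫⁻ z, (∫⁻ p in U, ENNReal.ofReal (Real.exp (n / 2 * loss PX p₀ p)) * lratioProd p₀ z p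
        ∂(prior d C₁ (tauScale n d Cx) a b)) ^ (1 / 5 : ℝ)
        ∂(Measure.pi fun _ : Fin n => regModel PX p₀.1 p₀.2) ≤ 1)
    (hU1' : ∫⁻ z, (∫⁻ p in U', ENNReal.ofReal (Real.exp (n / 2 * loss PX p₀ p))
        * lratioProd p₀ z p ∂(prior d C₁ (tauScale n d Cx) a b)) ^ (1 / 5 : ℝ)
        ∂(Measure.pi fun _ : Fin n => regModel PX p₀.1 p₀.2) ≤ 1)
    (hR1 : ∫⁻ z, (∫⁻ p in R, ENNReal.ofReal (Real.exp (n / 20 * (1 - rho PX p p₀)))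
        * lratioProd p₀ z p ∂(prior d C₁ (tauScale n d Cx) a b)) ^ (9 / 10 : ℝ)
        ∂(Measure.pi fun _ : Fin n => regModel PX p₀.1 p₀.2) ≤ ENNReal.ofReal (Real.exp Q))
    (hpt : ∀ p : EuclideanSpace ℝ (Fin d) × ℝ, 0 < p.2 → n * loss PX p₀ p
      ≤ F * tiltedLoss PX p₀ n U U' R p + (S₁ ∪ S₂).indicator (fun _ => M) p + c₁)
    (hVF : ENNReal.ofReal F * ∫⁻ z, ENNReal.ofReal (V z)
        ∂(Measure.pi fun _ : Fin n => regModel PX p₀.1 p₀.2) ≤ ENNReal.ofReal (1 / 4))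
    (hM1 : ENNReal.ofReal (M * Real.exp (B + K)) * prior d C₁ (tauScale n d Cx) a b S₁
      ≤ ENNReal.ofReal (1 / 8))
    (hM2 : ENNReal.ofReal (M * Real.exp (B + K)) * ∫⁻ z, (∫⁻ p in S₂, lratioProd p₀ z p
        ∂(prior d C₁ (tauScale n d Cx) a b)) ^ (9 / 10 : ℝ)
        ∂(Measure.pi fun _ : Fin n => regModel PX p₀.1 p₀.2) ≤ ENNReal.ofReal (1 / 8))
    (hM3 : ENNReal.ofReal (M / K) * ∫⁻ z, ENNReal.ofReal (V z)
        ∂(Measure.pi fun _ : Fin n => regModel PX p₀.1 p₀.2) ≤ ENNReal.ofReal (1 / 8)) :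
    ∃ W : (Fin n → ℝ × EuclideanSpace ℝ (Fin d)) → ℝ≥0∞, Measurable W ∧
      ∫⁻ z, W z ∂(Measure.pi fun _ : Fin n => regModel PX p₀.1 p₀.2) ≤ 1 ∧
      ∀ z, ∫⁻ p, ENNReal.ofReal (n * loss PX p₀ p) ∂(posterior C₁ (tauScale n d Cx) a b z)
        ≤ ENNReal.ofReal (F * (B + 5 * Q + 5 * Real.log (120 * F) + 1) + c₁) + W z := by
  have := h.prob
  have hlog : 0 ≤ Real.log (120 * F) := Real.log_nonneg (by linarith)
  obtain ⟨W, hWm, hW1, hW⟩ := lintegral_tiltedLoss_le ha hb h hU hU' hR hQ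
    (q := 5 * Real.log (120 * F)) (by positivity) hB hV0 hZ hU1 hU1' hR1
  set π := prior d C₁ (tauScale n d Cx) a b with hπ
  set P := Measure.pi fun _ : Fin n => regModel PX p₀.1 p₀.2 with hP
  have : IsProbabilityMeasure π := isProbabilityMeasure_prior ha hb h
  have hLm := measurable_lratioProd (n := n) p₀
  have hmeas : ∀ S : Set (EuclideanSpace ℝ (Fin d) × ℝ),
      Measurable fun z : Fin n → ℝ × EuclideanSpace ℝ (Fin d) => ∫⁻ p in S, lratioProd p₀ z p ∂π :=
    fun S => hLm.lintegral_prod_right'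
      (f := fun a : (Fin n → ℝ × EuclideanSpace ℝ (Fin d)) × (EuclideanSpace ℝ (Fin d) × ℝ) =>
        lratioProd p₀ a.1 a.2)
  set E := ENNReal.ofReal (M * Real.exp (B + K)) with hE
  have hVm' : Measurable fun z => ENNReal.ofReal (V z) := hVm.ennreal_ofReal
  have g1 : Measurable fun z : Fin n → ℝ × EuclideanSpace ℝ (Fin d) =>
      E * ∫⁻ p in S₁, lratioProd p₀ z p ∂π := (hmeas S₁).const_mul _
  have g2' := (hmeas S₂).pow_const (9 / 10 : ℝ)
  have g2 : Measurable fun z : Fin n → ℝ × EuclideanSpace ℝ (Fin d) =>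
      E * (∫⁻ p in S₂, lratioProd p₀ z p ∂π) ^ (9 / 10 : ℝ) := g2'.const_mul _
  have g3 : Measurable fun z : Fin n → ℝ × EuclideanSpace ℝ (Fin d) =>
      ENNReal.ofReal (M / K) * ENNReal.ofReal (V z) := hVm'.const_mul _
  have g4 : Measurable fun z : Fin n → ℝ × EuclideanSpace ℝ (Fin d) =>
      ENNReal.ofReal F * ENNReal.ofReal (V z) := hVm'.const_mul _
  have g5 : Measurable fun z : Fin n → ℝ × EuclideanSpace ℝ (Fin d) =>
      ENNReal.ofReal F * W z := hWm.const_mul _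
  refine ⟨fun z => ENNReal.ofReal F * W z + ENNReal.ofReal F * ENNReal.ofReal (V z)
    + ENNReal.ofReal (M / K) * ENNReal.ofReal (V z)
    + E * (∫⁻ p in S₂, lratioProd p₀ z p ∂π) ^ (9 / 10 : ℝ)
    + E * ∫⁻ p in S₁, lratioProd p₀ z p ∂π,
    (((g5.add g4).add g3).add g2).add g1, ?_, fun z => ?_⟩
  · rw [lintegral_add_right _ g1, lintegral_add_right _ g2, lintegral_add_right _ g3,
      lintegral_add_right _ g4, lintegral_const_mul _ hWm, lintegral_const_mul _ hVm',
      lintegral_const_mul _ hVm', lintegral_const_mul _ g2', lintegral_const_mul _ (hmeas S₁)]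
    have h1 : ENNReal.ofReal F * ∫⁻ z, W z ∂P ≤ ENNReal.ofReal (1 / 4) := by
      refine (mul_le_mul_right hW1 _).trans (le_of_eq ?_)
      rw [← ENNReal.ofReal_mul (by linarith)]
      congr 1
      rw [mul_div_cancel_left₀ _ (by norm_num : (5 : ℝ) ≠ 0), Real.exp_neg,
        Real.exp_log (by linarith)]
      have : F ≠ 0 := by linarith
      field_simp
      norm_num
    have h2 : E * ∫⁻ z, ∫⁻ p in S₁, lratioProd p₀ z p ∂π ∂P ≤ ENNReal.ofReal (1 / 8) :=
      (mul_le_mul_right (lintegral_setLIntegral_lratioProd_le ha hb h S₁) _).trans hM1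
    refine (add_le_add (add_le_add (add_le_add (add_le_add h1 hVF) hM3) hM2) h2).trans ?_
    rw [← ENNReal.ofReal_add, ← ENNReal.ofReal_add, ← ENNReal.ofReal_add, ← ENNReal.ofReal_add,
      ← ENNReal.ofReal_one] <;> norm_num
  · have hfm := measurable_tiltedLoss (PX := PX) (p₀ := p₀) (n := n) hU hU' hR
    have hf0 := tiltedLoss_nonneg (PX := PX) (p₀ := p₀) (n := n) U U' R
    set f := tiltedLoss PX p₀ n U U' R with hf
    set post := posterior C₁ (tauScale n d Cx) a b z with hpost
    have hp1 : post Set.univ ≤ 1 := normalize_univ_le_one _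
    have k1 : Measurable fun p => ENNReal.ofReal (f p) := hfm.ennreal_ofReal
    have k2 : Measurable fun p : EuclideanSpace ℝ (Fin d) × ℝ =>
        (S₁ ∪ S₂).indicator (fun _ => ENNReal.ofReal M) p :=
      measurable_const.indicator (hS₁.union hS₂)
    have s1 : ∫⁻ p, ENNReal.ofReal (n * loss PX p₀ p) ∂post
        ≤ ∫⁻ p, (ENNReal.ofReal F * ENNReal.ofReal (f p)
          + (S₁ ∪ S₂).indicator (fun _ => ENNReal.ofReal M) p + ENNReal.ofReal c₁) ∂post := by
      refine lintegral_mono_ae ?_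
      filter_upwards [ae_pos_posterior ha hb h.pos_sd (tauScale n d Cx) z] with p hp
      refine (ENNReal.ofReal_le_ofReal (hpt p hp)).trans (ENNReal.ofReal_add_le.trans ?_)
      refine add_le_add (ENNReal.ofReal_add_le.trans (add_le_add ?_ ?_)) le_rfl
      · rw [ENNReal.ofReal_mul (by linarith)]
      · by_cases hS : p ∈ S₁ ∪ S₂
        · rw [Set.indicator_of_mem hS, Set.indicator_of_mem hS]
        · rw [Set.indicator_of_notMem hS, Set.indicator_of_notMem hS, ENNReal.ofReal_zero]
    have s2 : post (S₁ ∪ S₂) ≤ _ := posterior_le_of_evidence h hS₁ hS₂ hK hZ z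
    have s3 : ENNReal.ofReal M * post (S₁ ∪ S₂) ≤ E * ∫⁻ p in S₁, lratioProd p₀ z p ∂π
        + E * (∫⁻ p in S₂, lratioProd p₀ z p ∂π) ^ (9 / 10 : ℝ)
        + ENNReal.ofReal (M / K) * ENNReal.ofReal (V z) := by
      refine (mul_le_mul_right s2 _).trans ?_
      rw [mul_add, mul_add]
      refine add_le_add (add_le_add (le_of_eq ?_) ?_) (le_of_eq ?_)
      · rw [hE, ENNReal.ofReal_mul hM, mul_assoc]
      · rw [hE, ENNReal.ofReal_mul hM, mul_assoc, ENNReal.mul_rpow_of_nonneg _ _ (by norm_num)]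
        refine mul_le_mul_right (mul_le_mul_left ?_ _) _
        refine (ENNReal.rpow_le_rpow_of_exponent_le ?_ (by norm_num : (9 / 10 : ℝ) ≤ 1)).trans_eq
          (ENNReal.rpow_one _)
        exact ENNReal.one_le_ofReal.2 (Real.one_le_exp (by positivity))
      · rw [← ENNReal.ofReal_mul hM, ← ENNReal.ofReal_mul (by positivity)]
        congr 1
        ring
    calc _ ≤ _ := s1
      _ = ENNReal.ofReal F * ∫⁻ p, ENNReal.ofReal (f p) ∂post
          + ENNReal.ofReal M * post (S₁ ∪ S₂) + ENNReal.ofReal c₁ * post Set.univ := by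
          rw [lintegral_add_right _ measurable_const, lintegral_add_right _ k2,
            lintegral_const_mul _ k1, lintegral_const,
            lintegral_indicator_const (hS₁.union hS₂)]
      _ ≤ ENNReal.ofReal F * (ENNReal.ofReal (B + 5 * Q + 5 * Real.log (120 * F) + 1)
            + ENNReal.ofReal (V z) + W z)
          + (E * ∫⁻ p in S₁, lratioProd p₀ z p ∂π
        + E * (∫⁻ p in S₂, lratioProd p₀ z p ∂π) ^ (9 / 10 : ℝ)
        + ENNReal.ofReal (M / K) * ENNReal.ofReal (V z)) + ENNReal.ofReal c₁ * 1 :=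
          add_le_add (add_le_add (mul_le_mul_right (hW z) _) s3) (mul_le_mul_right hp1 _)
      _ = _ := by
          rw [ENNReal.ofReal_add (p := F * _) (by positivity) hc,
            ENNReal.ofReal_mul (by linarith : 0 ≤ F)]
          ring

end Posterior

/-! ### The loss on and off the sieve -/

section Posterior

variable {l u : ℝ} {n d : ℕ} {Cx C₁ : ℝ} {PX : Measure (EuclideanSpace ℝ (Fin d))}
  {p₀ : EuclideanSpace ℝ (Fin d) × ℝ} {a b : ℝ}

/-- Pointwise domination of the loss. Off the sieve `g ≤ v` and at very small noise levels, a loss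
that is not already in the tilted part is at most `L`; on the sieve, either the noise level is
bounded away from `0` and a bounded loss is comparable to the squared Hellinger distance, or the
constant `c₁` absorbs it. -/
theorem loss_le_tiltedLoss_add (h : Regime l u n Cx C₁ PX p₀)
    (g : EuclideanSpace ℝ (Fin d) → ℝ) {v L t t₁ σ₂ c₁ : ℝ} (hL : 0 ≤ L) (ht₁ : 0 ≤ t₁)
    (hσ₂ : 2 * p₀.2 * Real.exp (2 * (8 + 4 * t₁)) ≤ σ₂) (hc₁ : 0 ≤ c₁)
    (hcase : t ≤ t₁ ∨ n * (8 + 4 * t) ≤ c₁) {p : EuclideanSpace ℝ (Fin d) × ℝ} (hp : 0 < p.2) :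
    n * loss PX p₀ p ≤ 20 * Real.exp (8 + 4 * t₁) * tiltedLoss PX p₀ n {p | L < loss PX p₀ p}
        {p | 8 + 4 * t < loss PX p₀ p ∧ p₀.2 * Real.exp (-t) ≤ p.2}
        {p | g p.1 ≤ v ∧ p₀.2 * Real.exp (-t₁) ≤ p.2 ∧ p.2 ≤ σ₂} p
      + ({p : EuclideanSpace ℝ (Fin d) × ℝ | v < g p.1}
          ∪ {p | g p.1 ≤ v ∧ p.2 < p₀.2 * Real.exp (-t)}).indicator (fun _ => n * L) p + c₁ := by
  have := h.prob
  set U : Set (EuclideanSpace ℝ (Fin d) × ℝ) := {p | L < loss PX p₀ p} with hU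
  set U' : Set (EuclideanSpace ℝ (Fin d) × ℝ) :=
    {p | 8 + 4 * t < loss PX p₀ p ∧ p₀.2 * Real.exp (-t) ≤ p.2} with hU'
  set R : Set (EuclideanSpace ℝ (Fin d) × ℝ) :=
    {p | g p.1 ≤ v ∧ p₀.2 * Real.exp (-t₁) ≤ p.2 ∧ p.2 ≤ σ₂} with hR
  set S : Set (EuclideanSpace ℝ (Fin d) × ℝ) :=
    {p : EuclideanSpace ℝ (Fin d) × ℝ | v < g p.1}
      ∪ {p | g p.1 ≤ v ∧ p.2 < p₀.2 * Real.exp (-t)} with hS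
  have hn : (0 : ℝ) ≤ n := Nat.cast_nonneg n
  have hf0 := tiltedLoss_nonneg (PX := PX) (p₀ := p₀) (n := n) U U' R p
  have hJ0 := loss_nonneg PX p₀ p
  have hE : 1 ≤ Real.exp (8 + 4 * t₁) := Real.one_le_exp (by linarith)
  have hI : 0 ≤ S.indicator (fun _ => n * L) p :=
    Set.indicator_nonneg (fun _ _ => mul_nonneg hn hL) p
  have hlarge : p ∈ U ∪ U' → n * loss PX p₀ p
      ≤ 20 * Real.exp (8 + 4 * t₁) * tiltedLoss PX p₀ n U U' R p := fun hp => by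
    have h1 := loss_le_tiltedLoss (PX := PX) (p₀ := p₀) (n := n) R hp
    nlinarith
  by_cases hJ : L < loss PX p₀ p
  · have := hlarge (Or.inl hJ)
    linarith
  by_cases hpS : p ∈ S
  · rw [Set.indicator_of_mem hpS]
    have h1 : n * loss PX p₀ p ≤ n * L := mul_le_mul_of_nonneg_left (not_lt.1 hJ) hn
    have h2 : 0 ≤ 20 * Real.exp (8 + 4 * t₁) * tiltedLoss PX p₀ n U U' R p := by positivity
    linarith
  have hg : g p.1 ≤ v := not_lt.1 fun hv => hpS (Or.inl hv)
  have hσ : p₀.2 * Real.exp (-t) ≤ p.2 := not_lt.1 fun hv => hpS (Or.inr ⟨hg, hv⟩)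
  by_cases hJt : 8 + 4 * t < loss PX p₀ p
  · have := hlarge (Or.inr ⟨hJt, hσ⟩)
    linarith
  have hJt' := not_lt.1 hJt
  rcases hcase with hc | hc
  · have hJ1 : loss PX p₀ p ≤ 8 + 4 * t₁ := by linarith
    have hpR : p ∈ R := by
      refine ⟨hg, le_trans ?_ hσ, (le_of_loss_le PX h.pos_sd hp hJ1).trans hσ₂⟩
      exact mul_le_mul_of_nonneg_left (Real.exp_le_exp.2 (by linarith)) h.pos_sd.le
    have h1 := rho_le_tiltedLoss (PX := PX) (p₀ := p₀) (n := n) U U' hpR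
    have h2 := mul_le_mul_of_nonneg_left (loss_le_exp_mul PX h.pos_sd hp hJ1) hn
    have h3 := mul_le_mul_of_nonneg_left h1 (by positivity : 0 ≤ 20 * Real.exp (8 + 4 * t₁))
    linarith
  · have h1 := mul_le_mul_of_nonneg_left hJt' hn
    have h2 : 0 ≤ 20 * Real.exp (8 + 4 * t₁) * tiltedLoss PX p₀ n U U' R p := by positivity
    linarith

/-- A posterior probability exponentially small in the complexity makes up for a loss of order
`log n`. -/
theorem Regime.mul_log_le (h : Regime l u n Cx C₁ PX p₀) {C : ℝ} (hC : 0 < C) :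
    n * (C * Real.log n) ≤ Real.exp ((C + 4) * complexity n d (l0Norm p₀.1) Cx C₁) := by
  have hS := h.one_le_complexity
  have hlog := h.log_n_le
  set S := complexity n d (l0Norm p₀.1) Cx C₁
  have hn : (0 : ℝ) < n := Nat.cast_pos.2 (h.one_le.trans_lt h.lt_n |>.trans_le' (by norm_num))
  have h1 : (n : ℝ) ≤ Real.exp (2 * S) := by
    rw [← Real.exp_log hn]; exact Real.exp_le_exp.2 hlog
  have h2 : Real.log n ≤ Real.exp (2 * S) := (Real.log_le_self hn.le).trans h1
  have h3 : C ≤ Real.exp (C * S) := by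
    have := Real.add_one_le_exp (C * S)
    nlinarith
  have h4 : 0 ≤ Real.log n := (Real.log_nonneg one_le_two).trans h.log_two_le
  calc n * (C * Real.log n) ≤ Real.exp (2 * S) * (Real.exp (C * S) * Real.exp (2 * S)) :=
        mul_le_mul h1 (mul_le_mul h3 h2 h4 (Real.exp_pos _).le) (by positivity)
          (Real.exp_pos _).le
    _ = _ := by rw [← Real.exp_add, ← Real.exp_add]; congr 1; ring

theorem exp_neg_three_le : Real.exp (-3) ≤ 1 / 8 := by
  rw [Real.exp_neg, one_div]
  refine inv_anti₀ (by norm_num) ?_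
  have h1 : Real.exp 3 = Real.exp 1 ^ 3 := by rw [← Real.exp_nat_mul]; norm_num
  have h2 : (2 : ℝ) ≤ Real.exp 1 := by linarith [Real.add_one_le_exp (1 : ℝ)]
  rw [h1]
  calc (8 : ℝ) = 2 ^ 3 := by norm_num
    _ ≤ _ := pow_le_pow_left₀ (by norm_num) h2 3

/-- When `log n` is large compared with `1 + S / n`, the sieve radius is small compared with the
noise levels at which the sieve is used. -/
theorem Regime.sieveLevel_div_le_sq (h : Regime l u n Cx C₁ PX p₀) (hl : 0 < l) {A T : ℝ}
    (hA : 0 ≤ A)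
    (hn : 5 * (|Real.log ((A + 2) / l)| + 1 + 2 * T)
        * (1 + complexity n d (l0Norm p₀.1) Cx C₁ / n) ≤ Real.log n) :
    sieveLevel A n d (l0Norm p₀.1) Cx C₁ / n
      ≤ (p₀.2 * Real.exp (-(T * (1 + complexity n d (l0Norm p₀.1) Cx C₁ / n)))) ^ 2 := by
  have hS := h.one_le_complexity
  have hlev := h.sieveLevel_div_le hA
  set S := complexity n d (l0Norm p₀.1) Cx C₁
  have hn0 : (0 : ℝ) < n := Nat.cast_pos.2 (h.one_le.trans_lt h.lt_n |>.trans_le' (by norm_num))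
  set ρ := 1 + S / n with hρ
  have hρ1 : 1 ≤ ρ := by rw [hρ]; have : 0 ≤ S / n := by positivity
                         linarith
  have hAl : 0 < (A + 2) / l := by positivity
  have h1 : (A + 2) / l ≤ Real.exp (|Real.log ((A + 2) / l)| * ρ) := by
    rw [← Real.log_le_iff_le_exp hAl]
    have := le_abs_self (Real.log ((A + 2) / l))
    have := abs_nonneg (Real.log ((A + 2) / l))
    nlinarith
  have h2 : ρ ≤ Real.exp ρ := by linarith [Real.add_one_le_exp ρ]
  have h3 : (A + 2) / l * ρ * Real.exp (2 * (T * ρ)) ≤ (n : ℝ) ^ (1 / 5 : ℝ) := by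
    rw [Real.rpow_def_of_pos hn0]
    calc (A + 2) / l * ρ * Real.exp (2 * (T * ρ))
        ≤ Real.exp (|Real.log ((A + 2) / l)| * ρ) * Real.exp ρ * Real.exp (2 * (T * ρ)) :=
          mul_le_mul_of_nonneg_right (mul_le_mul h1 h2 (by linarith) (Real.exp_pos _).le)
            (Real.exp_pos _).le
      _ = Real.exp ((|Real.log ((A + 2) / l)| + 1 + 2 * T) * ρ) := by
          rw [← Real.exp_add, ← Real.exp_add]; congr 1; ring
      _ ≤ _ := Real.exp_le_exp.2 (by linarith)
  have hn5 : 0 < (n : ℝ) ^ (1 / 5 : ℝ) := Real.rpow_pos_of_pos hn0 _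
  refine hlev.trans ?_
  rw [div_le_iff₀ hn5]
  have h4 : (p₀.2 * Real.exp (-(T * ρ))) ^ 2 = p₀.2 ^ 2 * (Real.exp (2 * (T * ρ)))⁻¹ := by
    rw [mul_pow, ← Real.exp_neg, ← Real.exp_nat_mul]; congr 2; push_cast; ring
  rw [h4]
  have h5 : 0 < Real.exp (2 * (T * ρ)) := Real.exp_pos _
  calc (A + 2) * ρ = l * (Real.exp (2 * (T * ρ)))⁻¹
        * ((A + 2) / l * ρ * Real.exp (2 * (T * ρ))) := by field_simp
    _ ≤ l * (Real.exp (2 * (T * ρ)))⁻¹ * (n : ℝ) ^ (1 / 5 : ℝ) :=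
        mul_le_mul_of_nonneg_left h3 (by positivity)
    _ ≤ _ := by
        refine mul_le_mul_of_nonneg_right (mul_le_mul_of_nonneg_right h.le_var ?_) hn5.le
        positivity

/-- When `log n` is bounded by a multiple of `1 + S / n`, a loss of order `log n` is negligible. -/
theorem Regime.mul_log_le_of_log_lt (h : Regime l u n Cx C₁ PX p₀) {C c : ℝ} (hC : 0 < C)
    (hc : 0 < c) (hn : Real.log n < c * (1 + complexity n d (l0Norm p₀.1) Cx C₁ / n)) :
    n * (C * Real.log n)
      ≤ C * (2 * c + 2 * c * Real.exp (2 * c)) * complexity n d (l0Norm p₀.1) Cx C₁ := by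
  have hS := h.one_le_complexity
  set S := complexity n d (l0Norm p₀.1) Cx C₁
  have hn0 : (0 : ℝ) < n := Nat.cast_pos.2 (h.one_le.trans_lt h.lt_n |>.trans_le' (by norm_num))
  have h0 : n * Real.log n ≤ c * (n + S) := by
    have := mul_le_mul_of_nonneg_left hn.le hn0.le
    refine this.trans (le_of_eq ?_)
    field_simp
  have he := Real.exp_pos (2 * c)
  have key : n * Real.log n ≤ (2 * c + 2 * c * Real.exp (2 * c)) * S := by
    rcases le_total (n : ℝ) S with hnS | hnS
    · have : 0 ≤ c * Real.exp (2 * c) * S := by positivity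
      nlinarith
    · have h1 : Real.log n ≤ 2 * c := by
        have : S / n ≤ 1 := (div_le_one hn0).2 hnS
        nlinarith
      have h2 : (n : ℝ) ≤ Real.exp (2 * c) := (Real.log_le_iff_le_exp hn0).1 h1
      have h3 : n * Real.log n ≤ Real.exp (2 * c) * (2 * c) :=
        (mul_le_mul_of_nonneg_left h1 hn0.le).trans
          (mul_le_mul_of_nonneg_right h2 (by positivity))
      have h4 : Real.exp (2 * c) * (2 * c) * 1 ≤ Real.exp (2 * c) * (2 * c) * S :=
        mul_le_mul_of_nonneg_left hS (by positivity)
      have : 0 ≤ 2 * c * S := by positivity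
      nlinarith
  calc n * (C * Real.log n) = C * (n * Real.log n) := by ring
    _ ≤ C * ((2 * c + 2 * c * Real.exp (2 * c)) * S) := mul_le_mul_of_nonneg_left key hC.le
    _ = _ := by ring

end Posterior

/-! ### The posterior mean of the loss -/

set_option maxHeartbeats 400000 in
/-- The posterior mean of `n` times the loss is at most a multiple of the complexity, up to a
remainder of mean at most `1`. -/
theorem exists_posterior_loss_le {a b l u : ℝ} (ha : 0 < a) (hb : 0 < b) (hl : 0 < l)
    (hu : 0 < u) : ∃ C : ℝ, 0 < C ∧ ∀ (n d : ℕ) (Cx C₁ : ℝ)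
      (PX : Measure (EuclideanSpace ℝ (Fin d))) (p₀ : EuclideanSpace ℝ (Fin d) × ℝ),
      Regime l u n Cx C₁ PX p₀ →
      ∃ W : (Fin n → ℝ × EuclideanSpace ℝ (Fin d)) → ℝ≥0∞, Measurable W ∧
        ∫⁻ z, W z ∂(Measure.pi fun _ : Fin n => regModel PX p₀.1 p₀.2) ≤ 1 ∧
        ∀ z, ∫⁻ p, ENNReal.ofReal (n * loss PX p₀ p) ∂(posterior C₁ (tauScale n d Cx) a b z)
          ≤ ENNReal.ofReal (C * complexity n d (l0Norm p₀.1) Cx C₁) + W z := by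
  obtain ⟨K₀, hK₀, hev⟩ := exists_evidence_ge ha hb hl hu
  obtain ⟨B, hB, hev⟩ := hev (1 / 8) (by norm_num)
  obtain ⟨D, hD, hlog⟩ := exists_lintegral_loss_gt_log_le (l := l) ha hb hu
  obtain ⟨G, hG, hnoise⟩ := exists_lintegral_small_noise_le
  set K := 16 * D * K₀ with hKdef
  have hK : 0 < K := by positivity
  -- `A` is the sieve exponent and `H` the small noise exponent: both beat the posterior
  -- normalization `exp ((B + K) S)` and the factor `n log n ≤ exp (4 S)`.
  set A := D + B + K + 8 with hA
  set H := D + B + K + G + 7 with hH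
  -- the value of `10 (H + 3) ρ`, for `ρ = 1 + S / n`, at its largest when `S ≤ n`
  set t₁ := 20 * (H + 3) with ht₁
  have hH0 : 0 < H := by positivity
  have ht₁0 : 0 < t₁ := by positivity
  set F := 20 * Real.exp (8 + 4 * t₁) with hF
  have hF1 : 1 ≤ F := by
    have : 1 ≤ Real.exp (8 + 4 * t₁) := Real.one_le_exp (by positivity)
    linarith
  set σ₂ := 2 * √u * Real.exp (2 * (8 + 4 * t₁)) with hσ₂
  have hσ₂0 : 0 < σ₂ := by positivity
  obtain ⟨Q, hQ, hsieve⟩ := exists_lintegral_sieve_le hl (t := t₁) hσ₂0 (A := A) (by positivity)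
  -- for `log n ≥ c ρ` the sieve is fine enough, and `n ≥ c` makes `F K₀ / d ≤ 1 / 4`
  set c := 5 * (|Real.log ((A + 2) / l)| + 1 + 2 * (10 * (H + 3))) + 4 * F * K₀ with hc
  have hc0 : 0 < c := by positivity
  set q := 5 * Real.log (120 * F) + 1 with hq
  have hq0 : 0 < q := by
    have : 0 ≤ Real.log (120 * F) := Real.log_nonneg (by linarith)
    positivity
  set E := D * (2 * c + 2 * c * Real.exp (2 * c)) with hE
  have hE0 : 0 < E := by positivity
  refine ⟨F * (B + 5 * Q + q) + (8 + 80 * (H + 3)) + 2 * (B + q) + E, by positivity,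
    fun n d Cx C₁ PX p₀ h => ?_⟩
  have := h.prob
  have hS := h.one_le_complexity
  have hlogn := h.log_n_le
  have hMle := h.mul_log_le hD
  have hlog0 : 0 ≤ Real.log n := (Real.log_nonneg one_le_two).trans h.log_two_le
  obtain ⟨V, hVm, hV0, hVδ, hVd, hZ⟩ := hev n d Cx C₁ PX p₀ h
  have hU1 := hlog n d Cx C₁ PX p₀ h
  have hsv := hsieve n d Cx C₁ PX p₀ a b u ha hb h
  have hnz := fun (ρ : ℝ) (hρ : 1 ≤ ρ) => hnoise ha hb h (A := A) (K := H) (ρ := ρ) hρ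
  have hA0 : 0 ≤ A := by positivity
  have hlev := h.sieveLevel_div_le_sq hl (A := A) (T := 10 * (H + 3)) hA0
  have hET := h.mul_log_le_of_log_lt hD hc0
  have hpr := prior_sieve_compl_le ha hb h A
  set S := complexity n d (l0Norm p₀.1) Cx C₁ with hSdef
  have hn0 : (0 : ℝ) < n := Nat.cast_pos.2 (h.one_le.trans_lt h.lt_n |>.trans_le' (by norm_num))
  have hd0 : (0 : ℝ) < d := hn0.trans (Nat.cast_lt.2 h.lt_d)
  have hnd : (n : ℝ) ≤ d := Nat.cast_le.2 h.lt_d.le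
  have hJm := measurable_loss PX p₀
  have hUm : MeasurableSet {p | D * Real.log n < loss PX p₀ p} :=
    measurableSet_lt measurable_const hJm
  have hL0 : 0 ≤ D * Real.log n := by positivity
  have hFc : ∀ x y : ℝ, x ≤ y → ENNReal.ofReal x ≤ ENNReal.ofReal y :=
    fun _ _ => ENNReal.ofReal_le_ofReal
  rcases lt_or_ge (Real.log n) (c * (1 + S / n)) with hcase | hcase
  · -- The loss is tilted only where it is of order at least `log n`.
    refine (exists_posterior_loss_le_of_bounds ha hb h hUm
      MeasurableSet.empty MeasurableSet.empty MeasurableSet.empty MeasurableSet.empty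
      (Q := 0) (B := B * S) (F := 2) (M := 0) (K := 1) (c₁ := n * (D * Real.log n)) le_rfl
      (by positivity) (by norm_num) le_rfl one_pos (by positivity) hVm hV0 hZ hU1
      (by simp) (by simp) ?_ ?_ (by simp) (by simp) (by simp)).imp fun W hW => ⟨hW.1, hW.2.1,
        fun z => (hW.2.2 z).trans (add_le_add (hFc _ _ ?_) le_rfl)⟩
    · intro p hp
      have hJ0 := loss_nonneg PX p₀ p
      have hf0 := tiltedLoss_nonneg (PX := PX) (p₀ := p₀) (n := n)
        {p | D * Real.log n < loss PX p₀ p} ∅ ∅ p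
      rw [Set.union_empty, Set.indicator_empty]
      by_cases hJ : D * Real.log n < loss PX p₀ p
      · have h1 := loss_le_tiltedLoss (PX := PX) (p₀ := p₀) (n := n)
          (U := {p | D * Real.log n < loss PX p₀ p}) (U' := ∅) ∅ (p := p) (Or.inl hJ)
        have : 0 ≤ n * (D * Real.log n) := by positivity
        linarith
      · have := mul_le_mul_of_nonneg_left (not_lt.1 hJ) hn0.le
        linarith
    · refine (mul_le_mul_right hVδ _).trans ?_
      rw [← ENNReal.ofReal_mul (by norm_num)]
      norm_num
    · have h1 := hET hcase
      have h2 : 5 * Real.log (120 * 2) + 1 ≤ q := by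
        have : Real.log (120 * 2) ≤ Real.log (120 * F) :=
          Real.log_le_log (by norm_num) (by
            have : 1 ≤ Real.exp (8 + 4 * t₁) := Real.one_le_exp (by positivity)
            linarith)
        linarith
      have h3 : q ≤ q * S := le_mul_of_one_le_right hq0.le hS
      have h4 : 0 ≤ (F * (B + 5 * Q + q) + (8 + 80 * (H + 3))) * S := by positivity
      nlinarith
  · set ρ := 1 + S / n with hρ
    have hSn : 0 ≤ S / n := by positivity
    have hρ1 : 1 ≤ ρ := by linarith
    have hnρ : n * ρ = n + S := by rw [hρ]; field_simp
    set t := 10 * (H + 3) * ρ with ht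
    have ht0 : 0 ≤ t := by positivity
    have hc1 : 5 * (|Real.log ((A + 2) / l)| + 1 + 2 * (10 * (H + 3))) * ρ ≤ Real.log n := by
      refine le_trans (mul_le_mul_of_nonneg_right ?_ (by linarith)) hcase
      have : 0 ≤ 4 * F * K₀ := by positivity
      linarith
    have hN1 := hnz ρ hρ1 (hlev hc1)
    have hU2 := lintegral_loss_gt_le ha hb h ht0 (le_refl (8 + 4 * t))
    have hgm := measurable_gridDist (d := d) (tauScale n d Cx * meshRatio d (l0Norm p₀.1))
    set g := gridDist (d := d) (tauScale n d Cx * meshRatio d (l0Norm p₀.1)) with hg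
    set v := sieveLevel A n d (l0Norm p₀.1) Cx C₁ * d * tauScale n d Cx ^ 2 with hv
    have hgm1 : Measurable fun p : EuclideanSpace ℝ (Fin d) × ℝ => g p.1 := by
      simpa only [Function.comp_def] using hgm.comp measurable_fst
    have hm1 : MeasurableSet {p : EuclideanSpace ℝ (Fin d) × ℝ | g p.1 ≤ v} :=
      measurableSet_le hgm1 measurable_const
    have hm2 : MeasurableSet {p : EuclideanSpace ℝ (Fin d) × ℝ | v < g p.1} :=
      measurableSet_lt measurable_const hgm1
    have hm3 : MeasurableSet
        {p : EuclideanSpace ℝ (Fin d) × ℝ | g p.1 ≤ v ∧ p.2 < p₀.2 * Real.exp (-t)} :=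
      hm1.inter (measurableSet_lt measurable_snd measurable_const)
    have hσ0 : p₀.2 ≤ √u := Real.le_sqrt_of_sq_le h.var_le
    refine (exists_posterior_loss_le_of_bounds ha hb h hUm
      ((measurableSet_lt measurable_const hJm).inter
        (measurableSet_le measurable_const measurable_snd))
      (hm1.inter ((measurableSet_le measurable_const measurable_snd).inter
        (measurableSet_le measurable_snd measurable_const)))
      hm2 hm3
      (Q := Q * S) (B := B * S) (F := F) (M := n * (D * Real.log n)) (K := K * S)
      (c₁ := (8 + 80 * (H + 3)) * S) (by positivity) (by positivity) hF1 (by positivity)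
      (by positivity) (by positivity) hVm hV0 hZ hU1 hU2 hsv ?_ ?_ ?_ ?_ ?_).imp fun W hW => ⟨hW.1, hW.2.1,
        fun z => (hW.2.2 z).trans (add_le_add (hFc _ _ ?_) le_rfl)⟩
    · intro p hp
      refine loss_le_tiltedLoss_add h g hL0 ht₁0.le ?_ (by positivity) ?_ hp
      · rw [hσ₂]
        exact mul_le_mul_of_nonneg_right (by linarith) (Real.exp_pos _).le
      · rcases le_total S n with hSn' | hSn'
        · left
          have : S / n ≤ 1 := (div_le_one hn0).2 hSn'
          have h1 : ρ ≤ 2 := by linarith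
          have : 10 * (H + 3) * ρ ≤ 10 * (H + 3) * 2 :=
            mul_le_mul_of_nonneg_left h1 (by positivity)
          linarith
        · right
          have h1 : n * (8 + 4 * t) = 8 * n + 40 * (H + 3) * (n * ρ) := by rw [ht]; ring
          rw [h1, hnρ]
          have : 40 * (H + 3) * (n + S) ≤ 40 * (H + 3) * (S + S) :=
            mul_le_mul_of_nonneg_left (by linarith) (by positivity)
          linarith
    · refine (mul_le_mul_right hVd _).trans ?_
      rw [← ENNReal.ofReal_mul (by linarith)]
      refine hFc _ _ ?_
      rw [← mul_div_assoc, div_le_iff₀ hd0]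
      have h1 : c ≤ c * ρ := le_mul_of_one_le_right hc0.le hρ1
      have h2 : Real.log n ≤ n := Real.log_le_self hn0.le
      have h3 : 4 * F * K₀ ≤ c := by
        have : 0 ≤ 5 * (|Real.log ((A + 2) / l)| + 1 + 2 * (10 * (H + 3))) := by positivity
        linarith
      linarith
    · refine (mul_le_mul_right hpr _).trans ?_
      rw [← ENNReal.ofReal_mul (by positivity)]
      refine hFc _ _ ?_
      calc _ ≤ Real.exp ((D + 4) * S) * Real.exp (B * S + K * S) * Real.exp (1 - A * S) :=
            mul_le_mul_of_nonneg_right (mul_le_mul_of_nonneg_right hMle (Real.exp_pos _).le)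
              (Real.exp_pos _).le
        _ = Real.exp (1 - 4 * S) := by
            rw [← Real.exp_add, ← Real.exp_add, hA]; congr 1; ring
        _ ≤ Real.exp (-3) := Real.exp_le_exp.2 (by linarith)
        _ ≤ _ := exp_neg_three_le
    · refine (mul_le_mul_right hN1 _).trans ?_
      rw [← ENNReal.ofReal_mul (by positivity)]
      refine hFc _ _ ?_
      calc _ ≤ Real.exp ((D + 4) * S) * Real.exp (B * S + K * S)
              * Real.exp (G * S - H * (n * ρ)) :=
            mul_le_mul_of_nonneg_right (mul_le_mul_of_nonneg_right hMle (Real.exp_pos _).le)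
              (Real.exp_pos _).le
        _ = Real.exp (-(3 * S) - H * n) := by
            rw [← Real.exp_add, ← Real.exp_add, hnρ, hH]; congr 1; ring
        _ ≤ Real.exp (-3) := by
            have : 0 ≤ H * n := by positivity
            exact Real.exp_le_exp.2 (by linarith)
        _ ≤ _ := exp_neg_three_le
    · refine (mul_le_mul_right hVd _).trans ?_
      rw [← ENNReal.ofReal_mul (by positivity)]
      refine hFc _ _ ?_
      have h1 : n * (D * Real.log n) / (K * S) * (K₀ / d)
          = 1 / 16 * ((n / d) * (Real.log n / S)) := by rw [hKdef]; field_simp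
      have h2 : (n : ℝ) / d ≤ 1 := (div_le_one hd0).2 hnd
      have h3 : Real.log n / S ≤ 2 := (div_le_iff₀ (by linarith)).2 hlogn
      have h4 : (n : ℝ) / d * (Real.log n / S) ≤ 1 * 2 :=
        mul_le_mul h2 h3 (by positivity) zero_le_one
      rw [h1]
      linarith
    · have h3 : F * q ≤ F * (q * S) :=
        mul_le_mul_of_nonneg_left (le_mul_of_one_le_right hq0.le hS) (by linarith)
      have h4 : 0 ≤ (2 * (B + q) + E) * S := by positivity
      have h5 : B * S + 5 * (Q * S) + 5 * Real.log (120 * F) + 1 = (B + 5 * Q) * S + q := by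
        rw [hq]; ring
      rw [h5]
      linarith

/-! ### Bounds for the risk -/

/-- The posterior mean of the Rényi divergence is controlled by that of the loss. -/
theorem posteriorRisk_le {n d : ℕ} {α a b C₁ τ σ₀ : ℝ} (ha : 0 < a) (hb : 0 < b) (h0 : 0 < α)
    (h1 : α < 1) (hn : 0 < n) (PX : Measure (EuclideanSpace ℝ (Fin d))) [IsProbabilityMeasure PX]
    (θ₀ : EuclideanSpace ℝ (Fin d)) (hσ : 0 < σ₀) (z : Fin n → ℝ × EuclideanSpace ℝ (Fin d)) :
    posteriorRisk α PX θ₀ σ₀ C₁ τ a b z ≤ ENNReal.ofReal (2 / ((1 - α) * n))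
      * ∫⁻ p, ENNReal.ofReal (n * loss PX (θ₀, σ₀) p) ∂(posterior C₁ τ a b z) := by
  have hα : 0 < 1 - α := by linarith
  have hn' : (0 : ℝ) < n := Nat.cast_pos.2 hn
  have hm : Measurable fun p => ENNReal.ofReal (n * loss PX (θ₀, σ₀) p) :=
    ((measurable_loss PX (θ₀, σ₀)).const_mul _).ennreal_ofReal
  rw [← lintegral_const_mul _ hm]
  refine lintegral_mono_ae ?_
  filter_upwards [ae_pos_posterior (p₀ := (θ₀, σ₀)) ha hb hσ τ z] with p hp
  refine (toENNReal_renyiDiv_le PX (p := p) (q := (θ₀, σ₀)) hp hσ h0 h1).trans (le_of_eq ?_)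
  rw [← ENNReal.ofReal_mul (by positivity)]
  congr 1
  rw [loss]
  field_simp

theorem natCast_mul_rate (c : ℝ) {n : ℕ} (hn : 0 < n) (d s : ℕ) (Cx C₁ : ℝ) :
    n * rate c n d s Cx C₁ = c * complexity n d s Cx C₁ := by
  have hn' : (n : ℝ) ≠ 0 := Nat.cast_ne_zero.2 hn.ne'
  rw [rate, complexity]
  field_simp

/-- Expectation and tail bounds for a risk that is at most a multiple of `x + W` with `E W ≤ 1`. -/
theorem lintegral_le_and_measure_ge {Ω : Type*} [MeasurableSpace Ω] (P : Measure Ω)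
    [IsProbabilityMeasure P] {f W : Ω → ℝ≥0∞} (hW : Measurable W) (hW1 : ∫⁻ z, W z ∂P ≤ 1)
    {κ α x y : ℝ} (hκ : 0 ≤ κ) (hα : 0 ≤ α) (hx : 0 ≤ x) (hxy : 2 * x + 2 ≤ y)
    (hf : ∀ z, f z ≤ ENNReal.ofReal (2 * κ) * (ENNReal.ofReal x + W z)) :
    ∫⁻ z, f z ∂P ≤ ENNReal.ofReal ((1 + α) * κ * y) ∧
      ENNReal.ofReal (1 - 2 / y) ≤ P {z | f z ≤ ENNReal.ofReal (2 * (α + 1) * κ * y)} := by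
  have hκy : 0 ≤ κ * y := mul_nonneg hκ (by linarith)
  constructor
  · refine (lintegral_mono hf).trans ?_
    have hm : Measurable fun z => ENNReal.ofReal x + W z := measurable_const.add hW
    rw [lintegral_const_mul _ hm, lintegral_add_left measurable_const,
      lintegral_const, measure_univ, mul_one]
    refine (mul_le_mul_right (add_le_add_right hW1 _) _).trans ?_
    rw [← ENNReal.ofReal_one, ← ENNReal.ofReal_add hx zero_le_one,
      ← ENNReal.ofReal_mul (by positivity)]
    refine ENNReal.ofReal_le_ofReal ?_
    nlinarith [mul_le_mul_of_nonneg_left hxy hκ, mul_nonneg hα hκy]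
  · have hy : 0 < y := by linarith
    set G := {z | W z ≤ ENNReal.ofReal (y / 2)} with hG
    have hGm : MeasurableSet G := measurableSet_le hW measurable_const
    have hsub : G ⊆ {z | f z ≤ ENNReal.ofReal (2 * (α + 1) * κ * y)} := by
      intro z hz
      refine (hf z).trans ((mul_le_mul_right (add_le_add_right hz _) _).trans ?_)
      rw [← ENNReal.ofReal_add hx (by linarith), ← ENNReal.ofReal_mul (by positivity)]
      refine ENNReal.ofReal_le_ofReal ?_
      nlinarith [mul_le_mul_of_nonneg_left hxy hκ, mul_nonneg hα hκy]
    refine le_trans ?_ (measure_mono hsub)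
    have hGc : P Gᶜ ≤ ENNReal.ofReal (2 / y) := by
      have h1 : Gᶜ ⊆ {z | ENNReal.ofReal (y / 2) ≤ W z} := fun z hz =>
        (not_le.1 (show ¬ W z ≤ ENNReal.ofReal (y / 2) from hz)).le
      have h2 := mul_meas_ge_le_lintegral (μ := P) hW (ENNReal.ofReal (y / 2))
      have h3 : ENNReal.ofReal (y / 2) * P Gᶜ ≤ 1 :=
        ((mul_le_mul_right (measure_mono h1) _).trans h2).trans hW1
      calc P Gᶜ = ENNReal.ofReal (2 / y) * (ENNReal.ofReal (y / 2) * P Gᶜ) := by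
            rw [← mul_assoc, ← ENNReal.ofReal_mul (by positivity),
              div_mul_div_cancel₀ hy.ne', div_self two_ne_zero, ENNReal.ofReal_one, one_mul]
        _ ≤ ENNReal.ofReal (2 / y) * 1 := mul_le_mul_right h3 _
        _ = _ := mul_one _
    rw [ENNReal.ofReal_sub _ (by positivity), ENNReal.ofReal_one, tsub_le_iff_right,
      ← measure_univ (μ := P), ← measure_add_measure_compl hGm]
    exact add_le_add_right hGc _

end SparseReg

end

theorem mainTheorem2 (σmin σmax a b : ℝ) (hσmin : 0 < σmin) (hσmax : 0 < σmax)
    (ha : 0 < a) (hb : 0 < b) :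
    ∃ c : ℝ, 0 < c ∧
      ∀ (n d : ℕ) (Cx C₁ : ℝ) (PX : Measure (EuclideanSpace ℝ (Fin d)))
        (θ₀ : EuclideanSpace ℝ (Fin d)) (σ₀ : ℝ),
        IsProbabilityMeasure PX →
        1 ≤ SparseReg.l0Norm θ₀ → SparseReg.l0Norm θ₀ < n → n < d →
        0 < Cx → ∫⁻ x, ‖x‖ₑ ^ 2 ∂PX < ENNReal.ofReal (Cx ^ 2) →
        0 < σ₀ → (2 * σmin)⁻¹ < σ₀ ^ 2 → σ₀ ^ 2 < (2 * σmax)⁻¹ →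
        SparseReg.l1Norm θ₀ ≤ C₁ - 2 * d * SparseReg.tauScale n d Cx →
        ∀ α : ℝ, 0 < α → α < 1 →
          (∫⁻ z, SparseReg.posteriorRisk α PX θ₀ σ₀ C₁ (SparseReg.tauScale n d Cx) a b z
              ∂(Measure.pi fun _ : Fin n => SparseReg.regModel PX θ₀ σ₀)
            ≤ ENNReal.ofReal
                ((1 + α) / (1 - α) * SparseReg.rate c n d (SparseReg.l0Norm θ₀) Cx C₁)) ∧
          (ENNReal.ofReal (1 - 2 / (n * SparseReg.rate c n d (SparseReg.l0Norm θ₀) Cx C₁))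
            ≤ (Measure.pi fun _ : Fin n => SparseReg.regModel PX θ₀ σ₀)
                {z | SparseReg.posteriorRisk α PX θ₀ σ₀ C₁ (SparseReg.tauScale n d Cx) a b z
                  ≤ ENNReal.ofReal (2 * (α + 1) / (1 - α) *
                      SparseReg.rate c n d (SparseReg.l0Norm θ₀) Cx C₁)}) := by
  obtain ⟨C, hC, hmain⟩ := SparseReg.exists_posterior_loss_le ha hb
    (l := (2 * σmin)⁻¹) (u := (2 * σmax)⁻¹) (by positivity) (by positivity)
  refine ⟨2 * C + 2, by positivity, ?_⟩
  intro n d Cx C₁ PX θ₀ σ₀ hPX hs hsn hnd hCx hmom hσ₀ hσl hσu hnorm α hα0 hα1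
  have h : SparseReg.Regime (2 * σmin)⁻¹ (2 * σmax)⁻¹ n Cx C₁ PX (θ₀, σ₀) :=
    ⟨hPX, hs, hsn, hnd, hCx, hmom.le, hσ₀, hσl.le, hσu.le, hnorm⟩
  have hn : 0 < n := by omega
  have hn' : (0 : ℝ) < n := Nat.cast_pos.2 hn
  have hα : 0 < 1 - α := by linarith
  obtain ⟨W, hWm, hW1, hW⟩ := hmain n d Cx C₁ PX (θ₀, σ₀) h
  have hS : 1 ≤ SparseReg.complexity n d (SparseReg.l0Norm θ₀) Cx C₁ := h.one_le_complexity
  have := SparseReg.isProbabilityMeasure_regModel PX θ₀ σ₀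
  have hrate := SparseReg.natCast_mul_rate (2 * C + 2) hn d (SparseReg.l0Norm θ₀) Cx C₁
  set ε := SparseReg.rate (2 * C + 2) n d (SparseReg.l0Norm θ₀) Cx C₁
  have key := SparseReg.lintegral_le_and_measure_ge
    (Measure.pi fun _ : Fin n => SparseReg.regModel PX θ₀ σ₀) hWm hW1
    (f := SparseReg.posteriorRisk α PX θ₀ σ₀ C₁ (SparseReg.tauScale n d Cx) a b)
    (κ := 1 / ((1 - α) * n)) (α := α) (y := n * ε) (by positivity) hα0.le
    (x := C * SparseReg.complexity n d (SparseReg.l0Norm θ₀) Cx C₁) (by positivity)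
    (by rw [hrate]; linarith) fun z => by
      refine (SparseReg.posteriorRisk_le ha hb hα0 hα1 hn PX θ₀ hσ₀ z).trans ?_
      rw [mul_one_div]
      exact mul_le_mul_right (hW z) _
  have e1 : (1 + α) * (1 / ((1 - α) * n)) * (n * ε) = (1 + α) / (1 - α) * ε := by field_simp
  have e2 : 2 * (α + 1) * (1 / ((1 - α) * n)) * (n * ε) = 2 * (α + 1) / (1 - α) * ε := by
    field_simp
  rw [e1, e2] at key
  exact key
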